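/- Let $\mathbf{CZF}$ be constructive Zermelo–Fraenkel set theory: the theory in intuitionistic first-order logic with equality over the language $\{\in\}$ with the axioms Extensionality, Pairing, Union, Strong Infinity, and the schemes of Set Induction, Bounded ($\Delta_0$) Separation, Strong Collection and Subset Collection. Then $\mathbf{CZF}$ proves the following implication: if elementary NID holds, then the category of set-presented formal spaces has all coequalizers. Here the notions are the following (all of them are understood as formulas of set theory). *Elementary NID.* An elementary rule on a set $X$ is a pair $(a,b)$ of subsets of $X$ with $a$ a singleton. If $\mathcal R$ is a set of rules on $X$, a subset $Y\subseteq X$ is $\mathcal R$-closed if for all $(a,b)\in\mathcal R$: if $a\subseteq Y$, then $b\cap Y$ is inhabited. Elementary NID says: for every set $X$ and every set $\mathcal R$ of elementary rules on $X$ there is a set $G$ of $\mathcal R$-closed subsets of $X$ such that for every $\mathcal R$-closed $\alpha\subseteq X$ and every $x\in\alpha$ there is $\beta\in G$ with $x\in\beta\subseteq\alpha$. *Set-presented formal spaces.* Such a space is given by a preordered set $(\mathbb P,\le)$ and, for each $p\in\mathbb P$, a set $\mathrm{BCov}(p)$ of sieves on $p$ (downwards closed subsets of ${\downarrow}p=\{x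 : x\le p\}$), such that the class relation $\mathrm{Cov}(p)=\{S : S \text{ is a sieve on } p \text{ and } R\subseteq S\text{ for some } R\in\mathrm{BCov}(p)\}$ satisfies: (maximality) ${\downarrow}p\in\mathrm{Cov}(p)$; (stability) if $S\in\mathrm{Cov}(p)$ and $q\le p$, then $S\cap{\downarrow}q\in\mathrm{Cov}(q)$; (local character) if $S\in\mathrm{Cov}(p)$, $R$ is a sieve on $p$, and $R\cap{\downarrow}q\in\mathrm{Cov}(q)$ for all $q\in S$, then $R\in\mathrm{Cov}(p)$. *Morphisms.* A morphism $F:(\mathbb P,\mathrm{Cov})\to(\mathbb Q,\mathrm{Cov}')$ is a relation $F\subseteq\mathbb P\times\mathbb Q$ such that: (1) if $F(p,q)$, $p'\le p$ and $q\le q'$, then $F(p',q')$; (2) if $S\in\mathrm{Cov}(p)$ and $F(p',q)$ for all $p'\in S$, then $F(p,q)$; (3) for every $p\in\mathbb P$ there is $S\in\mathrm{Cov}(p)$ such that each $p'\in S$ is $F$-related to some $q'\in\mathbb Q$; (4) if $F(p,q_0)$ and $F(p,q_1)$, there is $S\in\mathrm{Cov}(p)$ such that each $p'\in S$ is $F$-related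 to some $r$ with $r\le q_0$ and $r\le q_1$; (5) if $F(p,q)$ and $T\in\mathrm{Cov}'(q)$, there is $S\in\mathrm{Cov}(p)$ such that each $p'\in S$ is $F$-related to some $q'\in T$. The composite of $F:\mathbb P\to\mathbb Q$ and $G:\mathbb Q\to\mathbb T$ is given by: $(G\circ F)(p,r)$ if and only if there is $S\in\mathrm{Cov}(p)$ such that for each $p'\in S$ there is $q\in\mathbb Q$ with $F(p',q)$ and $G(q,r)$. *Coequalizers.* The category has all coequalizers if for all set-presented formal spaces $A,B$ and all morphisms $F,G:A\to B$ there are a set-presented formal space $C$ and a morphism $E:B\to C$ with $E\circ F=E\circ G$ such that for every set-presented formal space $D$ and every morphism $K:B\to D$ with $K\circ F=K\circ G$ there is a unique morphism $L:C\to D$ with $L\circ E=K$. -/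

import Mathlib

namespace CZF

/-! ## Intuitionistic first-order logic with equality over the language of set theory -/

/-- Formulas over `∈` and `=`, with de Bruijn indices: `all` and `ex` bind the index `0`. The only
terms are variables. -/
inductive Fml : Type
  | bot : Fml
  | mem : ℕ → ℕ → Fml
  | eq : ℕ → ℕ → Fml
  | and : Fml → Fml → Fml
  | or : Fml → Fml → Fml
  | imp : Fml → Fml → Fml
  | all : Fml → Fml
  | ex : Fml → Fml

/-- A map of variables, pushed under one binder. -/
def lift (σ : ℕ → ℕ) : ℕ → ℕ
  | 0 => 0
  | k + 1 => σ k + 1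

/-- Simultaneous (capture-avoiding) substitution of variables for the free variables. -/
def Fml.ren : Fml → (ℕ → ℕ) → Fml
  | .bot, _ => .bot
  | .mem i j, σ => .mem (σ i) (σ j)
  | .eq i j, σ => .eq (σ i) (σ j)
  | .and φ ψ, σ => .and (φ.ren σ) (ψ.ren σ)
  | .or φ ψ, σ => .or (φ.ren σ) (ψ.ren σ)
  | .imp φ ψ, σ => .imp (φ.ren σ) (ψ.ren σ)
  | .all φ, σ => .all (φ.ren (lift σ))
  | .ex φ, σ => .ex (φ.ren (lift σ))

/-- Weakening: all free variables move up by one, so that `0` is fresh. -/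
def Fml.shift (φ : Fml) : Fml := φ.ren Nat.succ

/-- `φ[t/0]`: the variable `t` for index `0`, the other free variables move down by one. -/
def Fml.inst (φ : Fml) (t : ℕ) : Fml :=
  φ.ren fun k => match k with
    | 0 => t
    | k + 1 => k

/-- Natural deduction for intuitionistic predicate logic with equality. `Prf T Γ φ`: from the axioms
`T` and the assumptions `Γ` one derives `φ`. An axiom with free variables stands for its universal
closure. -/
inductive Prf (T : Set Fml) : List Fml → Fml → Prop
  | ax {Γ : List Fml} {φ : Fml} : φ ∈ T → Prf T Γ φ
  | hyp {Γ : List Fml} {φ : Fml} : φ ∈ Γ → Prf T Γ φ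
  | botE {Γ : List Fml} {φ : Fml} : Prf T Γ .bot → Prf T Γ φ
  | andI {Γ : List Fml} {φ ψ : Fml} : Prf T Γ φ → Prf T Γ ψ → Prf T Γ (.and φ ψ)
  | andE₁ {Γ : List Fml} {φ ψ : Fml} : Prf T Γ (.and φ ψ) → Prf T Γ φ
  | andE₂ {Γ : List Fml} {φ ψ : Fml} : Prf T Γ (.and φ ψ) → Prf T Γ ψ
  | orI₁ {Γ : List Fml} {φ ψ : Fml} : Prf T Γ φ → Prf T Γ (.or φ ψ)
  | orI₂ {Γ : List Fml} {φ ψ : Fml} : Prf T Γ ψ → Prf T Γ (.or φ ψ)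
  | orE {Γ : List Fml} {φ ψ χ : Fml} :
      Prf T Γ (.or φ ψ) → Prf T (φ :: Γ) χ → Prf T (ψ :: Γ) χ → Prf T Γ χ
  | impI {Γ : List Fml} {φ ψ : Fml} : Prf T (φ :: Γ) ψ → Prf T Γ (.imp φ ψ)
  | impE {Γ : List Fml} {φ ψ : Fml} : Prf T Γ (.imp φ ψ) → Prf T Γ φ → Prf T Γ ψ
  | allI {Γ : List Fml} {φ : Fml} : Prf T (Γ.map Fml.shift) φ → Prf T Γ (.all φ)
  | allE {Γ : List Fml} {φ : Fml} (t : ℕ) : Prf T Γ (.all φ) → Prf T Γ (φ.inst t)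
  | exI {Γ : List Fml} {φ : Fml} (t : ℕ) : Prf T Γ (φ.inst t) → Prf T Γ (.ex φ)
  | exE {Γ : List Fml} {φ ψ : Fml} :
      Prf T Γ (.ex φ) → Prf T (φ :: Γ.map Fml.shift) ψ.shift → Prf T Γ ψ
  | eqI {Γ : List Fml} (t : ℕ) : Prf T Γ (.eq t t)
  | eqE {Γ : List Fml} {φ : Fml} (s t : ℕ) :
      Prf T Γ (.eq s t) → Prf T Γ (φ.inst s) → Prf T Γ (φ.inst t)

/-- `φ` is a theorem of the theory `T`. -/
def Provable (T : Set Fml) (φ : Fml) : Prop := Prf T [] φ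

/-- Bounded (that is, `Δ₀`) formulas: every quantifier has the form `∀ x ∈ y` or `∃ x ∈ y`. -/
inductive IsBounded : Fml → Prop
  | bot : IsBounded .bot
  | mem (i j : ℕ) : IsBounded (.mem i j)
  | eq (i j : ℕ) : IsBounded (.eq i j)
  | and {φ ψ : Fml} : IsBounded φ → IsBounded ψ → IsBounded (.and φ ψ)
  | or {φ ψ : Fml} : IsBounded φ → IsBounded ψ → IsBounded (.or φ ψ)
  | imp {φ ψ : Fml} : IsBounded φ → IsBounded ψ → IsBounded (.imp φ ψ)
  | all {φ : Fml} (y : ℕ) : IsBounded φ → IsBounded (.all (.imp (.mem 0 (y + 1)) φ))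
  | ex {φ : Fml} (y : ℕ) : IsBounded φ → IsBounded (.ex (.and (.mem 0 (y + 1)) φ))

/-! ## Writing formulas with named bound variables

A bound variable is named by its level, the number of binders above the one that binds it, and a
formula is written as a function of the number `d` of binders that it stands under. Level `x` is
then de Bruijn index `d - 1 - x`. `close` yields the formula itself. -/

abbrev Var := ℕ

abbrev Pre := ℕ → Fml

def Pre.close (φ : Pre) : Fml := φ 0

def Bot : Pre := fun _ => .bot
def Mem (x y : Var) : Pre := fun d => .mem (d - 1 - x) (d - 1 - y)
def Eql (x y : Var) : Pre := fun d => .eq (d - 1 - x) (d - 1 - y)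
def Conj (φ ψ : Pre) : Pre := fun d => .and (φ d) (ψ d)
def Disj (φ ψ : Pre) : Pre := fun d => .or (φ d) (ψ d)
def Impl (φ ψ : Pre) : Pre := fun d => .imp (φ d) (ψ d)
def Bicond (φ ψ : Pre) : Pre := Conj (Impl φ ψ) (Impl ψ φ)
def All (f : Var → Pre) : Pre := fun d => .all (f d (d + 1))
def Ex (f : Var → Pre) : Pre := fun d => .ex (f d (d + 1))

/-- `φ(x₀, …, xₙ₋₁)`, where `φ` is an arbitrary formula: the indices `0, …, n - 1` of `φ` become
the bound variables `x₀, …, xₙ₋₁`; the further free variables of `φ` are parameters and stay free. -/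
def Fml.app (φ : Fml) (xs : List Var) : Pre := fun d =>
  φ.ren fun k => (xs.map fun x => d - 1 - x).getD k (k - xs.length + d)

infix:55 " ∈ᶠ " => Mem
infix:55 " =ᶠ " => Eql
infixr:45 " ∧ᶠ " => Conj
infixr:40 " ∨ᶠ " => Disj
infixr:35 " ⇒ᶠ " => Impl
infix:30 " ⇔ᶠ " => Bicond

/-- `∀ x ∈ a, f x`. -/
def AllIn (a : Var) (f : Var → Pre) : Pre := All fun x => x ∈ᶠ a ⇒ᶠ f x

/-- `∃ x ∈ a, f x`. -/
def ExIn (a : Var) (f : Var → Pre) : Pre := Ex fun x => x ∈ᶠ a ∧ᶠ f x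

/-! ## The axioms of constructive Zermelo–Fraenkel set theory -/

def extensionality : Pre :=
  All fun a => All fun b => (All fun x => x ∈ᶠ a ⇔ᶠ x ∈ᶠ b) ⇒ᶠ a =ᶠ b

def pairing : Pre :=
  All fun a => All fun b => Ex fun c => All fun x => x ∈ᶠ c ⇔ᶠ (x =ᶠ a ∨ᶠ x =ᶠ b)

def union : Pre :=
  All fun a => Ex fun b => All fun x => x ∈ᶠ b ⇔ᶠ ExIn a fun y => x ∈ᶠ y

/-- `a` is inductive: `∅ ∈ a`, and `x ∪ {x} ∈ a` for all `x ∈ a`. -/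
def Inductive (a : Var) : Pre :=
  (ExIn a fun e => All fun x => x ∈ᶠ e ⇒ᶠ Bot) ∧ᶠ
  AllIn a fun x => ExIn a fun s => All fun y => y ∈ᶠ s ⇔ᶠ (y ∈ᶠ x ∨ᶠ y =ᶠ x)

def strongInfinity : Pre :=
  Ex fun a => Inductive a ∧ᶠ All fun b => Inductive b ⇒ᶠ AllIn a fun x => x ∈ᶠ b

def setInduction (φ : Fml) : Pre :=
  (All fun a => (AllIn a fun x => φ.app [x]) ⇒ᶠ φ.app [a]) ⇒ᶠ All fun a => φ.app [a]

/-- An axiom only if `φ` is bounded. -/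
def separation (φ : Fml) : Pre :=
  All fun a => Ex fun b => All fun x => x ∈ᶠ b ⇔ᶠ (x ∈ᶠ a ∧ᶠ φ.app [x])

def strongCollection (φ : Fml) : Pre :=
  All fun a => (AllIn a fun x => Ex fun y => φ.app [x, y]) ⇒ᶠ
    Ex fun b => (AllIn a fun x => ExIn b fun y => φ.app [x, y]) ∧ᶠ
      AllIn b fun y => ExIn a fun x => φ.app [x, y]

def subsetCollection (φ : Fml) : Pre :=
  All fun a => All fun b => Ex fun c => All fun u =>
    (AllIn a fun x => ExIn b fun y => φ.app [x, y, u]) ⇒ᶠ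
      ExIn c fun d => (AllIn a fun x => ExIn d fun y => φ.app [x, y, u]) ∧ᶠ
        AllIn d fun y => ExIn a fun x => φ.app [x, y, u]

/-- The theory **CZF**. -/
inductive Axioms : Set Fml
  | extensionality : Axioms extensionality.close
  | pairing : Axioms pairing.close
  | union : Axioms union.close
  | strongInfinity : Axioms strongInfinity.close
  | setInduction (φ : Fml) : Axioms (setInduction φ).close
  | boundedSeparation (φ : Fml) : IsBounded φ → Axioms (separation φ).close
  | strongCollection (φ : Fml) : Axioms (strongCollection φ).close
  | subsetCollection (φ : Fml) : Axioms (subsetCollection φ).close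

/-! ## Elementary set-theoretic notions -/

/-- `a ⊆ b`. -/
def Sub (a b : Var) : Pre := AllIn a fun x => x ∈ᶠ b

/-- `z = {x, y}`. -/
def IsUPair (z x y : Var) : Pre :=
  x ∈ᶠ z ∧ᶠ y ∈ᶠ z ∧ᶠ AllIn z fun w => w =ᶠ x ∨ᶠ w =ᶠ y

/-- `p = ⟨x, y⟩ = {{x}, {x, y}}`. -/
def IsPair (p x y : Var) : Pre :=
  (ExIn p fun s => IsUPair s x x) ∧ᶠ (ExIn p fun t => IsUPair t x y) ∧ᶠ
  AllIn p fun s => IsUPair s x x ∨ᶠ IsUPair s x y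

/-- `⟨x, y⟩ ∈ r`. -/
def Rel (r x y : Var) : Pre := ExIn r fun p => IsPair p x y

/-- `r ⊆ a × b`. -/
def SubProd (r a b : Var) : Pre :=
  AllIn r fun p => ExIn a fun x => ExIn b fun y => IsPair p x y

/-! ## Elementary non-deterministic inductive definitions -/

/-- `R` is a set of elementary rules on `X`: pairs `⟨a, b⟩` of subsets of `X` with `a` a
singleton. -/
def ElementaryRules (X R : Var) : Pre :=
  AllIn R fun r => Ex fun a => Ex fun b =>
    IsPair r a b ∧ᶠ Sub a X ∧ᶠ Sub b X ∧ᶠ Ex fun x => IsUPair a x x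

/-- `Y` is an `R`-closed subset of `X`: if `⟨a, b⟩ ∈ R` and `a ⊆ Y`, then `b ∩ Y` is inhabited. -/
def Closed (X R Y : Var) : Pre :=
  Sub Y X ∧ᶠ All fun a => All fun b => Rel R a b ⇒ᶠ Sub a Y ⇒ᶠ ExIn b fun x => x ∈ᶠ Y

/-- Elementary NID: for every set `R` of elementary rules on a set `X`, the class of `R`-closed
subsets of `X` is set-generated. -/
def elementaryNID : Pre :=
  All fun X => All fun R => ElementaryRules X R ⇒ᶠ
    Ex fun G => (AllIn G fun β => Closed X R β) ∧ᶠ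
      All fun α => Closed X R α ⇒ᶠ AllIn α fun x => ExIn G fun β => x ∈ᶠ β ∧ᶠ Sub β α

/-! ## Set-presented formal spaces -/

/-- The (variables for the) data of a set-presented formal space: the underlying set `pt`, the order
`le` as a set of pairs, and the presentation `bcov`, as the set of all pairs `⟨p, R⟩` with
`R ∈ BCov(p)`. -/
structure Sp where
  pt : Var
  le : Var
  bcov : Var

/-- `x ≤ y`. -/
def Sp.Le (A : Sp) (x y : Var) : Pre := Rel A.le x y

/-- `S` is a sieve on `p`: a downwards closed subset of `↓p`. -/
def Sp.Sieve (A : Sp) (S p : Var) : Pre :=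
  AllIn S fun x => x ∈ᶠ A.pt ∧ᶠ A.Le x p ∧ᶠ AllIn A.pt fun y => A.Le y x ⇒ᶠ y ∈ᶠ S

/-- `S ∈ Cov(p)`: `S` is a sieve on `p` that contains some `R ∈ BCov(p)`. -/
def Sp.Cov (A : Sp) (S p : Var) : Pre :=
  A.Sieve S p ∧ᶠ Ex fun R => Rel A.bcov p R ∧ᶠ Sub R S

/-- `S' = S ∩ ↓q`. -/
def Sp.IsRestr (A : Sp) (S' S q : Var) : Pre :=
  All fun x => x ∈ᶠ S' ⇔ᶠ (x ∈ᶠ S ∧ᶠ A.Le x q)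

/-- `≤` is a preorder on `pt`. -/
def Sp.IsPreorder (A : Sp) : Pre :=
  SubProd A.le A.pt A.pt ∧ᶠ
  (AllIn A.pt fun x => A.Le x x) ∧ᶠ
  All fun x => All fun y => All fun z => A.Le x y ⇒ᶠ A.Le y z ⇒ᶠ A.Le x z

/-- `BCov` assigns to each `p` a set of sieves on `p`. -/
def Sp.IsBCov (A : Sp) : Pre :=
  AllIn A.bcov fun b => ExIn A.pt fun p => Ex fun R => IsPair b p R ∧ᶠ A.Sieve R p

/-- `↓p ∈ Cov(p)`. -/
def Sp.Maximality (A : Sp) : Pre :=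
  AllIn A.pt fun p => All fun S => (All fun x => x ∈ᶠ S ⇔ᶠ A.Le x p) ⇒ᶠ A.Cov S p

/-- If `S ∈ Cov(p)` and `q ≤ p`, then `S ∩ ↓q ∈ Cov(q)`. -/
def Sp.Stability (A : Sp) : Pre :=
  AllIn A.pt fun p => All fun S => A.Cov S p ⇒ᶠ AllIn A.pt fun q => A.Le q p ⇒ᶠ
    All fun S' => A.IsRestr S' S q ⇒ᶠ A.Cov S' q

/-- If `S ∈ Cov(p)` and `R` is a sieve on `p` with `R ∩ ↓q ∈ Cov(q)` for all `q ∈ S`, then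
`R ∈ Cov(p)`. -/
def Sp.LocalCharacter (A : Sp) : Pre :=
  AllIn A.pt fun p => All fun S => A.Cov S p ⇒ᶠ All fun R => A.Sieve R p ⇒ᶠ
    (AllIn S fun q => All fun R' => A.IsRestr R' R q ⇒ᶠ A.Cov R' q) ⇒ᶠ A.Cov R p

/-- `A` is a set-presented formal space. -/
def Sp.IsFormalSpace (A : Sp) : Pre :=
  A.IsPreorder ∧ᶠ A.IsBCov ∧ᶠ A.Maximality ∧ᶠ A.Stability ∧ᶠ A.LocalCharacter

def AllSp (f : Sp → Pre) : Pre := All fun P => All fun L => All fun B => f ⟨P, L, B⟩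

def ExSp (f : Sp → Pre) : Pre := Ex fun P => Ex fun L => Ex fun B => f ⟨P, L, B⟩

/-- `F` is a continuous map (a morphism of formal spaces) from `A` to `B`. -/
def IsMor (A B : Sp) (F : Var) : Pre :=
  SubProd F A.pt B.pt ∧ᶠ
  (All fun p => All fun q => All fun p' => All fun q' =>
    Rel F p q ⇒ᶠ A.Le p' p ⇒ᶠ B.Le q q' ⇒ᶠ Rel F p' q') ∧ᶠ
  (AllIn B.pt fun q => AllIn A.pt fun p => All fun S =>
    A.Cov S p ⇒ᶠ (AllIn S fun p' => Rel F p' q) ⇒ᶠ Rel F p q) ∧ᶠ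
  (AllIn A.pt fun p => Ex fun S => A.Cov S p ∧ᶠ
    AllIn S fun p' => ExIn B.pt fun q' => Rel F p' q') ∧ᶠ
  (AllIn B.pt fun q₀ => AllIn B.pt fun q₁ => AllIn A.pt fun p =>
    Rel F p q₀ ⇒ᶠ Rel F p q₁ ⇒ᶠ Ex fun S => A.Cov S p ∧ᶠ
      AllIn S fun p' => ExIn B.pt fun r => B.Le r q₀ ∧ᶠ B.Le r q₁ ∧ᶠ Rel F p' r) ∧ᶠ
  (AllIn A.pt fun p => AllIn B.pt fun q => Rel F p q ⇒ᶠ All fun T => B.Cov T q ⇒ᶠ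
    Ex fun S => A.Cov S p ∧ᶠ AllIn S fun p' => ExIn T fun q' => Rel F p' q')

/-- `⟨p, r⟩ ∈ G ∘ F`, for `F : A ⟶ B` and `G : B ⟶ C`: there is a cover `S ∈ Cov(p)` such that
every `p' ∈ S` has some `q` with `F(p', q)` and `G(q, r)`. -/
def CompRel (A B : Sp) (F G p r : Var) : Pre :=
  Ex fun S => A.Cov S p ∧ᶠ
    AllIn S fun p' => ExIn B.pt fun q => Rel F p' q ∧ᶠ Rel G q r

/-- `E ∘ F = E ∘ G`, for `F, G : A ⟶ B` and `E : B ⟶ C`. -/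
def Coequalizes (A B C : Sp) (F G E : Var) : Pre :=
  AllIn A.pt fun p => AllIn C.pt fun r => CompRel A B F E p r ⇔ᶠ CompRel A B G E p r

/-- `L ∘ E = K`, for `E : B ⟶ C`, `L : C ⟶ D` and `K : B ⟶ D`. -/
def Factors (B C D : Sp) (E L K : Var) : Pre :=
  AllIn B.pt fun q => AllIn D.pt fun r => CompRel B C E L q r ⇔ᶠ Rel K q r

/-- `E : B ⟶ C` is a coequalizer of `F, G : A ⟶ B` in the category of set-presented formal
spaces. -/
def IsCoequalizer (A B C : Sp) (F G E : Var) : Pre :=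
  IsMor B C E ∧ᶠ Coequalizes A B C F G E ∧ᶠ
  AllSp fun D => D.IsFormalSpace ⇒ᶠ All fun K => IsMor B D K ⇒ᶠ Coequalizes A B D F G K ⇒ᶠ
    Ex fun L => (IsMor C D L ∧ᶠ Factors B C D E L K) ∧ᶠ
      All fun L' => IsMor C D L' ⇒ᶠ Factors B C D E L' K ⇒ᶠ L' =ᶠ L

/-- The category of set-presented formal spaces has all coequalizers. -/
def hasCoequalizers : Pre :=
  AllSp fun A => A.IsFormalSpace ⇒ᶠ AllSp fun B => B.IsFormalSpace ⇒ᶠ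
    All fun F => IsMor A B F ⇒ᶠ All fun G => IsMor A B G ⇒ᶠ
      ExSp fun C => C.IsFormalSpace ∧ᶠ Ex fun E => IsCoequalizer A B C F G E

end CZF

namespace CZF

set_option linter.unusedSimpArgs false

/-! ## Renaming of variables -/

namespace Fml

/-! An open set of the coequalizer of `F, G : A → B` should be a downset `U` of `B` whose inverse
images under `F` and `G` agree: if `q ∈ U` and `F(p, q)`, then on a cover of `p` every point is
`G`-related to a member of `U`, and the same with `F` and `G` exchanged. The obstacle is size. These
`U` form a class, while a space needs a set of points, so a generating set of them is required. The
closure condition reads "from `q` infer some basic cover `j` of `p`, all of whose members have a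
partner in `U`". This is not an elementary rule, but it splits into elementary rules once the covers
are adjoined as new elements: `q` yields some `j`, and `j` yields, for each `p' ∈ j`, some partner.
Elementary NID generates the closed sets of the enlarged system, and their traces generate the open
sets (`exists_generates`, `exists_generates_coequalizer`).

The generators, ordered by inclusion, are the points of the coequalizer `C`; a sieve of them covers
`U` when its members cover `U` in `B`. Presenting these covers by a set is again a matter of
two-step rules, and a second use of `exists_generates` does it (`exists_space`). The axioms of a
formal space follow from a small calculus of "true on a cover" (`loc_mono`, `loc_stable`,
`loc_bind`). The universal property is the topological one: if `K` coequalizes `F` and `G`, the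
inverse images of its basic opens are open (`isCompatible_coequalizer`), and `K` factors uniquely
through the relation "`U` is contained in the inverse image of `r`" (`factors_of_isFactor`,
`isMor_of_isFactor`, `eq_of_factors`).

Formal derivations are not written out. Worlds are formulas ordered by derivability in the theory,
and forcing a formula at a world amounts to deriving it from that world (`forces_eval_iff`). Truth
values are sheaves, so an existential statement may be used by passing to a stronger world that has
a witness; arguments inside a `SetModel` thus read like ordinary intuitionistic set theory. Of the
axioms only Extensionality, Pairing, Union, Bounded Separation and Strong Collection are needed. -/

theorem lift_comp (σ τ : ℕ → ℕ) : lift (σ ∘ τ) = lift σ ∘ lift τ := by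
  funext k; cases k <;> rfl

theorem lift_id : lift id = id := by
  funext k; cases k <;> rfl

theorem ren_ren (φ : Fml) (σ τ : ℕ → ℕ) : (φ.ren τ).ren σ = φ.ren (σ ∘ τ) := by
  induction φ generalizing σ τ <;> simp_all [ren, lift_comp]

theorem ren_id (φ : Fml) : φ.ren id = φ := by
  induction φ <;> simp_all [ren, lift_id]

/-- A strict upper bound for the free variables. -/
def bound : Fml → ℕ
  | .bot => 0
  | .mem i j => max i j + 1
  | .eq i j => max i j + 1
  | .and φ ψ => max φ.bound ψ.bound
  | .or φ ψ => max φ.bound ψ.bound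
  | .imp φ ψ => max φ.bound ψ.bound
  | .all φ => φ.bound - 1
  | .ex φ => φ.bound - 1

theorem ren_congr {φ : Fml} {σ τ : ℕ → ℕ} (h : ∀ k < φ.bound, σ k = τ k) :
    φ.ren σ = φ.ren τ := by
  have key : ∀ (ψ : Fml) (σ τ : ℕ → ℕ), (∀ k < ψ.bound - 1, σ k = τ k) →
      ∀ k < ψ.bound, lift σ k = lift τ k := by
    intro ψ σ τ h k hk
    cases k with
    | zero => rfl
    | succ k => simp [lift, h k (by omega)]
  induction φ generalizing σ τ with
  | bot => rfl
  | mem i j => simp only [bound] at h; simp [ren, h i (by omega), h j (by omega)]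
  | eq i j => simp only [bound] at h; simp [ren, h i (by omega), h j (by omega)]
  | and φ ψ ih₁ ih₂ | or φ ψ ih₁ ih₂ | imp φ ψ ih₁ ih₂ =>
    simp only [bound] at h
    simp only [ren]
    rw [ih₁ fun k hk => h k (by omega), ih₂ fun k hk => h k (by omega)]
  | all φ ih | ex φ ih =>
    simp only [bound] at h
    simp only [ren]
    rw [ih (key _ _ _ h)]

theorem inst_eq (φ : Fml) (t : ℕ) :
    φ.inst t = φ.ren fun k => match k with | 0 => t | k + 1 => k := rfl

theorem shift_ren (φ : Fml) (σ : ℕ → ℕ) : φ.shift.ren (lift σ) = (φ.ren σ).shift := by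
  simp only [shift, ren_ren]; rfl

theorem inst_ren (φ : Fml) (t : ℕ) (σ : ℕ → ℕ) :
    (φ.inst t).ren σ = (φ.ren (lift σ)).inst (σ t) := by
  simp only [inst_eq, ren_ren]
  congr 1; funext k; cases k <;> rfl

end Fml

namespace Prf

variable {T : Set Fml} {Γ Δ : List Fml} {φ ψ χ : Fml}

theorem weaken (h : Prf T Γ φ) (hΓ : Γ ⊆ Δ) : Prf T Δ φ := by
  induction h generalizing Δ with
  | ax h => exact .ax h
  | hyp h => exact .hyp (hΓ h)
  | botE _ ih => exact .botE (ih hΓ)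
  | andI _ _ ih₁ ih₂ => exact .andI (ih₁ hΓ) (ih₂ hΓ)
  | andE₁ _ ih => exact .andE₁ (ih hΓ)
  | andE₂ _ ih => exact .andE₂ (ih hΓ)
  | orI₁ _ ih => exact .orI₁ (ih hΓ)
  | orI₂ _ ih => exact .orI₂ (ih hΓ)
  | orE _ _ _ ih ih₁ ih₂ =>
    exact .orE (ih hΓ) (ih₁ (List.cons_subset_cons _ hΓ)) (ih₂ (List.cons_subset_cons _ hΓ))
  | impI _ ih => exact .impI (ih (List.cons_subset_cons _ hΓ))
  | impE _ _ ih₁ ih₂ => exact .impE (ih₁ hΓ) (ih₂ hΓ)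
  | allI _ ih => exact .allI (ih (List.map_subset _ hΓ))
  | allE t _ ih => exact .allE t (ih hΓ)
  | exI t _ ih => exact .exI t (ih hΓ)
  | exE _ _ ih₁ ih₂ =>
    exact .exE (ih₁ hΓ) (ih₂ (List.cons_subset_cons _ (List.map_subset _ hΓ)))
  | eqI t => exact .eqI t
  | eqE s t _ _ ih₁ ih₂ => exact .eqE s t (ih₁ hΓ) (ih₂ hΓ)

theorem cut (h₁ : Prf T Γ φ) (h₂ : Prf T (φ :: Γ) ψ) : Prf T Γ ψ := .impE (.impI h₂) h₁

theorem cut_singleton (h₁ : Prf T Γ φ) (h₂ : Prf T [φ] ψ) : Prf T Γ ψ :=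
  h₁.cut (h₂.weaken (by simp))

/-- Axioms may contain free parameters, hence the closure hypothesis on `T`. The purpose is to trade
a named fresh variable for index `0` in the quantifier rules. -/
theorem rename (hT : ∀ φ ∈ T, ∀ σ, φ.ren σ ∈ T) (h : Prf T Γ φ) (σ : ℕ → ℕ) :
    Prf T (Γ.map (·.ren σ)) (φ.ren σ) := by
  have hmap : ∀ (Γ : List Fml) (σ : ℕ → ℕ),
      (Γ.map Fml.shift).map (·.ren (lift σ)) = (Γ.map (·.ren σ)).map Fml.shift := by
    intro Γ σ; simp [Fml.shift_ren]
  induction h generalizing σ with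
  | ax h => exact .ax (hT _ h σ)
  | hyp h => exact .hyp (List.mem_map_of_mem h)
  | botE _ ih => exact .botE (ih σ)
  | andI _ _ ih₁ ih₂ => exact .andI (ih₁ σ) (ih₂ σ)
  | andE₁ _ ih => exact .andE₁ (ih σ)
  | andE₂ _ ih => exact .andE₂ (ih σ)
  | orI₁ _ ih => exact .orI₁ (ih σ)
  | orI₂ _ ih => exact .orI₂ (ih σ)
  | orE _ _ _ ih ih₁ ih₂ => exact .orE (ih σ) (ih₁ σ) (ih₂ σ)
  | impI _ ih => exact .impI (ih σ)
  | impE _ _ ih₁ ih₂ => exact .impE (ih₁ σ) (ih₂ σ)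
  | allI _ ih => exact .allI (by simpa only [hmap] using ih (lift σ))
  | allE t _ ih => rw [Fml.inst_ren]; exact .allE _ (ih σ)
  | exI t _ ih => exact .exI (σ t) (by simpa only [Fml.inst_ren] using ih σ)
  | exE _ _ ih₁ ih₂ =>
    refine .exE (ih₁ σ) ?_
    have := ih₂ (lift σ)
    rwa [List.map_cons, hmap, Fml.shift_ren] at this
  | eqI t => exact .eqI _
  | eqE s t _ _ ih₁ ih₂ =>
    rw [Fml.inst_ren]
    exact .eqE (σ s) (σ t) (ih₁ σ) (by simpa only [Fml.inst_ren] using ih₂ σ)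

/-- The renaming that turns the fresh variable `t` into index `0` and shifts the others. -/
def abstr (t : ℕ) : ℕ → ℕ := fun k => if k = t then 0 else k + 1

theorem ren_abstr (h : φ.bound ≤ t) : φ.ren (abstr t) = φ.shift :=
  Fml.ren_congr fun k hk => by simp [abstr, show k ≠ t by omega]

theorem inst_ren_abstr (h : φ.bound ≤ t) : (φ.inst t).ren (abstr t) = φ := by
  rw [Fml.inst_eq, Fml.ren_ren]
  conv_rhs => rw [← φ.ren_id]
  refine Fml.ren_congr fun k hk => ?_
  cases k with
  | zero => simp [abstr]
  | succ k => simp [abstr, show k ≠ t by omega]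

/-- Renaming by `abstr t` acts as the shift on formulas whose variables lie below `t`, and undoes
the instantiation at `t`; so a derivation with eigenvariable `t` becomes a premise of `allI`. -/
theorem allI_fresh (hT : ∀ φ ∈ T, ∀ σ, φ.ren σ ∈ T) (hψ : ψ.bound ≤ t) (hφ : φ.bound ≤ t)
    (h : Prf T [ψ] (φ.inst t)) : Prf T [ψ] (.all φ) := by
  have := h.rename hT (abstr t)
  rw [inst_ren_abstr hφ, List.map_singleton, ren_abstr hψ] at this
  exact .allI this

theorem exE_fresh (hT : ∀ φ ∈ T, ∀ σ, φ.ren σ ∈ T) (hψ : ψ.bound ≤ t) (hφ : φ.bound ≤ t)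
    (hχ : χ.bound ≤ t) (he : Prf T [ψ] (.ex φ)) (h : Prf T [φ.inst t, ψ] χ) : Prf T [ψ] χ := by
  have := h.rename hT (abstr t)
  rw [List.map_cons, List.map_singleton, inst_ren_abstr hφ, ren_abstr hψ, ren_abstr hχ] at this
  exact .exE he this

end Prf

/-! ## The axioms are closed under renaming -/

theorem IsBounded.ren {φ : Fml} (h : IsBounded φ) (σ : ℕ → ℕ) : IsBounded (φ.ren σ) := by
  induction h generalizing σ with
  | bot => exact .bot
  | mem i j => exact .mem _ _
  | eq i j => exact .eq _ _
  | and _ _ ih₁ ih₂ => exact .and (ih₁ σ) (ih₂ σ)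
  | or _ _ ih₁ ih₂ => exact .or (ih₁ σ) (ih₂ σ)
  | imp _ _ ih₁ ih₂ => exact .imp (ih₁ σ) (ih₂ σ)
  | all y _ ih => exact .all (σ y) (ih _)
  | ex y _ ih => exact .ex (σ y) (ih _)

/-- Renaming an instance of a scheme only changes the parameters of its formula; each argument place
that the scheme binds is protected by one `lift`. -/
theorem Axioms.ren {φ : Fml} (h : φ ∈ Axioms) (σ : ℕ → ℕ) : φ.ren σ ∈ Axioms := by
  cases h with
  | extensionality => exact .extensionality
  | pairing => exact .pairing
  | union => exact .union
  | strongInfinity => exact .strongInfinity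
  | setInduction φ =>
    have : (CZF.setInduction φ).close.ren σ = (CZF.setInduction (φ.ren (lift σ))).close := by
      simp only [Pre.close, CZF.setInduction, Impl, All, AllIn, Ex, ExIn, Bicond, Conj, Mem, Fml.app,
        Fml.ren, Fml.ren_ren, Fml.all.injEq, Fml.ex.injEq, Fml.imp.injEq, Fml.and.injEq, Fml.mem.injEq]
      and_intros <;> first
        | rfl
        | exact Fml.ren_congr fun k _ => by rcases k with _ | k <;> rfl
    exact this ▸ .setInduction _
  | boundedSeparation φ hφ =>
    have : (CZF.separation φ).close.ren σ = (CZF.separation (φ.ren (lift σ))).close := by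
      simp only [Pre.close, CZF.separation, Impl, All, AllIn, Ex, ExIn, Bicond, Conj, Mem, Fml.app,
        Fml.ren, Fml.ren_ren, Fml.all.injEq, Fml.ex.injEq, Fml.imp.injEq, Fml.and.injEq, Fml.mem.injEq]
      and_intros <;> first
        | rfl
        | exact Fml.ren_congr fun k _ => by rcases k with _ | k <;> rfl
    exact this ▸ .boundedSeparation _ (hφ.ren _)
  | strongCollection φ =>
    have : (CZF.strongCollection φ).close.ren σ =
        (CZF.strongCollection (φ.ren (lift (lift σ)))).close := by
      simp only [Pre.close, CZF.strongCollection, Impl, All, AllIn, Ex, ExIn, Bicond, Conj, Mem, Fml.app,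
        Fml.ren, Fml.ren_ren, Fml.all.injEq, Fml.ex.injEq, Fml.imp.injEq, Fml.and.injEq, Fml.mem.injEq]
      and_intros <;> first
        | rfl
        | exact Fml.ren_congr fun k _ => by rcases k with _ | _ | k <;> rfl
    exact this ▸ .strongCollection _
  | subsetCollection φ =>
    have : (CZF.subsetCollection φ).close.ren σ =
        (CZF.subsetCollection (φ.ren (lift (lift (lift σ))))).close := by
      simp only [Pre.close, CZF.subsetCollection, Impl, All, AllIn, Ex, ExIn, Bicond, Conj, Mem, Fml.app,
        Fml.ren, Fml.ren_ren, Fml.all.injEq, Fml.ex.injEq, Fml.imp.injEq, Fml.and.injEq, Fml.mem.injEq]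
      and_intros <;> first
        | rfl
        | exact Fml.ren_congr fun k _ => by rcases k with _ | _ | _ | k <;> rfl
    exact this ▸ .subsetCollection _

/-! ## Truth values over a preorder of worlds -/

/-- A truth value over a preorder of worlds: a downwards closed set of worlds that is a sheaf for
the coverage in which `v` is covered by the worlds `u ≤ v` of a set `A` whenever every upper bound
of them is an upper bound of `v`, hereditarily. -/
structure Omega (W : Type) [Preorder W] where
  holds : W → Prop
  mono : ∀ {v w}, v ≤ w → holds w → holds v
  sat : ∀ w, (∀ v ≤ w, ∀ χ, (∀ u ≤ v, holds u → u ≤ χ) → v ≤ χ) → holds w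

/-- `v` extends `w`, as a class, so that extensions compose by instance search. -/
class Ext {W : Type} [Preorder W] (v w : W) : Prop where
  le : v ≤ w

set_option synthInstance.checkSynthOrder false in
instance Ext.trans {W : Type} [Preorder W] {u v w : W} [h₁ : Ext u v] [h₂ : Ext v w] : Ext u w :=
  ⟨h₁.le.trans h₂.le⟩

instance (priority := high) Ext.refl {W : Type} [Preorder W] (w : W) : Ext w w := ⟨le_rfl⟩

section
variable {W : Type} [Preorder W]

/-- The truth value `A` holds at the world `w`. -/
def Forces (w : W) (A : Omega W) : Prop := A.holds w

infix:25 " ⊩ " => Forces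

theorem Forces.at {v w : W} {A : Omega W} (h : w ⊩ A) [hv : Ext v w] : v ⊩ A := A.mono hv.le h

instance {v w : W} {A : Omega W} (h : w ⊩ A) [Ext v w] : CoeDep (w ⊩ A) h (v ⊩ A) := ⟨h.at⟩

namespace Omega

abbrev bot : Omega W where
  holds w := ∀ v ≤ w, ∀ χ, v ≤ χ
  mono hv h u hu := h u (hu.trans hv)
  sat _ h v hv χ := h v hv χ fun u _ hb => hb u le_rfl χ

abbrev and (A B : Omega W) : Omega W where
  holds w := (w ⊩ A) ∧ (w ⊩ B)
  mono hv h := ⟨A.mono hv h.1, B.mono hv h.2⟩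
  sat w h :=
    ⟨A.sat w fun v hv χ hχ => h v hv χ fun u hu hab => hχ u hu hab.1,
      B.sat w fun v hv χ hχ => h v hv χ fun u hu hab => hχ u hu hab.2⟩

abbrev imp (A B : Omega W) : Omega W where
  holds w := ∀ v, Ext v w → (v ⊩ A) → (v ⊩ B)
  mono hv h u hu := h u ⟨hu.le.trans hv⟩
  sat _ h v hv hA := B.sat v fun u hu χ hχ => h u (hu.trans hv.le) χ fun t ht himp =>
    hχ t ht (himp t ⟨le_rfl⟩ (A.mono (ht.trans hu) hA))

abbrev all {D : Type} (f : D → Omega W) : Omega W where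
  holds w := ∀ x, w ⊩ f x
  mono hv h x := (f x).mono hv (h x)
  sat w h x := (f x).sat w fun v hv χ hχ => h v hv χ fun u hu hall => hχ u hu (hall x)

/-- The plain union of the `f x` need not be a sheaf. This is its closure, with the existential
encoded by its elimination rule against arbitrary worlds `χ`. -/
def ex {D : Type} (f : D → Omega W) : Omega W where
  holds w := ∀ v ≤ w, ∀ χ, (∀ u ≤ v, ∀ x, (u ⊩ f x) → u ≤ χ) → v ≤ χ
  mono hv h u hu := h u (hu.trans hv)
  sat _ h v hv χ hχ := h v hv χ fun u hu he => he u le_rfl χ fun t ht x hx =>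
    hχ t (ht.trans hu) x hx

def or (A B : Omega W) : Omega W where
  holds w := ∀ v ≤ w, ∀ χ, (∀ u ≤ v, ((u ⊩ A) ∨ (u ⊩ B)) → u ≤ χ) → v ≤ χ
  mono hv h u hu := h u (hu.trans hv)
  sat _ h v hv χ hχ := h v hv χ fun u hu he => he u le_rfl χ fun t ht hx =>
    hχ t (ht.trans hu) hx

abbrev iff (A B : Omega W) : Omega W := and (imp A B) (imp B A)

end Omega

open Omega

infixr:45 " ⋏ " => Omega.and
infixr:40 " ⋎ " => Omega.or
infixr:35 " ⟶ᵢ " => Omega.imp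
infix:30 " ⟷ᵢ " => Omega.iff

variable {D : Type} {u v w : W} {A B C : Omega W}

namespace Forces

theorem mp (h : w ⊩ A ⟶ᵢ B) [hv : Ext v w] (hA : v ⊩ A) : v ⊩ B := h v hv hA

theorem bot_elim (h : w ⊩ bot) : w ⊩ A := A.sat w fun v hv χ _ => h v hv χ

theorem ex_intro {f : D → Omega W} (x : D) (h : w ⊩ f x) : w ⊩ ex f := fun _ hv _ hχ =>
  hχ _ le_rfl x ((f x).mono hv h)

/-- The goal `C` is a sheaf, so it suffices to force it at the extensions that carry a witness;
these cover `v`. -/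
theorem elim {f : D → Omega W} (h : v ⊩ ex f)
    (k : ∀ u, Ext u v → ∀ x, (u ⊩ f x) → (u ⊩ C)) : v ⊩ C :=
  C.sat v fun u hu χ hχ => h u hu χ fun t ht x hx =>
    hχ t ht (k t ⟨ht.trans hu⟩ x hx)

theorem inl (h : w ⊩ A) : w ⊩ A ⋎ B := fun _ hv _ hχ => hχ _ le_rfl (.inl (A.mono hv h))

theorem inr (h : w ⊩ B) : w ⊩ A ⋎ B := fun _ hv _ hχ => hχ _ le_rfl (.inr (B.mono hv h))

theorem cases (h : v ⊩ A ⋎ B) (h₁ : ∀ u, Ext u v → (u ⊩ A) → (u ⊩ C))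
    (h₂ : ∀ u, Ext u v → (u ⊩ B) → (u ⊩ C)) : v ⊩ C :=
  C.sat v fun u hu χ hχ => h u hu χ fun t ht hx =>
    hχ t ht (hx.elim (h₁ t ⟨ht.trans hu⟩) (h₂ t ⟨ht.trans hu⟩))

end Forces

end

/-! ## Interpretation of formulas -/

/-- A membership relation and an equality with truth values in `Omega W`. -/
class SetStr (W : outParam Type) [Preorder W] (D : Type) where
  mem : D → D → Omega W
  eq : D → D → Omega W

def consEnv {D : Type} (x : D) (ρ : ℕ → D) : ℕ → D
  | 0 => x
  | k + 1 => ρ k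

section
variable {W D : Type} [Preorder W] [SetStr W D]

open SetStr Omega

infix:55 " ∈ᵢ " => SetStr.mem
infix:55 " =ᵢ " => SetStr.eq

def eval : Fml → (ℕ → D) → Omega W
  | .bot, _ => bot
  | .mem i j, ρ => ρ i ∈ᵢ ρ j
  | .eq i j, ρ => ρ i =ᵢ ρ j
  | .and φ ψ, ρ => eval φ ρ ⋏ eval ψ ρ
  | .or φ ψ, ρ => eval φ ρ ⋎ eval ψ ρ
  | .imp φ ψ, ρ => eval φ ρ ⟶ᵢ eval ψ ρ
  | .all φ, ρ => all fun x => eval φ (consEnv x ρ)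
  | .ex φ, ρ => ex fun x => eval φ (consEnv x ρ)

theorem consEnv_comp_lift (x : D) (ρ : ℕ → D) (σ : ℕ → ℕ) :
    consEnv x ρ ∘ lift σ = consEnv x (ρ ∘ σ) := by
  funext k; cases k <;> rfl

theorem eval_ren (φ : Fml) (σ : ℕ → ℕ) (ρ : ℕ → D) : eval (φ.ren σ) ρ = eval φ (ρ ∘ σ) := by
  induction φ generalizing σ ρ <;> simp_all [eval, Fml.ren, consEnv_comp_lift]

end

/-! ## The Lindenbaum model -/

instance : Preorder Fml where
  le φ ψ := Prf Axioms [φ] ψ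
  le_refl φ := .hyp (by simp)
  le_trans _ _ _ h₁ h₂ := h₁.cut_singleton h₂

theorem Prf.and_le_left (φ ψ : Fml) : Fml.and φ ψ ≤ φ :=
  Prf.andE₁ (ψ := ψ) (.hyp (List.mem_singleton.2 rfl))

theorem Prf.and_le_right (φ ψ : Fml) : Fml.and φ ψ ≤ ψ :=
  Prf.andE₂ (φ := φ) (.hyp (List.mem_singleton.2 rfl))

/-- The truth value of a formula in the Lindenbaum model. -/
def Fml.truth (φ : Fml) : Omega Fml where
  holds w := w ≤ φ
  mono hv h := hv.trans h
  sat w h := h w le_rfl φ fun _ _ hu => hu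

instance : SetStr Fml ℕ where
  mem i j := (Fml.mem i j).truth
  eq i j := (Fml.eq i j).truth

theorem Fml.ren_lift_inst (φ : Fml) (t : ℕ) (σ : ℕ → ℕ) :
    (φ.ren (lift σ)).inst t = φ.ren (consEnv t σ) := by
  simp only [inst_eq, ren_ren]
  congr 1; funext k; cases k <;> rfl

/-- For disjunction and existence, forcing is tested against the formula itself as `χ`. Conversely,
a case or an instance is conjoined with the current world to give the world at which the hypothesis
on `χ` is applied. -/
theorem forces_eval_iff (φ : Fml) (ρ : ℕ → ℕ) (w : Fml) :
    (w ⊩ eval φ ρ) ↔ Prf Axioms [w] (φ.ren ρ) := by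
  have hT : ∀ φ ∈ Axioms, ∀ σ, φ.ren σ ∈ Axioms := fun φ h σ => Axioms.ren h σ
  induction φ generalizing ρ w with
  | bot =>
    refine ⟨fun h => h w le_rfl .bot, fun h v hv χ => ?_⟩
    exact .botE (hv.cut_singleton h)
  | mem i j => exact Iff.rfl
  | eq i j => exact Iff.rfl
  | and φ ψ ih₁ ih₂ =>
    refine ⟨fun h => .andI ((ih₁ ρ w).1 h.1) ((ih₂ ρ w).1 h.2), fun h => ⟨?_, ?_⟩⟩
    · exact (ih₁ ρ w).2 h.andE₁
    · exact (ih₂ ρ w).2 h.andE₂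
  | or φ ψ ih₁ ih₂ =>
    constructor
    · refine fun h => h w le_rfl (.or (φ.ren ρ) (ψ.ren ρ)) fun u hu h => ?_
      rcases h with h | h
      · exact .orI₁ ((ih₁ ρ u).1 h)
      · exact .orI₂ ((ih₂ ρ u).1 h)
    · intro h v hv χ hχ
      have key : ∀ θ, (∀ u, u ≤ θ → u ≤ v → u ≤ χ) → Prf Axioms [θ, v] χ := by
        intro θ hθ
        refine .cut (.andI (.hyp (φ := θ) (by simp)) (.hyp (φ := v) (by simp))) ?_
        exact Prf.weaken (hθ (.and θ v) (Prf.and_le_left _ _) (Prf.and_le_right _ _))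
          (by simp)
      exact .orE (hv.cut_singleton h) (key _ fun u h₁ h₂ => hχ u h₂ (.inl ((ih₁ ρ u).2 h₁)))
        (key _ fun u h₁ h₂ => hχ u h₂ (.inr ((ih₂ ρ u).2 h₁)))
  | imp φ ψ ih₁ ih₂ =>
    constructor
    · intro h
      refine .impI (.cut (.andI (.hyp (φ := φ.ren ρ) (by simp)) (.hyp (φ := w) (by simp))) ?_)
      refine Prf.weaken (Γ := [.and (φ.ren ρ) w]) ?_ (by simp)
      exact (ih₂ ρ _).1 (h _ ⟨Prf.and_le_right _ _⟩ ((ih₁ ρ _).2 (Prf.and_le_left _ _)))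
    · intro h v hv hA
      exact (ih₂ ρ v).2 (.impE (hv.le.cut_singleton h) ((ih₁ ρ v).1 hA))
  | all φ ih =>
    constructor
    · intro h
      obtain ⟨t, ht⟩ : ∃ t, t = max w.bound (φ.ren (lift ρ)).bound := ⟨_, rfl⟩
      refine Prf.allI_fresh hT (t := t) (by omega) (by omega) ?_
      rw [Fml.ren_lift_inst]
      exact (ih _ w).1 (h t)
    · intro h t
      refine (ih _ w).2 ?_
      rw [← Fml.ren_lift_inst]
      exact .allE t h
  | ex φ ih =>
    constructor
    · intro h
      refine h w le_rfl (.ex (φ.ren (lift ρ))) fun u hu t ht => .exI t ?_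
      rw [Fml.ren_lift_inst]
      exact (ih _ u).1 ht
    · intro h v hv χ hχ
      -- The witness is named by a variable fresh for the world, the matrix and also the conclusion
      -- `χ`, as existential elimination demands.
      obtain ⟨t, ht⟩ : ∃ t, t = max (max v.bound (φ.ren (lift ρ)).bound) χ.bound := ⟨_, rfl⟩
      refine Prf.exE_fresh hT (t := t) (φ := φ.ren (lift ρ)) (by omega) (by omega) (by omega)
        (hv.cut_singleton h) ?_
      rw [Fml.ren_lift_inst]
      refine .cut (.andI (.hyp (φ := φ.ren (consEnv t ρ)) (by simp)) (.hyp (φ := v) (by simp))) ?_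
      refine Prf.weaken (Γ := [.and (φ.ren (consEnv t ρ)) v]) ?_ (by simp)
      exact hχ _ (Prf.and_le_right _ _) t ((ih _ _).2 (Prf.and_le_left _ _))

theorem provable_of_forces {φ : Fml} (h : ∀ w : Fml, w ⊩ eval φ (id : ℕ → ℕ)) :
    Provable Axioms φ := by
  -- Any derivable formula serves as the world here; it is then cut away.
  have := (forces_eval_iff φ id _).1 (h (.imp .bot .bot))
  rw [Fml.ren_id] at this
  exact .cut (.impI (.hyp (by simp))) this

theorem forces_axiom {φ : Fml} (h : φ ∈ Axioms) (ρ : ℕ → ℕ) (w : Fml) : w ⊩ eval φ ρ :=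
  (forces_eval_iff φ ρ w).2 (.ax (Axioms.ren h ρ))

theorem forces_eq_refl (i : ℕ) (w : Fml) : w ⊩ i =ᵢ i :=
  show w ≤ .eq i i from .eqI i

theorem forces_eq_subst (φ : Fml) (ρ : ℕ → ℕ) (s t : ℕ) (w : Fml) (h : w ⊩ s =ᵢ t)
    (hs : w ⊩ eval φ (consEnv s ρ)) : w ⊩ eval φ (consEnv t ρ) := by
  rw [forces_eval_iff, ← Fml.ren_lift_inst] at hs ⊢
  exact .eqE s t h hs

/-! ### Models of a fragment of the theory -/

open SetStr Omega

/-- A model, in the sense of `SetStr`, of the fragment of **CZF** that is used below. -/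
class SetModel (W : outParam Type) [Preorder W] (D : Type) extends SetStr W D where
  enum : ℕ → D
  enum_surj : Function.Surjective enum
  eq_refl (w : W) (x : D) : w ⊩ x =ᵢ x
  eq_subst (φ : Fml) (ρ : ℕ → D) (s t : D) (w : W) :
    (w ⊩ s =ᵢ t) → (w ⊩ eval φ (consEnv s ρ)) → w ⊩ eval φ (consEnv t ρ)
  extensionality (w : W) (a b : D) :
    w ⊩ (all fun x : D => (x ∈ᵢ a) ⟷ᵢ (x ∈ᵢ b)) ⟶ᵢ a =ᵢ b
  pairing (w : W) (a b : D) :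
    w ⊩ ex fun c : D => all fun x : D => x ∈ᵢ c ⟷ᵢ (x =ᵢ a ⋎ x =ᵢ b)
  union (w : W) (a : D) :
    w ⊩ ex fun b : D => all fun x : D => x ∈ᵢ b ⟷ᵢ ex fun y : D => y ∈ᵢ a ⋏ x ∈ᵢ y
  separation (φ : Fml) (hφ : IsBounded φ) (ρ : ℕ → D) (w : W) (a : D) :
    w ⊩ ex fun b : D => all fun x : D => x ∈ᵢ b ⟷ᵢ (x ∈ᵢ a ⋏ eval φ (consEnv x ρ))
  collection (φ : Fml) (ρ : ℕ → D) (w : W) (a : D) :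
    w ⊩ (all fun x : D => x ∈ᵢ a ⟶ᵢ ex fun y : D => eval φ (consEnv x (consEnv y ρ))) ⟶ᵢ
      ex fun b : D =>
        (all fun x : D => x ∈ᵢ a ⟶ᵢ ex fun y : D => y ∈ᵢ b ⋏ eval φ (consEnv x (consEnv y ρ))) ⋏
        (all fun y : D => y ∈ᵢ b ⟶ᵢ ex fun x : D => x ∈ᵢ a ⋏ eval φ (consEnv x (consEnv y ρ)))

theorem eval_app_one (φ : Fml) (ρ : ℕ → ℕ) (x₁ x₂ x₃ : ℕ) :
    eval (φ.app [2] 3) (consEnv x₁ (consEnv x₂ (consEnv x₃ ρ))) = eval φ (consEnv x₁ ρ) := by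
  rw [Fml.app, eval_ren]
  congr 1; funext k; rcases k with _ | k <;> rfl

theorem eval_app_two (φ : Fml) (ρ : ℕ → ℕ) (x₁ x₂ x₃ : ℕ) :
    eval (φ.app [1, 2] 3) (consEnv x₁ (consEnv x₂ (consEnv x₃ ρ))) =
      eval φ (consEnv x₂ (consEnv x₁ ρ)) := by
  rw [Fml.app, eval_ren]
  congr 1; funext k; rcases k with _ | _ | k <;> rfl

theorem eval_app_two' (φ : Fml) (ρ : ℕ → ℕ) (x₁ x₂ x₃ x₄ : ℕ) :
    eval (φ.app [2, 3] 4) (consEnv x₁ (consEnv x₂ (consEnv x₃ (consEnv x₄ ρ)))) =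
      eval φ (consEnv x₂ (consEnv x₁ ρ)) := by
  rw [Fml.app, eval_ren]
  congr 1; funext k; rcases k with _ | _ | k <;> rfl

theorem eval_app_two'' (φ : Fml) (ρ : ℕ → ℕ) (x₁ x₂ x₃ x₄ : ℕ) :
    eval (φ.app [3, 2] 4) (consEnv x₁ (consEnv x₂ (consEnv x₃ (consEnv x₄ ρ)))) =
      eval φ (consEnv x₁ (consEnv x₂ ρ)) := by
  rw [Fml.app, eval_ren]
  congr 1; funext k; rcases k with _ | _ | k <;> rfl

/-- The Lindenbaum model. -/
instance : SetModel Fml ℕ where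
  enum := id
  enum_surj := Function.surjective_id
  eq_refl w x := forces_eq_refl x w
  eq_subst φ ρ s t w := forces_eq_subst φ ρ s t w
  extensionality w a b := forces_axiom .extensionality id w a b
  pairing w a b := forces_axiom .pairing id w a b
  union w a := forces_axiom .union id w a
  separation φ hφ ρ w a := by
    have h := forces_axiom (.boundedSeparation φ hφ) ρ w a
    simp only [Bicond, Conj, Impl, All, Ex, Mem, eval, Nat.reduceAdd, eval_app_one] at h
    exact h
  collection φ ρ w a := by
    have h := forces_axiom (.strongCollection φ) ρ w a
    simp only [Impl, AllIn, ExIn, All, Ex, Conj, Mem, eval, Nat.reduceAdd, eval_app_two,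
      eval_app_two', eval_app_two''] at h
    exact h

/-! ## The set-theoretic notions, interpreted -/

namespace Sem

section
variable {W : Type} [Preorder W] {D : Type} [SetModel W D]

def allIn (a : D) (f : D → Omega W) : Omega W := all fun x => x ∈ᵢ a ⟶ᵢ f x
def exIn (a : D) (f : D → Omega W) : Omega W := ex fun x => x ∈ᵢ a ⋏ f x
def sub (a b : D) : Omega W := allIn a fun x => x ∈ᵢ b
def isUPair (z x y : D) : Omega W := x ∈ᵢ z ⋏ y ∈ᵢ z ⋏ allIn z fun w => w =ᵢ x ⋎ w =ᵢ y
def isPair (p x y : D) : Omega W :=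
  (exIn p fun s => isUPair s x x) ⋏ (exIn p fun t => isUPair t x y) ⋏
  allIn p fun s => isUPair s x x ⋎ isUPair s x y
def rel (r x y : D) : Omega W := exIn r fun p => isPair p x y
def subProd (r a b : D) : Omega W :=
  allIn r fun p => exIn a fun x => exIn b fun y => isPair p x y

def elementaryRules (X R : D) : Omega W :=
  allIn R fun r => ex fun a : D => ex fun b : D =>
    isPair r a b ⋏ sub a X ⋏ sub b X ⋏ ex fun x : D => isUPair a x x
def closed (X R Y : D) : Omega W :=
  sub Y X ⋏ all fun a : D => all fun b : D => rel R a b ⟶ᵢ sub a Y ⟶ᵢ exIn b fun x => x ∈ᵢ Y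

variable (D) in
def elementaryNID : Omega W :=
  all fun X : D => all fun R : D => elementaryRules X R ⟶ᵢ
    ex fun G : D => (allIn G fun β => closed X R β) ⋏
      all fun α : D => closed X R α ⟶ᵢ allIn α fun x => exIn G fun β => x ∈ᵢ β ⋏ sub β α

end

/-- The data of a set-presented formal space. -/
structure Space (D : Type) where
  pt : D
  ord : D
  bcov : D

section
variable {W : Type} [Preorder W] {D : Type} [SetModel W D]

namespace Space

variable (A : Space D)

def le (x y : D) : Omega W := rel A.ord x y
def sieve (S p : D) : Omega W :=
  allIn S fun x => x ∈ᵢ A.pt ⋏ A.le x p ⋏ allIn A.pt fun y => A.le y x ⟶ᵢ y ∈ᵢ S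
def cov (S p : D) : Omega W := A.sieve S p ⋏ ex fun R : D => rel A.bcov p R ⋏ sub R S
def isRestr (S' S q : D) : Omega W := all fun x : D => x ∈ᵢ S' ⟷ᵢ (x ∈ᵢ S ⋏ A.le x q)
def isPreorder : Omega W :=
  subProd A.ord A.pt A.pt ⋏ (allIn A.pt fun x => A.le x x) ⋏
  all fun x : D => all fun y : D => all fun z : D => A.le x y ⟶ᵢ A.le y z ⟶ᵢ A.le x z
def isBCov : Omega W :=
  allIn A.bcov fun b => exIn A.pt fun p => ex fun R : D => isPair b p R ⋏ A.sieve R p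
def maximality : Omega W :=
  allIn A.pt fun p => all fun S : D => (all fun x : D => x ∈ᵢ S ⟷ᵢ A.le x p) ⟶ᵢ A.cov S p
def stability : Omega W :=
  allIn A.pt fun p => all fun S : D => A.cov S p ⟶ᵢ allIn A.pt fun q => A.le q p ⟶ᵢ
    all fun S' : D => A.isRestr S' S q ⟶ᵢ A.cov S' q
def localCharacter : Omega W :=
  allIn A.pt fun p => all fun S : D => A.cov S p ⟶ᵢ all fun R : D => A.sieve R p ⟶ᵢ
    (allIn S fun q => all fun R' : D => A.isRestr R' R q ⟶ᵢ A.cov R' q) ⟶ᵢ A.cov R p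
def isFormalSpace : Omega W :=
  A.isPreorder ⋏ A.isBCov ⋏ A.maximality ⋏ A.stability ⋏ A.localCharacter

end Space

def allSp (f : Space D → Omega W) : Omega W :=
  all fun P : D => all fun L : D => all fun B : D => f ⟨P, L, B⟩
def exSp (f : Space D → Omega W) : Omega W :=
  ex fun P : D => ex fun L : D => ex fun B : D => f ⟨P, L, B⟩

def isMor (A B : Space D) (F : D) : Omega W :=
  subProd F A.pt B.pt ⋏
  (all fun p : D => all fun q : D => all fun p' : D => all fun q' : D =>
    rel F p q ⟶ᵢ A.le p' p ⟶ᵢ B.le q q' ⟶ᵢ rel F p' q') ⋏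
  (allIn B.pt fun q => allIn A.pt fun p => all fun S : D =>
    A.cov S p ⟶ᵢ (allIn S fun p' => rel F p' q) ⟶ᵢ rel F p q) ⋏
  (allIn A.pt fun p => ex fun S : D => A.cov S p ⋏
    allIn S fun p' => exIn B.pt fun q' => rel F p' q') ⋏
  (allIn B.pt fun q₀ => allIn B.pt fun q₁ => allIn A.pt fun p =>
    rel F p q₀ ⟶ᵢ rel F p q₁ ⟶ᵢ ex fun S : D => A.cov S p ⋏
      allIn S fun p' => exIn B.pt fun r => B.le r q₀ ⋏ B.le r q₁ ⋏ rel F p' r) ⋏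
  (allIn A.pt fun p => allIn B.pt fun q => rel F p q ⟶ᵢ all fun T : D => B.cov T q ⟶ᵢ
    ex fun S : D => A.cov S p ⋏ allIn S fun p' => exIn T fun q' => rel F p' q')

def compRel (A B : Space D) (F G p r : D) : Omega W :=
  ex fun S : D => A.cov S p ⋏ allIn S fun p' => exIn B.pt fun q => rel F p' q ⋏ rel G q r
def coequalizes (A B C : Space D) (F G E : D) : Omega W :=
  allIn A.pt fun p => allIn C.pt fun r => compRel A B F E p r ⟷ᵢ compRel A B G E p r
def factors (B C T : Space D) (E L K : D) : Omega W :=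
  allIn B.pt fun q => allIn T.pt fun r => compRel B C E L q r ⟷ᵢ rel K q r
def isCoequalizer (A B C : Space D) (F G E : D) : Omega W :=
  isMor B C E ⋏ coequalizes A B C F G E ⋏
  allSp fun T => T.isFormalSpace ⟶ᵢ all fun K : D => isMor B T K ⟶ᵢ coequalizes A B T F G K ⟶ᵢ
    ex fun L : D => (isMor C T L ⋏ factors B C T E L K) ⋏
      all fun L' : D => isMor C T L' ⟶ᵢ factors B C T E L' K ⟶ᵢ L' =ᵢ L
variable (D) in
def hasCoequalizers : Omega W :=
  allSp fun A : Space D => A.isFormalSpace ⟶ᵢ allSp fun B => B.isFormalSpace ⟶ᵢ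
    all fun F : D => isMor A B F ⟶ᵢ all fun G : D => isMor A B G ⟶ᵢ
      exSp fun C => C.isFormalSpace ⋏ ex fun E : D => isCoequalizer A B C F G E

end

end Sem

/-! ## Formulas with named variables represent the interpreted notions -/

section
variable {W : Type} [Preorder W] {D : Type} [SetModel W D] {d : ℕ} {ρ : ℕ → D}

/-- Under `d` binders, in the environment `ρ`, the variable `x` denotes `a`. -/
class IsVar (d : ℕ) (ρ : ℕ → D) (x : Var) (a : D) : Prop where
  lt : x < d
  eq : ρ (d - 1 - x) = a

/-- Under `d` binders, in the environment `ρ`, the formula `φ` has the truth value `A`. -/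
class Reps (d : ℕ) (ρ : ℕ → D) (φ : Pre) (A : Omega W) : Prop where
  eq : eval (φ d) ρ = A

class IsSpace (d : ℕ) (ρ : ℕ → D) (A : Sp) (A' : Sem.Space D) : Prop where
  pt : IsVar d ρ A.pt A'.pt
  le : IsVar d ρ A.le A'.ord
  bcov : IsVar d ρ A.bcov A'.bcov

instance IsVar.new {a : D} : IsVar (d + 1) (consEnv a ρ) d a := ⟨Nat.lt_succ_self d, by simp [consEnv]⟩

instance IsVar.up {x : Var} {a b : D} [h : IsVar d ρ x a] :
    IsVar (d + 1) (consEnv b ρ) x a :=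
  ⟨Nat.lt_succ_of_lt h.lt, by
    have key : ∀ x d : ℕ, x < d → d + 1 - 1 - x = d - 1 - x + 1 := by omega
    rw [← h.eq, key x d h.lt]; rfl⟩

instance IsSpace.up {A : Sp} {A' : Sem.Space D} {b : D} [h : IsSpace d ρ A A'] :
    IsSpace (d + 1) (consEnv b ρ) A A' :=
  ⟨h.pt.up, h.le.up, h.bcov.up⟩

instance {A : Sp} {A' : Sem.Space D} [h : IsSpace d ρ A A'] : IsVar d ρ A.pt A'.pt := h.pt
instance {A : Sp} {A' : Sem.Space D} [h : IsSpace d ρ A A'] : IsVar d ρ A.le A'.ord := h.le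
instance {A : Sp} {A' : Sem.Space D} [h : IsSpace d ρ A A'] : IsVar d ρ A.bcov A'.bcov := h.bcov

instance {x y z : Var} {a b c : D} [hx : IsVar d ρ x a] [hy : IsVar d ρ y b]
    [hz : IsVar d ρ z c] : IsSpace d ρ ⟨x, y, z⟩ ⟨a, b, c⟩ := ⟨hx, hy, hz⟩

namespace Reps

set_option synthInstance.maxSize 10000
set_option synthInstance.maxHeartbeats 400000

variable {φ ψ : Pre} {A B : Omega W}

instance mem {x y : Var} {a b : D} [hx : IsVar d ρ x a] [hy : IsVar d ρ y b] :
    Reps d ρ (x ∈ᶠ y) (a ∈ᵢ b) := ⟨by rw [← hx.eq, ← hy.eq]; rfl⟩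

instance eql {x y : Var} {a b : D} [hx : IsVar d ρ x a] [hy : IsVar d ρ y b] :
    Reps d ρ (x =ᶠ y) (a =ᵢ b) := ⟨by rw [← hx.eq, ← hy.eq]; rfl⟩

instance conj [h₁ : Reps d ρ φ A] [h₂ : Reps d ρ ψ B] : Reps d ρ (φ ∧ᶠ ψ) (A ⋏ B) :=
  ⟨by rw [← h₁.eq, ← h₂.eq]; rfl⟩

instance disj [h₁ : Reps d ρ φ A] [h₂ : Reps d ρ ψ B] : Reps d ρ (φ ∨ᶠ ψ) (A ⋎ B) :=
  ⟨by rw [← h₁.eq, ← h₂.eq]; rfl⟩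

instance impl [h₁ : Reps d ρ φ A] [h₂ : Reps d ρ ψ B] : Reps d ρ (φ ⇒ᶠ ψ) (A ⟶ᵢ B) :=
  ⟨by rw [← h₁.eq, ← h₂.eq]; rfl⟩

instance bicond [h₁ : Reps d ρ φ A] [h₂ : Reps d ρ ψ B] : Reps d ρ (φ ⇔ᶠ ψ) (A ⟷ᵢ B) :=
  ⟨by rw [← h₁.eq, ← h₂.eq]; rfl⟩

instance all {f : Var → Pre} {g : D → Omega W}
    [h : ∀ a, Reps (d + 1) (consEnv a ρ) (f d) (g a)] : Reps d ρ (All f) (all g) :=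
  ⟨by rw [show g = fun a => eval (f d (d + 1)) (consEnv a ρ) from funext fun a => (h a).eq.symm]
      rfl⟩

instance ex {f : Var → Pre} {g : D → Omega W}
    [h : ∀ a, Reps (d + 1) (consEnv a ρ) (f d) (g a)] : Reps d ρ (Ex f) (ex g) :=
  ⟨by rw [show g = fun a => eval (f d (d + 1)) (consEnv a ρ) from funext fun a => (h a).eq.symm]
      rfl⟩

instance allIn {x : Var} {a : D} {f : Var → Pre} {g : D → Omega W} [IsVar d ρ x a]
    [∀ a, Reps (d + 1) (consEnv a ρ) (f d) (g a)] : Reps d ρ (AllIn x f) (Sem.allIn a g) := by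
  unfold AllIn Sem.allIn; infer_instance

instance exIn {x : Var} {a : D} {f : Var → Pre} {g : D → Omega W} [IsVar d ρ x a]
    [∀ a, Reps (d + 1) (consEnv a ρ) (f d) (g a)] : Reps d ρ (ExIn x f) (Sem.exIn a g) := by
  unfold ExIn Sem.exIn; infer_instance

instance allSp {f : Sp → Pre} {g : Sem.Space D → Omega W}
    [h : ∀ a b c, Reps (d + 1 + 1 + 1) (consEnv c (consEnv b (consEnv a ρ)))
      (f ⟨d, d + 1, d + 1 + 1⟩) (g ⟨a, b, c⟩)] : Reps d ρ (AllSp f) (Sem.allSp g) := by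
  unfold AllSp Sem.allSp; infer_instance

instance exSp {f : Sp → Pre} {g : Sem.Space D → Omega W}
    [h : ∀ a b c, Reps (d + 1 + 1 + 1) (consEnv c (consEnv b (consEnv a ρ)))
      (f ⟨d, d + 1, d + 1 + 1⟩) (g ⟨a, b, c⟩)] : Reps d ρ (ExSp f) (Sem.exSp g) := by
  unfold ExSp Sem.exSp; infer_instance

instance sub {x y : Var} {x' y' : D} [IsVar d ρ x x'] [IsVar d ρ y y'] :
    Reps d ρ (Sub x y) (Sem.sub x' y') := by
  unfold Sub Sem.sub; infer_instance

instance isUPair {x y z : Var} {x' y' z' : D} [IsVar d ρ x x'] [IsVar d ρ y y'] [IsVar d ρ z z'] :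
    Reps d ρ (IsUPair x y z) (Sem.isUPair x' y' z') := by
  unfold IsUPair Sem.isUPair; infer_instance

instance isPair {x y z : Var} {x' y' z' : D} [IsVar d ρ x x'] [IsVar d ρ y y'] [IsVar d ρ z z'] :
    Reps d ρ (IsPair x y z) (Sem.isPair x' y' z') := by
  unfold IsPair Sem.isPair; infer_instance

instance rel {x y z : Var} {x' y' z' : D} [IsVar d ρ x x'] [IsVar d ρ y y'] [IsVar d ρ z z'] :
    Reps d ρ (Rel x y z) (Sem.rel x' y' z') := by
  unfold Rel Sem.rel; infer_instance

instance subProd {x y z : Var} {x' y' z' : D} [IsVar d ρ x x'] [IsVar d ρ y y'] [IsVar d ρ z z'] :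
    Reps d ρ (SubProd x y z) (Sem.subProd x' y' z') := by
  unfold SubProd Sem.subProd; infer_instance

instance elementaryRules {x y : Var} {x' y' : D} [IsVar d ρ x x'] [IsVar d ρ y y'] :
    Reps d ρ (ElementaryRules x y) (Sem.elementaryRules x' y') := by
  unfold ElementaryRules Sem.elementaryRules; infer_instance

instance closed {x y z : Var} {x' y' z' : D} [IsVar d ρ x x'] [IsVar d ρ y y'] [IsVar d ρ z z'] :
    Reps d ρ (Closed x y z) (Sem.closed x' y' z') := by
  unfold Closed Sem.closed; infer_instance

instance elementaryNID :
    Reps d ρ (CZF.elementaryNID) (Sem.elementaryNID D) := by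
  unfold CZF.elementaryNID Sem.elementaryNID; infer_instance

instance le {A : Sp} {A' : Sem.Space D} {x y : Var} {x' y' : D} [IsSpace d ρ A A']
    [IsVar d ρ x x'] [IsVar d ρ y y'] :
    Reps d ρ (A.Le x y) (A'.le x' y') := by
  unfold Sp.Le Sem.Space.le; infer_instance

instance sieve {A : Sp} {A' : Sem.Space D} {x y : Var} {x' y' : D} [IsSpace d ρ A A']
    [IsVar d ρ x x'] [IsVar d ρ y y'] :
    Reps d ρ (A.Sieve x y) (A'.sieve x' y') := by
  unfold Sp.Sieve Sem.Space.sieve; infer_instance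

instance cov {A : Sp} {A' : Sem.Space D} {x y : Var} {x' y' : D} [IsSpace d ρ A A']
    [IsVar d ρ x x'] [IsVar d ρ y y'] :
    Reps d ρ (A.Cov x y) (A'.cov x' y') := by
  unfold Sp.Cov Sem.Space.cov; infer_instance

instance isRestr {A : Sp} {A' : Sem.Space D} {x y z : Var} {x' y' z' : D} [IsSpace d ρ A A']
    [IsVar d ρ x x'] [IsVar d ρ y y'] [IsVar d ρ z z'] :
    Reps d ρ (A.IsRestr x y z) (A'.isRestr x' y' z') := by
  unfold Sp.IsRestr Sem.Space.isRestr; infer_instance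

instance isPreorder {A : Sp} {A' : Sem.Space D} [IsSpace d ρ A A'] :
    Reps d ρ (A.IsPreorder) (A'.isPreorder) := by
  unfold Sp.IsPreorder Sem.Space.isPreorder; infer_instance

instance isBCov {A : Sp} {A' : Sem.Space D} [IsSpace d ρ A A'] :
    Reps d ρ (A.IsBCov) (A'.isBCov) := by
  unfold Sp.IsBCov Sem.Space.isBCov; infer_instance

instance maximality {A : Sp} {A' : Sem.Space D} [IsSpace d ρ A A'] :
    Reps d ρ (A.Maximality) (A'.maximality) := by
  unfold Sp.Maximality Sem.Space.maximality; infer_instance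

instance stability {A : Sp} {A' : Sem.Space D} [IsSpace d ρ A A'] :
    Reps d ρ (A.Stability) (A'.stability) := by
  unfold Sp.Stability Sem.Space.stability; infer_instance

instance localCharacter {A : Sp} {A' : Sem.Space D} [IsSpace d ρ A A'] :
    Reps d ρ (A.LocalCharacter) (A'.localCharacter) := by
  unfold Sp.LocalCharacter Sem.Space.localCharacter; infer_instance

instance isFormalSpace {A : Sp} {A' : Sem.Space D} [IsSpace d ρ A A'] :
    Reps d ρ (A.IsFormalSpace) (A'.isFormalSpace) := by
  unfold Sp.IsFormalSpace Sem.Space.isFormalSpace; infer_instance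

instance isMor {A B : Sp} {A' B' : Sem.Space D} {x : Var} {x' : D} [IsSpace d ρ A A']
    [IsSpace d ρ B B'] [IsVar d ρ x x'] :
    Reps d ρ (IsMor A B x) (Sem.isMor A' B' x') := by
  unfold IsMor Sem.isMor; infer_instance

instance compRel {A B : Sp} {A' B' : Sem.Space D} {x y z t : Var} {x' y' z' t' : D}
    [IsSpace d ρ A A'] [IsSpace d ρ B B'] [IsVar d ρ x x'] [IsVar d ρ y y'] [IsVar d ρ z z']
    [IsVar d ρ t t'] :
    Reps d ρ (CompRel A B x y z t) (Sem.compRel A' B' x' y' z' t') := by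
  unfold CompRel Sem.compRel; infer_instance

instance coequalizes {A B C : Sp} {A' B' C' : Sem.Space D} {x y z : Var} {x' y' z' : D}
    [IsSpace d ρ A A'] [IsSpace d ρ B B'] [IsSpace d ρ C C'] [IsVar d ρ x x'] [IsVar d ρ y y']
    [IsVar d ρ z z'] :
    Reps d ρ (Coequalizes A B C x y z) (Sem.coequalizes A' B' C' x' y' z') := by
  unfold Coequalizes Sem.coequalizes; infer_instance

instance factors {A B C : Sp} {A' B' C' : Sem.Space D} {x y z : Var} {x' y' z' : D}
    [IsSpace d ρ A A'] [IsSpace d ρ B B'] [IsSpace d ρ C C'] [IsVar d ρ x x'] [IsVar d ρ y y']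
    [IsVar d ρ z z'] :
    Reps d ρ (Factors A B C x y z) (Sem.factors A' B' C' x' y' z') := by
  unfold Factors Sem.factors; infer_instance

instance isCoequalizer {A B C : Sp} {A' B' C' : Sem.Space D} {x y z : Var} {x' y' z' : D}
    [IsSpace d ρ A A'] [IsSpace d ρ B B'] [IsSpace d ρ C C'] [IsVar d ρ x x'] [IsVar d ρ y y']
    [IsVar d ρ z z'] :
    Reps d ρ (IsCoequalizer A B C x y z) (Sem.isCoequalizer A' B' C' x' y' z') := by
  unfold IsCoequalizer Sem.isCoequalizer; infer_instance

instance hasCoequalizers :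
    Reps d ρ (CZF.hasCoequalizers) (Sem.hasCoequalizers D) := by
  unfold CZF.hasCoequalizers Sem.hasCoequalizers; infer_instance

end Reps

end

/-- An implication holds in **CZF** if its interpretation holds in the Lindenbaum model. -/
theorem provable_of_forces_imp {φ ψ : Pre} {A B : Omega Fml} [hφ : Reps 0 (id : ℕ → ℕ) φ A]
    [hψ : Reps 0 (id : ℕ → ℕ) ψ B] (h : ∀ w, (w ⊩ A) → w ⊩ B) :
    Provable Axioms (φ ⇒ᶠ ψ).close := by
  refine provable_of_forces fun w v _ hv => ?_
  change v ⊩ eval (φ 0) id at hv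
  rw [hφ.eq] at hv
  rw [hψ.eq]
  exact h v hv

theorem provable_of_model (h : ∀ w : Fml, (w ⊩ Sem.elementaryNID ℕ) → w ⊩ Sem.hasCoequalizers ℕ) :
    Provable Axioms (elementaryNID ⇒ᶠ hasCoequalizers).close :=
  provable_of_forces_imp h

open SetStr Omega Sem

namespace Forces

variable {W : Type} [Preorder W] {v w : W} {A B : Omega W}

theorem fwd (h : w ⊩ A ⟷ᵢ B) [Ext v w] (hA : v ⊩ A) : v ⊩ B := Forces.mp h.1 hA

theorem bwd (h : w ⊩ A ⟷ᵢ B) [Ext v w] (hB : v ⊩ B) : v ⊩ A := Forces.mp h.2 hB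

end Forces

/-! ## Bounded definability -/

/-- `E` is a type of tuples of elements of `D`; every element of `D` counts as a constant
coordinate. -/
class Env (D : outParam Type) (E : Type) where
  coord : ℕ → E → D
  const : ∀ c : D, ∃ i, ∀ e, coord i e = c

/-- Coordinate `0` is the variable element and the others run through an enumeration of `D`. Hence a
formula evaluated at the coordinates can use every element as a parameter. -/
instance {W : Type} [Preorder W] {D : Type} [SetModel W D] : Env D D where
  coord i e := consEnv e SetModel.enum i
  const c := by
    obtain ⟨i, hi⟩ := SetModel.enum_surj c
    exact ⟨i + 1, fun _ => hi⟩

instance {D E : Type} [Env D E] : Env D (E × D) where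
  coord i e := consEnv e.2 (fun i => Env.coord i e.1) i
  const c := by
    obtain ⟨i, hi⟩ := Env.const (E := E) c
    exact ⟨i + 1, fun e => hi e.1⟩

/-- `t` is a coordinate. -/
class Tm {D E : Type} [Env D E] (t : E → D) : Prop where
  out : ∃ i, ∀ e, t e = Env.coord i e

section

variable {W : Type} [Preorder W] {D : Type} [SetModel W D] {E : Type} [Env D E]

instance Tm.base : Tm (fun e : D => e) := ⟨0, fun _ => rfl⟩

instance Tm.const (c : D) : Tm (fun _ : E => c) := ⟨by
  obtain ⟨i, hi⟩ := Env.const (E := E) c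
  exact ⟨i, fun e => (hi e).symm⟩⟩

instance Tm.snd : Tm (fun e : E × D => e.2) := ⟨0, fun _ => rfl⟩

instance Tm.fst_base : Tm (fun e : D × D => e.1) := ⟨1, fun _ => rfl⟩

instance Tm.fst (t : E → D) [h : Tm t] : Tm (fun e : E × D => t e.1) := ⟨by
  obtain ⟨i, hi⟩ := h.out
  exact ⟨i + 1, fun e => hi e.1⟩⟩

instance Tm.fst2 (t : E → D) [Tm t] :
    Tm (fun e : (E × D) × D => t e.1.1) :=
  Tm.fst fun e : E × D => t e.1

instance Tm.fst3 (t : E → D) [Tm t] :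
    Tm (fun e : ((E × D) × D) × D => t e.1.1.1) :=
  Tm.fst fun e : (E × D) × D => t e.1.1

/-- `P` is given by a bounded formula, with parameters. -/
class Bdd (P : E → Omega W) : Prop where
  out : ∃ φ, IsBounded φ ∧ ∀ e w, (w ⊩ eval φ fun i => Env.coord i e) ↔ (w ⊩ P e)

/-- Asking for boundedness after substitution of any coordinate of any tuple type lets `P` be used
beneath further binders, where a bare `Bdd P` would not suffice. -/
structure Bdd₁ (P : D → Omega W) : Prop where
  out : ∀ (E : Type) [Env D E] (s : E → D) [Tm s], Bdd fun e => P (s e)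

structure Bdd₂ (P : D → D → Omega W) : Prop where
  out : ∀ (E : Type) [Env D E] (s t : E → D) [Tm s] [Tm t], Bdd fun e => P (s e) (t e)

namespace Bdd

variable {P Q : E → Omega W} {r s t a b p x y z : E → D}

instance of_bot : Bdd fun _ : E => (Omega.bot : Omega W) := ⟨.bot, .bot, fun _ _ => Iff.rfl⟩

instance of_mem [hs : Tm s] [ht : Tm t] : Bdd fun e => s e ∈ᵢ t e := ⟨by
  obtain ⟨i, hi⟩ := hs.out
  obtain ⟨j, hj⟩ := ht.out
  exact ⟨.mem i j, .mem i j, fun e w => by rw [hi, hj]; rfl⟩⟩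

instance of_eq [hs : Tm s] [ht : Tm t] : Bdd fun e => s e =ᵢ t e := ⟨by
  obtain ⟨i, hi⟩ := hs.out
  obtain ⟨j, hj⟩ := ht.out
  exact ⟨.eq i j, .eq i j, fun e w => by rw [hi, hj]; rfl⟩⟩

instance of_and [hP : Bdd P] [hQ : Bdd Q] : Bdd fun e => P e ⋏ Q e := ⟨by
  obtain ⟨φ, hφ, h₁⟩ := hP.out
  obtain ⟨ψ, hψ, h₂⟩ := hQ.out
  exact ⟨.and φ ψ, .and hφ hψ, fun e w => and_congr (h₁ e w) (h₂ e w)⟩⟩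

instance of_or [hP : Bdd P] [hQ : Bdd Q] : Bdd fun e => P e ⋎ Q e := ⟨by
  obtain ⟨φ, hφ, h₁⟩ := hP.out
  obtain ⟨ψ, hψ, h₂⟩ := hQ.out
  refine ⟨.or φ ψ, .or hφ hψ, fun e w => ⟨fun h => h.cases ?_ ?_, fun h => h.cases ?_ ?_⟩⟩
  · exact fun u _ h => .inl ((h₁ e u).1 h)
  · exact fun u _ h => .inr ((h₂ e u).1 h)
  · exact fun u _ h => .inl ((h₁ e u).2 h)
  · exact fun u _ h => .inr ((h₂ e u).2 h)⟩

instance of_imp [hP : Bdd P] [hQ : Bdd Q] : Bdd fun e => P e ⟶ᵢ Q e := ⟨by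
  obtain ⟨φ, hφ, h₁⟩ := hP.out
  obtain ⟨ψ, hψ, h₂⟩ := hQ.out
  refine ⟨.imp φ ψ, .imp hφ hψ, fun e w => forall_congr' fun v => forall_congr' fun _ => ?_⟩
  exact imp_congr (h₁ e v) (h₂ e v)⟩

theorem consEnv_coord (e : E) (x : D) :
    consEnv x (fun i => Env.coord i e) = fun i => Env.coord i (e, x) := by
  funext i; cases i <;> rfl

instance of_allIn {P : E → D → Omega W} [ha : Tm a] [hP : Bdd fun e : E × D => P e.1 e.2] :
    Bdd fun e => allIn (a e) (P e) := ⟨by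
  obtain ⟨i, hi⟩ := ha.out
  obtain ⟨φ, hφ, h⟩ := hP.out
  refine ⟨_, .all i hφ, fun e w => forall_congr' fun x => forall_congr' fun v =>
    forall_congr' fun _ => imp_congr ?_ ?_⟩
  · rw [hi]; rfl
  · rw [consEnv_coord]; exact h (e, x) v⟩

instance of_exIn {P : E → D → Omega W} [ha : Tm a] [hP : Bdd fun e : E × D => P e.1 e.2] :
    Bdd fun e => exIn (a e) (P e) := ⟨by
  obtain ⟨i, hi⟩ := ha.out
  obtain ⟨φ, hφ, h⟩ := hP.out
  have key : ∀ e x w, (w ⊩ eval (.and (.mem 0 (i + 1)) φ) (consEnv x fun i => Env.coord i e)) ↔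
      (w ⊩ x ∈ᵢ a e ⋏ P e x) := by
    refine fun e x w => and_congr ?_ ?_
    · rw [hi]; rfl
    · rw [consEnv_coord]; exact h (e, x) w
  refine ⟨_, .ex i hφ, fun e w => ⟨fun h => h.elim ?_, fun h => h.elim ?_⟩⟩
  · exact fun u _ x hx => .ex_intro x ((key e x u).1 hx)
  · exact fun u _ x hx => .ex_intro x ((key e x u).2 hx)⟩

instance of_sub [Tm a] [Tm b] : Bdd fun e => sub (a e) (b e) := by unfold Sem.sub; infer_instance

instance of_isUPair [Tm z] [Tm x] [Tm y] : Bdd fun e => isUPair (z e) (x e) (y e) := by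
  unfold Sem.isUPair; infer_instance

instance of_isPair [Tm p] [Tm x] [Tm y] : Bdd fun e => isPair (p e) (x e) (y e) := by
  unfold Sem.isPair; infer_instance

instance of_rel [Tm r] [Tm x] [Tm y] : Bdd fun e => rel (r e) (x e) (y e) := by
  unfold Sem.rel; infer_instance

instance of_le (A : Space D) [Tm x] [Tm y] : Bdd fun e => A.le (x e) (y e) := by
  unfold Sem.Space.le; infer_instance

instance of_sieve (A : Space D) [Tm s] [Tm p] : Bdd fun e => A.sieve (s e) (p e) := by
  unfold Sem.Space.sieve; infer_instance

end Bdd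

/-! ## Elementary set theory -/

variable {u v w : W} {a b c x y z x' y' p q r : D}

theorem Forces.subst {x y : D} (h : w ⊩ x =ᵢ y) (P : D → Omega W) [Ext v w]
    (hx : v ⊩ P x) (hP : Bdd₁ P := by exact ⟨fun _ _ _ _ => inferInstance⟩) : v ⊩ P y := by
  obtain ⟨φ, -, h'⟩ := (hP.out D fun e => e).out
  have := SetModel.eq_subst φ SetModel.enum x y v h.at
  exact (h' y v).1 (this ((h' x v).2 hx))

theorem eq_refl (x : D) : w ⊩ x =ᵢ x := SetModel.eq_refl w x

theorem Forces.symm (h : w ⊩ x =ᵢ y) : w ⊩ y =ᵢ x :=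
  h.subst (fun z => z =ᵢ x) (eq_refl (w := w) x)

theorem Forces.trans (h : w ⊩ x =ᵢ y) (h' : w ⊩ y =ᵢ z) : w ⊩ x =ᵢ z :=
  h'.subst (fun z => x =ᵢ z) h

theorem Forces.app {f : D → Omega W} (h : w ⊩ allIn a f) [hv : Ext v w] (hx : v ⊩ x ∈ᵢ a) :
    v ⊩ f x := h x v hv hx

/-- `Forces.app`, for a world that is determined by the expected type. -/
theorem Forces.app' {f : D → Omega W} (h : w ⊩ allIn a f) (hx : u ⊩ x ∈ᵢ a) [hv : Ext v w]
    [Ext v u] : v ⊩ f x := h x v hv hx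

theorem Forces.exIn_intro {f : D → Omega W} (x : D) (h : w ⊩ x ∈ᵢ a) (h' : w ⊩ f x) :
    w ⊩ exIn a f := .ex_intro x ⟨h, h'⟩

theorem Forces.elimIn {f : D → Omega W} {C : Omega W} (h : v ⊩ exIn a f)
    (k : ∀ u, Ext u v → ∀ x, (u ⊩ x ∈ᵢ a) → (u ⊩ f x) → (u ⊩ C)) : v ⊩ C :=
  Forces.elim h fun u hu x hx => k u hu x hx.1 hx.2

theorem eq_of_mem_iff (h₁ : ∀ v, Ext v w → ∀ x : D, (v ⊩ x ∈ᵢ a) → (v ⊩ x ∈ᵢ b))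
    (h₂ : ∀ v, Ext v w → ∀ x : D, (v ⊩ x ∈ᵢ b) → (v ⊩ x ∈ᵢ a)) : w ⊩ a =ᵢ b :=
  (SetModel.extensionality w a b).mp
    (v := w) fun x => ⟨fun v hv hx => h₁ v hv x hx, fun v hv hx => h₂ v hv x hx⟩

theorem exists_sep (a : D) (P : D → Omega W)
    (hP : Bdd₁ P := by exact ⟨fun _ _ _ _ => inferInstance⟩) :
    w ⊩ ex fun b : D => all fun x : D => x ∈ᵢ b ⟷ᵢ (x ∈ᵢ a ⋏ P x) := by
  obtain ⟨φ, hφ, h⟩ := (hP.out D fun e => e).out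
  refine (SetModel.separation φ hφ SetModel.enum w a).elim fun v _ b hb => .ex_intro b fun x => ?_
  refine ⟨fun u _ hx => ?_, fun u _ hx => ?_⟩
  · obtain ⟨h₁, h₂⟩ : u ⊩ _ := (hb x).fwd hx
    exact ⟨h₁, (h x u).1 h₂⟩
  · exact (hb x).bwd ⟨hx.1, (h x u).2 hx.2⟩

theorem collect (a : D) (P : D → D → Omega W)
    (h : w ⊩ allIn a fun x => ex fun y : D => P x y)
    (hP : Bdd₂ P := by exact ⟨fun _ _ _ _ _ _ => inferInstance⟩) :
    w ⊩ ex fun b : D => (allIn a fun x => exIn b fun y => P x y) ⋏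
      allIn b fun y => exIn a fun x => P x y := by
  obtain ⟨φ, hφ, hφP⟩ := (hP.out (D × D) (fun e => e.2) (fun e => e.1)).out
  have key : ∀ x y w, (w ⊩ eval φ (consEnv x (consEnv y SetModel.enum))) ↔ (w ⊩ P x y) :=
    fun x y w => hφP (y, x) w
  refine Forces.elim ((SetModel.collection φ SetModel.enum w a).mp (v := w)
    fun x v _ hx => ?_) fun v _ b hb => .ex_intro b ⟨fun x u _ hx => ?_, fun y u _ hy => ?_⟩
  · exact (h.app hx).elim fun u _ y hy => .ex_intro y ((key x y u).2 hy)
  · refine ((hb.1 x).mp hx).elim fun u _ y hy => .ex_intro y ⟨hy.1, (key x y u).1 hy.2⟩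
  · refine ((hb.2 y).mp hy).elim fun u _ x hx => .ex_intro x ⟨hx.1, (key x y u).1 hx.2⟩

end

section

variable {W : Type} [Preorder W] {D : Type} [SetModel W D]
  {v w : W} {a b c x y z x' y' p q r s t X Y : D}

/-! ### Pairs -/

theorem exists_upair (x y : D) : w ⊩ ex fun z : D => isUPair z x y :=
  (SetModel.pairing w x y).elim fun _ _ z hz =>
    .ex_intro z ⟨(hz x).bwd (.inl (eq_refl x)), (hz y).bwd (.inr (eq_refl y)),
      fun t _ _ ht => (hz t).fwd ht⟩

theorem mem_of_isUPair_left (h : w ⊩ isUPair z x y) (e : w ⊩ t =ᵢ x) : w ⊩ t ∈ᵢ z :=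
  e.symm.subst (fun t => t ∈ᵢ z) h.1

theorem mem_of_isUPair_right (h : w ⊩ isUPair z x y) (e : w ⊩ t =ᵢ y) : w ⊩ t ∈ᵢ z :=
  e.symm.subst (fun t => t ∈ᵢ z) h.2.1

theorem eq_or_of_isUPair (h : w ⊩ isUPair z x y) (ht : w ⊩ t ∈ᵢ z) : w ⊩ t =ᵢ x ⋎ t =ᵢ y :=
  h.2.2.app ht

theorem eq_of_isUPair_self (h : w ⊩ isUPair z x x) (ht : w ⊩ t ∈ᵢ z) : w ⊩ t =ᵢ x :=
  (eq_or_of_isUPair h ht).cases (fun _ _ h => h) (fun _ _ h => h)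

theorem isUPair_unique (h : w ⊩ isUPair z x y) (h' : w ⊩ isUPair t x y) : w ⊩ z =ᵢ t :=
  eq_of_mem_iff
    (fun _ _ _ hs => (eq_or_of_isUPair h.at hs).cases (fun _ _ e => mem_of_isUPair_left h'.at e)
      (fun _ _ e => mem_of_isUPair_right h'.at e))
    (fun _ _ _ hs => (eq_or_of_isUPair h'.at hs).cases (fun _ _ e => mem_of_isUPair_left h.at e)
      (fun _ _ e => mem_of_isUPair_right h.at e))

theorem exists_pair (x y : D) : w ⊩ ex fun p : D => isPair p x y := by
  refine (exists_upair x x).elim fun w _ s hs => ?_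
  refine (exists_upair x y).elim fun w _ t ht => ?_
  refine (exists_upair s t).elim fun w _ p hp => .ex_intro p ⟨?_, ?_, ?_⟩
  · exact .exIn_intro s hp.1 hs
  · exact .exIn_intro t hp.2.1 ht
  · intro q w _ hq
    refine (eq_or_of_isUPair hp.at hq).cases (fun w _ e => .inl ?_) (fun w _ e => .inr ?_)
    · exact e.symm.subst (fun q => isUPair q x x) hs
    · exact e.symm.subst (fun q => isUPair q x y) ht

theorem sub_of_isPair (h : w ⊩ isPair p x y) (h' : w ⊩ isPair q x y) (hs : w ⊩ s ∈ᵢ p) :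
    w ⊩ s ∈ᵢ q := by
  refine (h.2.2.app hs).cases (fun w _ hu => ?_) (fun w _ hu => ?_)
  · refine h'.at.1.elimIn fun w _ t ht htu => ?_
    exact (isUPair_unique htu hu).subst (fun s => s ∈ᵢ q) ht
  · refine h'.at.2.1.elimIn fun w _ t ht htu => ?_
    exact (isUPair_unique htu hu).subst (fun s => s ∈ᵢ q) ht

theorem isPair_unique (h : w ⊩ isPair p x y) (h' : w ⊩ isPair q x y) : w ⊩ p =ᵢ q :=
  eq_of_mem_iff (fun _ _ _ hs => sub_of_isPair h.at h'.at hs) (fun _ _ _ hs => sub_of_isPair h'.at h.at hs)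

theorem isPair_inj_left (h : w ⊩ isPair p x y) (h' : w ⊩ isPair p x' y') : w ⊩ x =ᵢ x' := by
  refine h.1.elimIn fun w _ s hs hsu => ?_
  refine (h'.2.2.app hs).cases (fun w _ hu => ?_) (fun w _ hu => ?_)
  · exact (eq_of_isUPair_self hsu.at hu.1).symm
  · exact (eq_of_isUPair_self hsu.at hu.1).symm

theorem isPair_snd_eq_or (h : w ⊩ isPair p x y) (h' : w ⊩ isPair p x' y') :
    w ⊩ y =ᵢ y' ⋎ y =ᵢ x := by
  have e := isPair_inj_left h h'
  refine h.2.1.elimIn fun w _ t ht htu => ?_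
  refine (h'.2.2.app ht).cases (fun w _ hu => ?_) (fun w _ hu => ?_)
  · exact .inr ((eq_of_isUPair_self hu htu.2.1).trans e.symm)
  · exact (eq_or_of_isUPair hu htu.2.1).cases (fun w _ h => .inr (h.trans e.symm))
      (fun w _ h => .inl h)

theorem isPair_inj_right (h : w ⊩ isPair p x y) (h' : w ⊩ isPair p x' y') : w ⊩ y =ᵢ y' := by
  refine (isPair_snd_eq_or h h').cases (fun w _ e => e) (fun w _ e => ?_)
  -- The remaining case has `y = x` and `y' = x'`, where equality of the first components decides.
  refine (isPair_snd_eq_or h'.at h.at).cases (fun w _ e' => e'.symm) (fun w _ e' => ?_)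
  exact (e.at.trans (isPair_inj_left h.at h'.at)).trans e'.symm

theorem rel_of_isPair (hp : w ⊩ isPair p x y) (h : w ⊩ p ∈ᵢ r) : w ⊩ rel r x y :=
  .exIn_intro p h hp

theorem mem_of_rel (hp : w ⊩ isPair p x y) (h : w ⊩ rel r x y) : w ⊩ p ∈ᵢ r :=
  h.elimIn fun _ _ _ hq hqp => (isPair_unique hqp hp).subst (fun p => p ∈ᵢ r) hq

theorem fst_mem_of_rel (hr : w ⊩ subProd r a b) (h : w ⊩ rel r x y) : w ⊩ x ∈ᵢ a :=
  h.elimIn fun _ _ _ hp hxy => (hr.app hp).elimIn fun _ _ _ hx h => h.elimIn fun _ _ _ _ h =>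
    (isPair_inj_left h hxy.at).subst (fun x => x ∈ᵢ a) hx

theorem snd_mem_of_rel (hr : w ⊩ subProd r a b) (h : w ⊩ rel r x y) : w ⊩ y ∈ᵢ b :=
  h.elimIn fun _ _ _ hp hxy => (hr.app hp).elimIn fun _ _ _ _ h => h.elimIn fun _ _ _ hy h =>
    (isPair_inj_right h hxy.at).subst (fun y => y ∈ᵢ b) hy

/-- Two sets of pairs that relate the same elements are equal. -/
theorem eq_of_rel_iff (hr : w ⊩ subProd r a b) (hs : w ⊩ subProd s a b)
    (h₁ : ∀ v, Ext v w → ∀ x y : D, (v ⊩ rel r x y) → (v ⊩ rel s x y))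
    (h₂ : ∀ v, Ext v w → ∀ x y : D, (v ⊩ rel s x y) → (v ⊩ rel r x y)) : w ⊩ r =ᵢ s :=
  eq_of_mem_iff
    (fun _ _ _ hp => (hr.app hp).elimIn fun _ _ x _ h => h.elimIn fun _ _ y _ h =>
      mem_of_rel h (h₁ _ inferInstance x y (rel_of_isPair h hp)))
    (fun _ _ _ hp => (hs.app hp).elimIn fun _ _ x _ h => h.elimIn fun _ _ y _ h =>
      mem_of_rel h (h₂ _ inferInstance x y (rel_of_isPair h hp)))

/-! ### Sets given by separation -/

/-- `b = {y ∈ X : P y}`. -/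
def isSet (b X : D) (P : D → Omega W) : Omega W :=
  (allIn b fun y => y ∈ᵢ X ⋏ P y) ⋏ allIn X fun y => P y ⟶ᵢ y ∈ᵢ b

theorem exists_isSet (X : D) (P : D → Omega W)
    (hP : Bdd₁ P := by exact ⟨fun _ _ _ _ => inferInstance⟩) : w ⊩ ex fun b : D => isSet b X P :=
  (exists_sep X P hP).elim fun _ _ b hb => .ex_intro b
    ⟨fun y _ _ hy => (hb y).fwd hy, fun y _ _ hy _ _ h => (hb y).bwd ⟨hy, h⟩⟩

variable {P : D → Omega W}

theorem isSet_sub (h : w ⊩ isSet b X P) : w ⊩ sub b X := fun _ _ _ hy => (h.1.app hy).1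

theorem isSet_prop (h : w ⊩ isSet b X P) [Ext v w] (hy : v ⊩ y ∈ᵢ b) : v ⊩ P y :=
  (h.1.app hy).2

theorem isSet_mem (h : w ⊩ isSet b X P) [Ext v w] (hy : v ⊩ y ∈ᵢ X) (h' : v ⊩ P y) :
    v ⊩ y ∈ᵢ b :=
  (h.2.app hy).mp h'

instance Bdd.of_isSet {E : Type} [Env D E] {s t : E → D} {P : E → D → Omega W} [Tm s] [Tm t]
    [Bdd fun e : E × D => P e.1 e.2] : Bdd fun e => isSet (s e) (t e) (P e) := by
  unfold isSet; infer_instance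

/-- The set of all sets `{y ∈ X : κ(n, y)}`, for `n ∈ N`. -/
theorem exists_family (N X : D) (κ : D → D → Omega W)
    (hκ : Bdd₂ κ := by exact ⟨fun _ _ _ _ _ _ => inferInstance⟩) :
    w ⊩ ex fun 𝓑 : D => (allIn N fun n => exIn 𝓑 fun b => isSet b X (κ n)) ⋏
      allIn 𝓑 fun b => exIn N fun n => isSet b X (κ n) := by
  have := hκ.out
  refine collect N (fun n b => isSet b X (κ n)) (hP := ⟨fun _ _ _ _ _ _ => inferInstance⟩) fun n _ _ _ => ?_
  exact exists_isSet X (κ n)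

/-- Strong Collection is used twice, over `y` for fixed `x` and then over `x`, followed by a union.
Its second half makes each collected set contain nothing but the intended pairs. -/
theorem exists_product (a b : D) :
    w ⊩ ex fun c : D => all fun p : D => p ∈ᵢ c ⟷ᵢ exIn a fun x => exIn b fun y => isPair p x y := by
  have h : w ⊩ allIn a fun x => ex fun s : D =>
      (allIn b fun y => exIn s fun p => isPair p x y) ⋏
        allIn s fun p => exIn b fun y => isPair p x y := fun x _ _ _ =>
    collect b (fun y p => isPair p x y) fun y _ _ _ => exists_pair x y
  refine (collect a _ h).elim fun w _ 𝓢 h𝓢 => ?_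
  refine (SetModel.union w 𝓢).elim fun w _ c hc => .ex_intro c fun p => ⟨fun w _ hp => ?_, fun w _ hp => ?_⟩
  · refine ((hc p).fwd hp).elim fun w _ s hs => ?_
    refine (h𝓢.2.app hs.1).elimIn fun w _ x hx hxs => ?_
    exact .exIn_intro x hx (hxs.2.app hs.2)
  · refine hp.elimIn fun w _ x hx hp => hp.elimIn fun w _ y hy hp => ?_
    refine (h𝓢.1.app' hx).elimIn fun w _ s hs hxs => ?_
    refine (hxs.1.app' hy).elimIn fun w _ q hq hqp => ?_
    exact (hc p).bwd (.ex_intro s ⟨hs, (isPair_unique hqp hp).subst (fun p => p ∈ᵢ s) hq⟩)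

/-- The relation `{⟨x, y⟩ ∈ a × b : P(x, y)}`. -/
theorem exists_rel (a b : D) (P : D → D → Omega W)
    (hP : Bdd₂ P := by exact ⟨fun _ _ _ _ _ _ => inferInstance⟩) :
    w ⊩ ex fun r : D => subProd r a b ⋏
      all fun x : D => all fun y : D => rel r x y ⟷ᵢ (x ∈ᵢ a ⋏ y ∈ᵢ b ⋏ P x y) := by
  have := hP.out
  refine (exists_product a b).elim fun w _ c hc => ?_
  refine (exists_sep c fun p => exIn a fun x => exIn b fun y => isPair p x y ⋏ P x y).elim
    fun w _ r hr => .ex_intro r ⟨fun p w _ hp => (hc p).fwd ((hr p).fwd hp).1, fun x y => ⟨?_, ?_⟩⟩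
  · intro w _ h
    refine h.elimIn fun w _ p hp hxy => ?_
    refine ((hr p).fwd hp).2.elimIn fun w _ x' hx' h => h.elimIn fun w _ y' hy' h => ?_
    have ex := isPair_inj_left h.1 hxy.at
    have ey := isPair_inj_right h.1 hxy.at
    refine ⟨ex.subst (fun x => x ∈ᵢ a) hx', ey.subst (fun y => y ∈ᵢ b) hy', ?_⟩
    exact ey.subst (fun y => P x y) (ex.subst (fun x => P x y') h.2)
  · intro w _ h
    refine (exists_pair x y).elim fun w _ p hp => rel_of_isPair hp ?_
    refine (hr p).bwd ⟨(hc p).bwd ?_, ?_⟩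
    · exact .exIn_intro x h.1 (.exIn_intro y h.2.1 hp)
    · exact .exIn_intro x h.1 (.exIn_intro y h.2.1 ⟨hp, h.2.2⟩)

theorem exists_union (a b : D) :
    w ⊩ ex fun c : D => all fun x : D => x ∈ᵢ c ⟷ᵢ (x ∈ᵢ a ⋎ x ∈ᵢ b) := by
  refine (exists_upair a b).elim fun w _ s hs => ?_
  refine (SetModel.union w s).elim fun w _ c hc => .ex_intro c fun x => ⟨fun w _ hx => ?_, fun w _ hx => ?_⟩
  · refine ((hc x).fwd hx).elim fun w _ t ht => ?_
    refine (eq_or_of_isUPair hs.at ht.1).cases (fun w _ e => .inl ?_) (fun w _ e => .inr ?_)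
    · exact e.subst (fun t => x ∈ᵢ t) ht.2
    · exact e.subst (fun t => x ∈ᵢ t) ht.2
  · exact hx.cases (fun w _ h => (hc x).bwd (.ex_intro a ⟨hs.1, h⟩))
      (fun w _ h => (hc x).bwd (.ex_intro b ⟨hs.2.1, h⟩))

/-- There are two sets that are not equal. -/
theorem exists_ne : w ⊩ ex fun x : D => ex fun y : D => x =ᵢ y ⟶ᵢ bot := by
  -- The two sets are the empty set, separated from an arbitrary set, and its singleton.
  refine (exists_sep (SetModel.enum 0) fun _ => bot).elim fun w _ x hx => .ex_intro x ?_
  refine (exists_upair x x).elim fun w _ y hy => .ex_intro y fun w _ e => ?_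
  exact ((hx x).fwd (e.symm.subst (fun y => x ∈ᵢ y) hy.1 : w ⊩ x ∈ᵢ x)).2

end

section

variable {W : Type} [Preorder W] {D : Type} [SetModel W D]
  {v w : W} {a b c x y z x' y' p q r s t X Y : D}

/-! ## Sets of elementary rules -/

/-- `Y ⊆ X` is closed under the rules `{x} / {y ∈ X : κ(n, y)}`, for `n ∈ N` and `π(n, x)`. -/
def closedUnder (X N : D) (π κ : D → D → Omega W) (Y : D) : Omega W :=
  sub Y X ⋏ allIn N fun n => allIn X fun x => π n x ⟶ᵢ x ∈ᵢ Y ⟶ᵢ exIn Y fun y => κ n y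

/-- By collection the possible conclusions form a set, and so do the singletons of elements of `X`;
the rules are then separated from the product of these two sets. -/
theorem exists_rules (X N : D) (π κ : D → D → Omega W)
    (hπ : Bdd₂ π := by exact ⟨fun _ _ _ _ _ _ => inferInstance⟩)
    (hκ : Bdd₂ κ := by exact ⟨fun _ _ _ _ _ _ => inferInstance⟩) :
    w ⊩ ex fun R : D => elementaryRules X R ⋏
      all fun Y : D => closed X R Y ⟷ᵢ closedUnder X N π κ Y := by
  have := hπ.out
  have := hκ.out
  refine (exists_family N X κ hκ).elim fun w _ 𝓑 h𝓑 => ?_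
  refine (exists_family X X fun x y => y =ᵢ x).elim fun w _ 𝓢 h𝓢 => ?_
  have hsingle : w ⊩ allIn X fun x => exIn 𝓢 fun s => isUPair s x x := by
    intro x w _ hx
    refine (h𝓢.1.app' hx).elimIn fun w _ s hs h => .exIn_intro s hs ⟨?_, ?_, ?_⟩
    · exact isSet_mem h hx (eq_refl x)
    · exact isSet_mem h hx (eq_refl x)
    · exact fun t w _ ht => .inl (isSet_prop (P := fun y => y =ᵢ x) h ht)
  refine (exists_rel 𝓢 𝓑 fun s b => exIn N fun n => exIn X fun x =>
    π n x ⋏ isUPair s x x ⋏ isSet b X (κ n)).elim fun w _ R hR => .ex_intro R ⟨?_, ?_⟩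
  · intro r w _ hr
    refine (hR.1.app' hr).elimIn fun w _ s hs h => h.elimIn fun w _ b hb hsb => ?_
    have := (hR.2 s b).fwd (rel_of_isPair hsb hr)
    refine .ex_intro s (.ex_intro b ?_)
    refine this.2.2.elimIn fun w _ n hn h => h.elimIn fun w _ x hx h => ?_
    refine ⟨hsb, ?_, isSet_sub h.2.2, .ex_intro x h.2.1⟩
    exact fun t w _ ht => (eq_of_isUPair_self h.2.1.at ht).symm.subst (fun t => t ∈ᵢ X) hx
  · refine fun Y => ⟨fun w _ hY => ⟨hY.1, ?_⟩, fun w _ hY => ⟨hY.1, ?_⟩⟩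
    · intro n w _ hn x w _ hx w _ hπx w _ hxY
      refine (h𝓑.1.app' hn).elimIn fun w _ b hb hbn => ?_
      refine (hsingle.app' hx).elimIn fun w _ s hs hsx => ?_
      have hsb : w ⊩ rel R s b :=
        (hR.2 s b).bwd ⟨hs, hb, .exIn_intro n hn (.exIn_intro x hx ⟨hπx, hsx, hbn⟩)⟩
      have hsY : w ⊩ sub s Y := fun t w _ ht =>
        (eq_of_isUPair_self hsx.at ht).symm.subst (fun t => t ∈ᵢ Y) hxY
      refine ((hY.2 s b).mp hsb |>.mp hsY).elimIn fun w _ y hy hyY => ?_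
      exact .exIn_intro y hyY (isSet_prop hbn hy)
    · intro s b w _ hsb w _ hsY
      have h' : w ⊩ _ := (hR.2 s b).fwd hsb
      refine Forces.elimIn h'.2.2 fun w _ n hn h => h.elimIn fun w _ x hx h => ?_
      have hxY : w ⊩ x ∈ᵢ Y := hsY.app h.2.1.1
      refine Forces.elimIn ((((hY.2.app hn).app hx).mp h.1).mp hxY) fun w _ y hy hκy => ?_
      exact .exIn_intro y (isSet_mem h.2.2 (hY.1.app hy) hκy) hy

theorem exists_rules_union {R₁ R₂ : D} (h₁ : w ⊩ elementaryRules X R₁)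
    (h₂ : w ⊩ elementaryRules X R₂) :
    w ⊩ ex fun R : D => elementaryRules X R ⋏
      all fun Y : D => closed X R Y ⟷ᵢ (closed X R₁ Y ⋏ closed X R₂ Y) := by
  refine (exists_union R₁ R₂).elim fun w _ R hR => .ex_intro R ⟨fun r w _ hr => ?_, fun Y => ⟨?_, ?_⟩⟩
  · exact Forces.cases ((hR r).fwd hr) (fun w _ h => h₁.app h) (fun w _ h => h₂.app h)
  · intro w _ hY
    have key : ∀ R' : D, (w ⊩ sub R' R) → w ⊩ closed X R' Y := by
      refine fun R' hR' => ⟨hY.1, fun a b w _ hab => (hY.2 a b).mp ?_⟩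
      exact hab.elimIn fun w _ p hp hpab => .exIn_intro p (hR'.app hp) hpab
    exact ⟨key R₁ fun r w _ h => (hR r).bwd (.inl h), key R₂ fun r w _ h => (hR r).bwd (.inr h)⟩
  · refine fun w _ hY => ⟨hY.1.1, fun a b w _ hab w _ ha => ?_⟩
    refine hab.at.elimIn fun w _ p hp hpab => Forces.cases ((hR p).fwd hp) ?_ ?_
    · exact fun w _ h => Forces.mp ((hY.1.2 a b).mp (rel_of_isPair hpab.at h)) ha
    · exact fun w _ h => Forces.mp ((hY.2.2 a b).mp (rel_of_isPair hpab.at h)) ha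

end

/-! ### Elementary rules between tagged copies of sets -/

section

variable {W : Type} [Preorder W] {D : Type} [SetModel W D]
  {v w : W} {a b c x y z x' y' p q r s t X Y : D}

/-! Variants of `Forces.app` and so on, for an argument that is available at an earlier world. -/

theorem Forces.appAt {u : W} {f : D → Omega W} (h : w ⊩ allIn a f) (hx : u ⊩ x ∈ᵢ a) [Ext w u] :
    w ⊩ f x := h.app (v := w) hx.at

theorem Forces.mpAt {u : W} {A B : Omega W} (h : w ⊩ A ⟶ᵢ B) (hA : u ⊩ A) [Ext w u] : w ⊩ B :=
  h.mp (v := w) hA.at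

/-- `β ⊆ X` is closed under the rules `⟨τ, y⟩ / {⟨σ, z⟩ : z ∈ Z, κ(n, z)}`, for `n ∈ N`, `y ∈ Y` and
`π(n, y)`. -/
def closedUnderTagged (X τ σ Y Z N : D) (π κ : D → D → Omega W) (β : D) : Omega W :=
  sub β X ⋏ allIn N fun n => allIn Y fun y => π n y ⟶ᵢ rel β τ y ⟶ᵢ
    exIn Z fun z => κ n z ⋏ rel β σ z

/-- There is a set of elementary rules on `X` with closed sets `Φ`. -/
def presented (X : D) (Φ : D → Omega W) : Omega W :=
  ex fun R : D => elementaryRules X R ⋏ all fun β : D => closed X R β ⟷ᵢ Φ β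

theorem presented_closedUnderTagged (X τ σ Y Z N : D) (π κ : D → D → Omega W)
    (hπ : Bdd₂ π := by exact ⟨fun _ _ _ _ _ _ => inferInstance⟩)
    (hκ : Bdd₂ κ := by exact ⟨fun _ _ _ _ _ _ => inferInstance⟩) :
    w ⊩ presented X (closedUnderTagged X τ σ Y Z N π κ) := by
  have := hπ.out
  have := hκ.out
  refine (exists_rules X N (fun n t => exIn Y fun y => isPair t τ y ⋏ π n y)
    (fun n t => exIn Z fun z => isPair t σ z ⋏ κ n z)).elim fun w _ R hR =>
      .ex_intro R ⟨hR.1, fun β => ⟨fun w _ h => ?_, fun w _ h => (hR.2 β).bwd ?_⟩⟩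
  · have h : w ⊩ _ := (hR.2 β).fwd h
    refine ⟨h.1, fun n w _ hn y w _ hy w _ hπ w _ hβ => hβ.elimIn fun w _ t ht hty => ?_⟩
    have hn' : w ⊩ _ := h.2.app' hn
    have ht' : w ⊩ _ := hn'.app (h.1.app' ht)
    have hπ' : w ⊩ exIn Y fun y => isPair t τ y ⋏ π n y := .exIn_intro y hy.at ⟨hty, hπ⟩
    refine Forces.elimIn ((ht'.mp hπ').mp ht) fun w _ s hs hsz => ?_
    exact hsz.elimIn fun w _ z hz hsz => .exIn_intro z hz ⟨hsz.2, rel_of_isPair hsz.1 hs⟩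
  · refine ⟨h.1, fun n w _ hn t w _ _ w _ hπ w _ hβ => Forces.elimIn hπ.at fun w _ y hy hty => ?_⟩
    have hn' : w ⊩ _ := h.2.app' hn
    have hy' : w ⊩ _ := hn'.app hy
    refine Forces.elimIn ((hy'.mp hty.2).mp (rel_of_isPair hty.1 hβ)) fun w _ z hz hκ => ?_
    refine hκ.2.elimIn fun w _ s hs hsz => .exIn_intro s hs (.exIn_intro z hz ⟨hsz, hκ.1⟩)

theorem presented_and {Φ₁ Φ₂ : D → Omega W} (h₁ : w ⊩ presented X Φ₁) (h₂ : w ⊩ presented X Φ₂) :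
    w ⊩ presented X fun β => Φ₁ β ⋏ Φ₂ β := by
  refine h₁.elim fun w _ R₁ h₁ => Forces.elim h₂.at fun w _ R₂ h₂ => ?_
  refine (exists_rules_union h₁.1.at h₂.1).elim fun w _ R hR => .ex_intro R ⟨hR.1, fun β => ?_⟩
  refine ⟨fun w _ h => ?_, fun w _ h => (hR.2 β).bwd ?_⟩
  · have h : w ⊩ _ := (hR.2 β).fwd h
    exact ⟨(h₁.2 β).fwd h.1, (h₂.2 β).fwd h.2⟩
  · exact ⟨(h₁.2 β).bwd h.1, (h₂.2 β).bwd h.2⟩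

/-- A set into which both of two sets embed. -/
theorem exists_tagged (τ σ Y J : D) :
    w ⊩ ex fun X : D => (allIn Y fun y => exIn X fun t => isPair t τ y) ⋏
      allIn J fun j => exIn X fun t => isPair t σ j := by
  refine (exists_upair τ σ).elim fun w _ T hT => (exists_union Y J).elim fun w _ Z hZ => ?_
  -- The product `{τ, σ} × (Y ∪ J)` is larger than a disjoint union, which is harmless: only the two
  -- embeddings matter.
  refine (exists_product T Z).elim fun w _ X hX => .ex_intro X ⟨fun y w _ hy => ?_, fun y w _ hy => ?_⟩
  · refine (exists_pair τ y).elim fun w _ t ht => .exIn_intro t ?_ ht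
    exact (hX t).bwd (.exIn_intro τ hT.1 (.exIn_intro y ((hZ y).bwd (.inl hy)) ht))
  · refine (exists_pair σ y).elim fun w _ t ht => .exIn_intro t ?_ ht
    exact (hX t).bwd (.exIn_intro σ hT.2.1 (.exIn_intro y ((hZ y).bwd (.inr hy)) ht))

/-! ## Sets closed under two-step rules -/

/-- The conclusion of the two-step rules with premise `j`. -/
def step (M : D) (γ δ₁ δ₂ : D → D → Omega W) (U j : D) : Omega W :=
  allIn M fun m => γ m j ⟶ᵢ (exIn U fun y => δ₁ m y) ⋏ exIn U fun y => δ₂ m y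

/-- `U ⊆ Y` is closed under the rules that derive from `x ∈ U` that for some `j`, all the
sets `j` leads to are inhabited in `U`, and under the unary rules `lam`. -/
def good (Y J M : D) (α β γ δ₁ δ₂ lam : D → D → Omega W) (U : D) : Omega W :=
  sub U Y ⋏ (allIn U fun x => allIn Y fun x' => lam x x' ⟶ᵢ x' ∈ᵢ U) ⋏
    allIn U fun x => allIn M fun m => α m x ⟶ᵢ exIn J fun j => β m j ⋏ step M γ δ₁ δ₂ U j

/-- The members of `𝒢` are `good`, and every `good` set is a union of members of `𝒢`. -/
def generates (𝒢 : D) (good : D → Omega W) : Omega W :=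
  allIn 𝒢 good ⋏ all fun U : D => good U ⟶ᵢ allIn U fun x => exIn 𝒢 fun V => x ∈ᵢ V ⋏ sub V U

/-- The intermediate choice of `j` is made visible by placing `J` beside `Y` in a tagged set `X`. On
`X` the two steps are separate elementary rules, so NID applies, and the traces on `Y` of the
generators of closed sets generate the good sets. -/
theorem exists_generates (hNID : w ⊩ Sem.elementaryNID D) (Y J M : D)
    (α β γ δ₁ δ₂ lam : D → D → Omega W)
    (hα : Bdd₂ α := by exact ⟨fun _ _ _ _ _ _ => inferInstance⟩)
    (hβ : Bdd₂ β := by exact ⟨fun _ _ _ _ _ _ => inferInstance⟩)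
    (hγ : Bdd₂ γ := by exact ⟨fun _ _ _ _ _ _ => inferInstance⟩)
    (hδ₁ : Bdd₂ δ₁ := by exact ⟨fun _ _ _ _ _ _ => inferInstance⟩)
    (hδ₂ : Bdd₂ δ₂ := by exact ⟨fun _ _ _ _ _ _ => inferInstance⟩)
    (hlam : Bdd₂ lam := by exact ⟨fun _ _ _ _ _ _ => inferInstance⟩) :
    w ⊩ ex fun 𝒢 : D => generates 𝒢 (good Y J M α β γ δ₁ δ₂ lam) := by
  have := hα.out
  have := hβ.out
  have := hγ.out
  have := hδ₁.out
  have := hδ₂.out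
  have := hlam.out
  have hstep (U : D) : Bdd₁ (step M γ δ₁ δ₂ U) :=
    ⟨fun _ _ _ _ => by unfold step; infer_instance⟩
  refine (exists_ne (D := D)).elim fun w _ τ hτ => hτ.elim fun w _ σ hne => ?_
  refine (exists_tagged τ σ Y J).elim fun w _ X hX => ?_
  -- Four families of rules: `x` yields some `j`; the unary rules `lam`, with the singleton of `x'`
  -- as conclusion; and `j` yields some `y`, once for `δ₁` and once for `δ₂`.
  have hpres := presented_and
    (presented_and (presented_closedUnderTagged (w := w) X τ σ Y J M α β)
      (presented_closedUnderTagged X τ τ Y Y Y (fun x' x => lam x x') (fun x' x => x =ᵢ x')))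
    (presented_and (presented_closedUnderTagged X σ τ J Y M γ δ₁)
      (presented_closedUnderTagged X σ τ J Y M γ δ₂))
  refine hpres.elim fun w _ R hR => ?_
  have hG : w ⊩ _ := (hNID X R).mp hR.1
  refine hG.elim fun w _ G hG => ?_
  refine (exists_family G Y fun b x => rel b τ x).elim fun w _ 𝒢 h𝒢 =>
    .ex_intro 𝒢 ⟨fun V w _ hV => ?_, fun U w _ hU x w _ hx => ?_⟩
  · refine (h𝒢.2.app hV).elimIn fun w _ b hb hbV => ?_
    have hb' : w ⊩ _ := (hR.2 b).fwd (hG.1.app hb)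
    obtain ⟨⟨h₁, h₂⟩, h₃, h₄⟩ : w ⊩ _ := hb'
    refine ⟨isSet_sub hbV, fun x w _ hx x' w _ hx' w _ h => ?_, fun x w _ hx m w _ hm w _ h => ?_⟩
    · have hxY : w ⊩ x ∈ᵢ Y := (isSet_sub hbV).app' hx
      have := ((h₂.2.app hx').app hxY).mp h
      refine Forces.elimIn (this.mp (isSet_prop hbV hx.at)) fun w _ z hzY hz => ?_
      exact hz.1.subst (fun z => z ∈ᵢ V) (isSet_mem hbV hzY hz.2)
    · have hxY : w ⊩ x ∈ᵢ Y := (isSet_sub hbV).app' hx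
      have h := ((h₁.2.app hm).app hxY).mp h
      refine Forces.elimIn (h.mp (isSet_prop hbV hx.at)) fun w _ j hj hβ => ?_
      refine .exIn_intro j hj ⟨hβ.1, fun m w _ hm w _ h => ⟨?_, ?_⟩⟩
      · have h := ((h₃.2.app hm).app (hj.at : w ⊩ _)).mp h
        refine Forces.elimIn (h.mp hβ.2) fun w _ y hy hδ => ?_
        exact .exIn_intro y (isSet_mem hbV hy hδ.2) hδ.1
      · have h := ((h₄.2.app hm).app (hj.at : w ⊩ _)).mp h
        refine Forces.elimIn (h.mp hβ.2) fun w _ y hy hδ => ?_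
        exact .exIn_intro y (isSet_mem hbV hy hδ.2) hδ.1
  · have := (hstep U).out
    -- The closed set belonging to a good `U` consists of the copy of `U` together with the copies
    -- of all `j` whose second step can be carried out inside `U`. Distinctness of the tags keeps
    -- the two parts apart.
    refine (exists_isSet X fun t => (exIn U fun x => isPair t τ x) ⋎
      exIn J fun j => isPair t σ j ⋏ step M γ δ₁ δ₂ U j).elim fun w _ b hb => ?_
    have h₁ : w ⊩ all fun x => rel b τ x ⟷ᵢ x ∈ᵢ U := by
      refine fun x => ⟨fun w _ h => h.elimIn fun w _ t ht htx => ?_, fun w _ h => ?_⟩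
      · refine (isSet_prop hb ht).cases (fun w _ h => h.elimIn fun w _ x' hx' h => ?_)
          (fun w _ h => h.elimIn fun w _ j hj h => ?_)
        · exact (isPair_inj_right h htx.at).subst (fun x => x ∈ᵢ U) hx'
        · exact (hne.mp (isPair_inj_left htx.at h.1)).bot_elim
      · have hxY : w ⊩ x ∈ᵢ Y := hU.1.app h
        refine (hX.1.app' hxY).elimIn fun w _ t ht htx => rel_of_isPair htx ?_
        exact isSet_mem hb ht (.inl (.exIn_intro x h.at htx))
    have h₂ : w ⊩ allIn J fun j => rel b σ j ⟷ᵢ step M γ δ₁ δ₂ U j := by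
      refine fun j w _ hj => ⟨fun w _ h => h.elimIn fun w _ t ht htx => ?_, fun w _ h => ?_⟩
      · refine (isSet_prop hb ht).cases (fun w _ h => h.elimIn fun w _ x' hx' h => ?_)
          (fun w _ h => h.elimIn fun w _ j hj h => ?_)
        · exact (hne.mp (isPair_inj_left h htx.at)).bot_elim
        · exact (isPair_inj_right h.1 htx.at).subst (fun x => step M γ δ₁ δ₂ U x) h.2
      · refine (hX.2.app' hj).elimIn fun w _ t ht htx => rel_of_isPair htx ?_
        exact isSet_mem hb ht (.inr (.exIn_intro j hj.at ⟨htx, h⟩))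
    have hbX := isSet_sub hb
    have hcl : w ⊩ closed X R b := by
      refine (hR.2 b).bwd (v := w) ⟨⟨⟨hbX, ?_⟩, hbX, ?_⟩, ⟨hbX, ?_⟩, hbX, ?_⟩
      · intro m w _ hm x w _ hx w _ hα w _ hbx
        have hxU : w ⊩ x ∈ᵢ U := (h₁ x).fwd hbx
        have h := ((hU.2.2.app hxU).appAt hm).mpAt hα
        refine Forces.elimIn (h : w ⊩ _) fun w _ j hj h => .exIn_intro j hj ⟨h.1, ?_⟩
        exact (h₂.app hj).bwd h.2
      · intro x' w _ hx' x w _ hx w _ hlam w _ hbx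
        have hxU : w ⊩ x ∈ᵢ U := (h₁ x).fwd hbx
        have h := ((hU.2.1.app hxU).appAt hx').mpAt hlam
        exact .exIn_intro x' hx' ⟨eq_refl x', (h₁ x').bwd h⟩
      · intro m w _ hm j w _ hj w _ hγ w _ hbj
        have h : w ⊩ _ := (h₂.app hj).fwd hbj
        have h := ((h.appAt hm).mpAt hγ).1
        refine Forces.elimIn (h : w ⊩ _) fun w _ y hy h => ?_
        exact .exIn_intro y (hU.1.app hy) ⟨h, (h₁ y).bwd hy⟩
      · intro m w _ hm j w _ hj w _ hγ w _ hbj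
        have h : w ⊩ _ := (h₂.app hj).fwd hbj
        have h := ((h.appAt hm).mpAt hγ).2
        refine Forces.elimIn (h : w ⊩ _) fun w _ y hy h => ?_
        exact .exIn_intro y (hU.1.app hy) ⟨h, (h₁ y).bwd hy⟩
    -- A generator through the copy of `x` and below `b` has as its trace on `Y` the required member
    -- of `𝒢`.
    refine (exists_pair τ x).elim fun w _ t ht => ?_
    have htb : w ⊩ t ∈ᵢ b := mem_of_rel ht ((h₁ x).bwd hx.at)
    refine Forces.elimIn (((hG.2 b).mp hcl).app' htb) fun w _ b' hb' h => ?_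
    refine (h𝒢.1.app' hb').elimIn fun w _ V hV hVb => .exIn_intro V hV ⟨?_, fun y w _ hy => ?_⟩
    · exact isSet_mem hVb (hU.1.app' hx) (rel_of_isPair ht.at h.1)
    · refine (isSet_prop hVb hy).elimIn fun w _ s hs hsy => ?_
      exact (h₁ y).fwd (rel_of_isPair hsy (h.2.app' hs))

end

/-! ## Local truth in a formal space -/

namespace Sem.Space

section

variable {W : Type} [Preorder W] {D : Type} [SetModel W D]
  {u v w : W} {a b c x y z x' y' p q r s t X Y S R J : D} {A : Space D} {Φ Ψ : D → Omega W}

/-- `Φ` holds on a cover of `p`. -/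
def loc (A : Space D) (p : D) (Φ : D → Omega W) : Omega W :=
  ex fun S : D => A.cov S p ⋏ allIn S fun p' => Φ p'

/-- All the basic covers are in `J`. -/
def boundedBy (A : Space D) (J : D) : Omega W :=
  all fun p : D => all fun R : D => rel A.bcov p R ⟶ᵢ R ∈ᵢ J

/-- The bounded variant of `loc`. -/
def locIn (A : Space D) (J p : D) (Φ : D → Omega W) : Omega W :=
  exIn J fun R => rel A.bcov p R ⋏ allIn R fun p' => Φ p'

instance {E : Type} [Env D E] {p : E → D} {P : E → D → Omega W} [Tm p]
    [Bdd fun e : (E × D) × D => P e.1.1 e.2] : Bdd fun e => A.locIn J (p e) (P e) := by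
  unfold locIn; infer_instance

/-- With Kuratowski pairs, the second component of a member of `bcov` is an element of the double
union of `bcov`. -/
theorem exists_boundedBy (A : Space D) : w ⊩ ex fun J : D => A.boundedBy J := by
  refine (SetModel.union w A.bcov).elim fun w _ K hK => ?_
  refine (SetModel.union w K).elim fun w _ J hJ => .ex_intro J fun p R w _ h => ?_
  refine h.elimIn fun w _ t ht hpR => hpR.2.1.elimIn fun w _ s hs hsR => ?_
  exact (hJ R).bwd (.ex_intro s ⟨(hK s).bwd (.ex_intro t ⟨ht.at, hs⟩), hsR.2.1⟩)

theorem le_refl (hA : u ⊩ A.isFormalSpace) [Ext w u] (hp : w ⊩ p ∈ᵢ A.pt) : w ⊩ A.le p p :=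
  hA.1.2.1.app hp

theorem le_trans (hA : u ⊩ A.isFormalSpace) [Ext w u] (h : w ⊩ A.le x y) (h' : w ⊩ A.le y z) :
    w ⊩ A.le x z :=
  ((hA.1.2.2 x y z).mp h).mp h'

theorem mem_left (hA : u ⊩ A.isFormalSpace) [Ext w u] (h : w ⊩ A.le x y) : w ⊩ x ∈ᵢ A.pt :=
  fst_mem_of_rel hA.1.1.at h

theorem mem_right (hA : u ⊩ A.isFormalSpace) [Ext w u] (h : w ⊩ A.le x y) : w ⊩ y ∈ᵢ A.pt :=
  snd_mem_of_rel hA.1.1.at h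

theorem sieve_of_bcov (hA : u ⊩ A.isFormalSpace) [Ext w u] (h : w ⊩ rel A.bcov p R) :
    w ⊩ A.sieve R p := by
  refine h.elimIn fun w _ t ht hpR => (hA.2.1.app ht).elimIn fun w _ p' hp' h => ?_
  refine h.elim fun w _ R' h => ?_
  refine (isPair_inj_right h.1 hpR.at).subst (fun R => A.sieve R p) ?_
  exact (isPair_inj_left h.1 hpR.at).subst (fun p => A.sieve R' p) h.2

theorem mem_of_bcov (hA : u ⊩ A.isFormalSpace) [Ext w u] (h : w ⊩ rel A.bcov p R) :
    w ⊩ p ∈ᵢ A.pt := by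
  refine h.elimIn fun w _ t ht hpR => (hA.2.1.app ht).elimIn fun w _ p' hp' h => ?_
  exact h.elim fun w _ R' h => (isPair_inj_left h.1 hpR.at).subst (fun p => p ∈ᵢ A.pt) hp'.at

/-- `loc` quantifies over arbitrary covers and so cannot be used in Bounded Separation. Restricting
to basic covers, all of which lie in `J`, loses nothing, and this lemma and the next pass between
the two forms. -/
theorem loc_of_locIn (hA : u ⊩ A.isFormalSpace) [Ext w u] (h : w ⊩ A.locIn J p Φ) :
    w ⊩ A.loc p Φ :=
  h.elimIn fun _ _ R _ h => .ex_intro R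
    ⟨⟨sieve_of_bcov hA h.1, .ex_intro R ⟨h.1, fun _ _ _ h => h⟩⟩, h.2⟩

theorem locIn_of_loc (hJ : u ⊩ A.boundedBy J) [Ext w u] (h : w ⊩ A.loc p Φ) :
    w ⊩ A.locIn J p Φ :=
  h.elim fun _ _ _ h => h.1.2.elim fun _ _ R hR =>
    .exIn_intro R ((hJ p R).mp hR.1) ⟨hR.1, fun _ _ _ hx => h.2.app (hR.2.app hx)⟩

theorem mem_of_loc (hA : u ⊩ A.isFormalSpace) [Ext w u] (h : w ⊩ A.loc p Φ) : w ⊩ p ∈ᵢ A.pt :=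
  h.elim fun _ _ _ h => h.1.2.elim fun _ _ _ hR => mem_of_bcov hA hR.1

theorem loc_mono (h : w ⊩ A.loc p Φ)
    (k : ∀ v, Ext v w → ∀ x, (v ⊩ x ∈ᵢ A.pt) → (v ⊩ A.le x p) → (v ⊩ Φ x) → v ⊩ Ψ x) :
    w ⊩ A.loc p Ψ :=
  h.elim fun _ _ S h => .ex_intro S ⟨h.1, fun x _ _ hx =>
    have hx' := h.1.1.app hx
    k _ inferInstance x hx'.1 hx'.2.1 (h.2.app hx)⟩

theorem loc_unit (hA : u ⊩ A.isFormalSpace) [Ext w u] (hp : w ⊩ p ∈ᵢ A.pt)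
    (h : ∀ v, Ext v w → ∀ x, (v ⊩ x ∈ᵢ A.pt) → (v ⊩ A.le x p) → v ⊩ Φ x) : w ⊩ A.loc p Φ := by
  refine (exists_isSet A.pt fun x => A.le x p).elim fun w _ S hS => .ex_intro S ⟨?_, ?_⟩
  · refine ((hA.2.2.1.app hp) S).mp (v := w) fun x => ⟨fun w _ hx => ?_, fun w _ hx => ?_⟩
    · exact isSet_prop (P := fun x => A.le x p) hS hx
    · exact isSet_mem hS (mem_left hA hx) hx
  · exact fun x w _ hx => h w inferInstance x ((isSet_sub hS).app hx) (isSet_prop (P := fun x => A.le x p) hS hx)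

theorem loc_stable (hA : u ⊩ A.isFormalSpace) [Ext w u] (h : w ⊩ A.loc p Φ) (hq : w ⊩ A.le q p) :
    w ⊩ A.loc q Φ := by
  refine h.elim fun w _ S h => ?_
  refine (exists_isSet S fun x => A.le x q).elim fun w _ S' hS => .ex_intro S' ⟨?_, ?_⟩
  · have hp : w ⊩ _ := hA.2.2.2.1.app (mem_right hA hq.at : w ⊩ p ∈ᵢ A.pt)
    have hq' : w ⊩ _ := ((hp S).mpAt h.1).app (mem_left hA hq.at : w ⊩ q ∈ᵢ A.pt)
    refine ((hq'.mpAt hq) S').mp (v := w) fun x => ⟨fun w _ hx => ?_, fun w _ hx => ?_⟩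
    · exact ⟨(isSet_sub hS).app hx, isSet_prop (P := fun x => A.le x q) hS hx⟩
    · exact isSet_mem hS hx.1 hx.2
  · exact fun x w _ hx => h.2.app ((isSet_sub hS).app hx)

/-- Local character, applied to the sieve of all `x ≤ p` with `Φ x`. Boundedness of `Φ` makes this a
set, and `hdown` makes it a sieve. -/
theorem loc_bind (hA : u ⊩ A.isFormalSpace) [Ext w u] (h : w ⊩ A.loc p Ψ)
    (k : ∀ v, Ext v w → ∀ x, (v ⊩ x ∈ᵢ A.pt) → (v ⊩ A.le x p) → (v ⊩ Ψ x) → v ⊩ A.loc x Φ)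
    (hdown : ∀ v, Ext v w → ∀ x y, (v ⊩ A.le y x) → (v ⊩ A.le x p) → (v ⊩ Φ x) → v ⊩ Φ y)
    (hΦ : Bdd₁ Φ := by exact ⟨fun _ _ _ _ => inferInstance⟩) : w ⊩ A.loc p Φ := by
  have := hΦ.out
  have hp := mem_of_loc hA h
  refine h.elim fun w _ S h => ?_
  refine (exists_isSet A.pt fun x => A.le x p ⋏ Φ x).elim fun w _ R hR => .ex_intro R ⟨?_, ?_⟩
  · have hp' : w ⊩ _ := hA.2.2.2.2.app (hp.at : w ⊩ _)
    have hsieve : w ⊩ A.sieve R p := by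
      intro x w _ hx
      have hx' := isSet_prop hR hx
      refine ⟨(isSet_sub hR).app hx, hx'.1, fun y w _ hy w _ hyx => ?_⟩
      exact isSet_mem hR hy.at ⟨le_trans hA hyx hx'.1.at,
        hdown w inferInstance x y hyx hx'.1.at hx'.2.at⟩
    refine (((hp' S).mpAt h.1 R).mp hsieve).mp (v := w) fun q w _ hq R' w _ hR' => ?_
    have hqS : w ⊩ _ := h.1.1.app' hq
    refine (k w inferInstance q hqS.1 hqS.2.1 (h.2.app' hq)).elim fun w _ T hT => ⟨?_, ?_⟩
    · intro x w _ hx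
      have hx' : w ⊩ _ := (hR' x).fwd hx
      have hxR : w ⊩ _ := hsieve.app hx'.1
      refine ⟨hxR.1, hx'.2, fun y w _ hy w _ hyx => ?_⟩
      exact (hR' y).bwd ⟨(hxR.2.2.app hy).mp hyx, le_trans hA hyx hx'.2.at⟩
    · refine hT.1.2.elim fun w _ R₁ hR₁ => .ex_intro R₁ ⟨hR₁.1, fun x w _ hx => ?_⟩
      have hxT : w ⊩ _ := hR₁.2.app hx
      have hx' : w ⊩ _ := hT.1.1.app hxT
      refine (hR' x).bwd ⟨isSet_mem hR hx'.1 ⟨le_trans hA hx'.2.1 hqS.2.1.at, hT.2.app hxT⟩, hx'.2.1⟩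
  · exact fun x w _ hx => (isSet_prop hR hx).2

end

end Sem.Space

open SetStr Omega Sem Space

/-! ## Morphisms -/

section

variable {W : Type} [Preorder W] {D : Type} [SetModel W D]
  {u v w : W} {a b c x y z x' y' p q r s t X Y S R J F : D} {A B C : Space D} {Φ Ψ : D → Omega W}

theorem fst_mem_of_mor (hF : u ⊩ isMor A B F) [Ext w u] (h : w ⊩ rel F p q) : w ⊩ p ∈ᵢ A.pt :=
  fst_mem_of_rel hF.1.at h

theorem snd_mem_of_mor (hF : u ⊩ isMor A B F) [Ext w u] (h : w ⊩ rel F p q) : w ⊩ q ∈ᵢ B.pt :=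
  snd_mem_of_rel hF.1.at h

theorem mor_mono (hF : u ⊩ isMor A B F) [Ext w u] (h : w ⊩ rel F p q) (hp : w ⊩ A.le x p)
    (hq : w ⊩ B.le q y) : w ⊩ rel F x y :=
  (((hF.2.1 p q x y).mp h).mp hp).mp hq

theorem mor_of_loc (hF : u ⊩ isMor A B F) [Ext w u] (hA : w ⊩ A.isFormalSpace)
    (hq : w ⊩ q ∈ᵢ B.pt) (h : w ⊩ A.loc p fun p' => rel F p' q) : w ⊩ rel F p q := by
  have h' : w ⊩ _ := (hF.2.2.1.app hq).app (mem_of_loc hA h)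
  exact h.elim fun w _ S hS => Forces.mp ((h' S).mp hS.1) hS.2

theorem mor_total (hF : u ⊩ isMor A B F) [Ext w u] (hp : w ⊩ p ∈ᵢ A.pt) :
    w ⊩ A.loc p fun p' => exIn B.pt fun q => rel F p' q :=
  hF.2.2.2.1.app hp

theorem mor_inter (hF : u ⊩ isMor A B F) [Ext w u] (h₀ : w ⊩ rel F p x) (h₁ : w ⊩ rel F p y) :
    w ⊩ A.loc p fun p' => exIn B.pt fun r => B.le r x ⋏ B.le r y ⋏ rel F p' r := by
  have h : w ⊩ _ := hF.2.2.2.2.1.app (snd_mem_of_mor hF h₀)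
  exact Forces.mp (((h.app (snd_mem_of_mor hF h₁)).app (fst_mem_of_mor hF h₀)).mp h₀) h₁

theorem mor_cov (hF : u ⊩ isMor A B F) [Ext w u] (h : w ⊩ rel F p q) (hS : w ⊩ B.cov S q) :
    w ⊩ A.loc p fun p' => exIn S fun q' => rel F p' q' := by
  have h' : w ⊩ _ := hF.2.2.2.2.2.app (fst_mem_of_mor hF h)
  exact Forces.mp (((h'.app (snd_mem_of_mor hF h)).mp h) S) hS

/-! ## The space of a family of open sets -/

/-- `opn` is a class of downwards closed sets that is closed under finite intersections. -/
def isTopology (B : Space D) (opn : D → Omega W) : Omega W :=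
  opn B.pt ⋏
  (all fun U : D => opn U ⟶ᵢ sub U B.pt ⋏ allIn U fun x => all fun y : D => B.le y x ⟶ᵢ y ∈ᵢ U) ⋏
  all fun U : D => all fun V : D => all fun I : D => opn U ⟶ᵢ opn V ⟶ᵢ
    isSet I U (fun x => x ∈ᵢ V) ⟶ᵢ opn I

/-- `U` is covered by the members of `𝒱`. -/
def covering (B : Space D) (𝒱 U : D) : Omega W :=
  allIn U fun q => B.loc q fun q' => exIn 𝒱 fun V => q' ∈ᵢ V

/-- The points of `C` are sets of points of `B`, with the order and the covers these have as open
sets of `B`. -/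
def isSpaceOfOpens (B C : Space D) : Omega W :=
  subProd C.ord C.pt C.pt ⋏
  (all fun U : D => all fun V : D => C.le U V ⟷ᵢ (U ∈ᵢ C.pt ⋏ V ∈ᵢ C.pt ⋏ sub U V)) ⋏
  C.isBCov ⋏
  all fun 𝒱 : D => all fun U : D => C.cov 𝒱 U ⟷ᵢ (U ∈ᵢ C.pt ⋏ C.sieve 𝒱 U ⋏ covering B 𝒱 U)

/-- The covering sieves form a class, so NID must supply the basic ones. That the sets tagged `σ`
cover the sets tagged `τ` is a two-step condition: for `q ∈ U` there is a basic cover of `q`, each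
member of which lies in some `V`. The `σ`-parts of generators provide the candidates for basic
covers. -/
theorem exists_space (hNID : w ⊩ Sem.elementaryNID D) (hB : w ⊩ B.isFormalSpace) (𝒢 : D) :
    w ⊩ ex fun o : D => ex fun b : D => isSpaceOfOpens B ⟨𝒢, o, b⟩ := by
  refine (B.exists_boundedBy).elim fun w _ J hJ => ?_
  refine (exists_ne (D := D)).elim fun w _ τ hτ => hτ.elim fun w _ σ hne => ?_
  refine (exists_upair τ σ).elim fun w _ T hT => (exists_product T 𝒢).elim fun w _ Y hY => ?_
  -- A single conclusion is wanted here, so `δ₁` and `δ₂` coincide. The unary rules make the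
  -- `σ`-part closed under smaller members of `𝒢`, so that it can be a sieve.
  refine (exists_generates hNID.at Y J B.pt (fun q x => exIn 𝒢 fun U => isPair x τ U ⋏ q ∈ᵢ U)
    (fun q S => rel B.bcov q S) (fun q S => q ∈ᵢ S)
    (fun q y => exIn 𝒢 fun V => isPair y σ V ⋏ q ∈ᵢ V)
    (fun q y => exIn 𝒢 fun V => isPair y σ V ⋏ q ∈ᵢ V)
    (fun x x' => exIn 𝒢 fun V => exIn 𝒢 fun V' => isPair x σ V ⋏ isPair x' σ V' ⋏ sub V' V)).elim
    fun w _ G hG => ?_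
  refine (exists_family G 𝒢 fun b V => rel b σ V).elim fun w _ H hH => ?_
  refine (exists_rel 𝒢 𝒢 fun U V => sub U V).elim fun w _ o ho => .ex_intro o ?_
  refine (exists_rel 𝒢 H fun U R => Space.sieve ⟨𝒢, o, o⟩ R U ⋏ allIn U fun q =>
    B.locIn J q fun q' => exIn R fun V => q' ∈ᵢ V).elim fun w _ b hb => .ex_intro b ?_
  refine ⟨ho.1.at, ho.2.at, fun t w _ ht => ?_, fun 𝒱 U => ⟨fun w _ h => ?_, fun w _ h₀ => ?_⟩⟩
  · refine (hb.1.app' ht).elimIn fun w _ U hU h => h.elimIn fun w _ R hR h => ?_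
    have h' : w ⊩ _ := (hb.2 U R).fwd (rel_of_isPair h ht.at)
    exact .exIn_intro U hU.at (.ex_intro R ⟨h, h'.2.2.1⟩)
  · refine h.2.elim fun w _ R hR => ?_
    have h' : w ⊩ _ := (hb.2 U R).fwd hR.1
    refine ⟨h'.1, h.1.at, fun q w _ hq => ?_⟩
    refine loc_mono (loc_of_locIn hB (h'.2.2.2.app hq)) fun w _ x hx _ h => ?_
    exact h.elimIn fun w _ V hV h => .exIn_intro V (hR.2.app hV) h
  · have hYτ : w ⊩ allIn 𝒢 fun V => exIn Y fun t => isPair t τ V := fun V w _ hV =>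
      (exists_pair τ V).elim fun w _ t ht =>
        .exIn_intro t ((hY t).bwd (.exIn_intro τ hT.1 (.exIn_intro V hV ht))) ht
    have hYσ : w ⊩ allIn 𝒢 fun V => exIn Y fun t => isPair t σ V := fun V w _ hV =>
      (exists_pair σ V).elim fun w _ t ht =>
        .exIn_intro t ((hY t).bwd (.exIn_intro σ hT.2.1 (.exIn_intro V hV ht))) ht
    -- The covering of `U` by `𝒱` is encoded as one good set: `U` with tag `τ` and the members of
    -- `𝒱` with tag `σ`.
    refine (exists_isSet Y fun t => isPair t τ U ⋎ exIn 𝒱 fun V => isPair t σ V).elim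
      fun w _ K hK => ?_
    have hτK : w ⊩ all fun t => all fun V => isPair t τ V ⟶ᵢ t ∈ᵢ K ⟶ᵢ V =ᵢ U := by
      intro t V w _ ht w _ htK
      refine (isSet_prop hK htK).cases (fun w _ h => isPair_inj_right ht.at h) fun w _ h => ?_
      exact h.elimIn fun w _ V' _ h => (hne.mp (isPair_inj_left ht.at h)).bot_elim
    have hσK : w ⊩ all fun t => all fun V => isPair t σ V ⟶ᵢ t ∈ᵢ K ⟶ᵢ V ∈ᵢ 𝒱 := by
      intro t V w _ ht w _ htK
      refine (isSet_prop hK htK).cases (fun w _ h => ?_) fun w _ h => ?_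
      · exact (hne.mp (isPair_inj_left h ht.at)).bot_elim
      · exact h.elimIn fun w _ V' hV' h => (isPair_inj_right h ht.at).subst (fun V => V ∈ᵢ 𝒱) hV'
    have hKσ : w ⊩ allIn 𝒱 fun V => exIn K fun t => isPair t σ V := by
      intro V w _ hV
      refine (hYσ.app' ((h₀.2.1.app hV).1 : w ⊩ _)).elimIn fun w _ t ht htV => ?_
      exact .exIn_intro t (isSet_mem hK ht (.inr (.exIn_intro V hV.at htV))) htV
    have hKG : w ⊩ allIn K fun x => exIn G fun V => x ∈ᵢ V ⋏ sub V K := by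
      refine (hG.2 K).mp (v := w) ⟨isSet_sub hK, fun x w _ hx x' w _ hx' w _ hlam => ?_,
        fun x w _ hx q w _ hq w _ hα => ?_⟩
      · refine hlam.elimIn fun w _ V hV h => h.elimIn fun w _ V' hV' h => ?_
        have hV𝒱 : w ⊩ V ∈ᵢ 𝒱 := ((hσK x V).mp h.1).mpAt hx
        have hV'' : w ⊩ _ := (h₀.2.1.app hV𝒱).2.2.app hV'
        have hle : w ⊩ rel o V' V := (ho.2 V' V).bwd ⟨hV', hV.at, h.2.2⟩
        exact isSet_mem hK hx'.at (.inr (.exIn_intro V' (hV''.mp hle) h.2.1))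
      · refine hα.elimIn fun w _ U' hU' h => ?_
        have hU : w ⊩ U' =ᵢ U := ((hτK x U').mp h.1).mpAt hx
        have hcov : w ⊩ _ := h₀.2.2.app (hU.subst (fun U => q ∈ᵢ U) h.2)
        refine Forces.elimIn (locIn_of_loc hJ hcov) fun w _ j hj hqj => ?_
        have hstep : w ⊩ allIn B.pt fun m => m ∈ᵢ j ⟶ᵢ
            exIn K fun y => exIn 𝒢 fun V => isPair y σ V ⋏ m ∈ᵢ V := by
          intro m w _ _ w _ hm
          refine (hqj.2.app hm).elimIn fun w _ V hV hmV => ?_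
          refine (hKσ.app' hV).elimIn fun w _ t ht htV => ?_
          exact .exIn_intro t ht (.exIn_intro V (h₀.2.1.app hV.at).1 ⟨htV, hmV.at⟩)
        exact .exIn_intro j hj ⟨hqj.1, fun m w _ hm w _ hmj =>
          have h : w ⊩ _ := (hstep.app hm).mp hmj
          ⟨h, h⟩⟩
    refine (hYτ.app' h₀.1).elimIn fun w _ t ht htU => ?_
    have htK : w ⊩ t ∈ᵢ K := isSet_mem hK ht (.inl htU)
    -- A generator containing `⟨τ, U⟩` and below `K` still describes a covering of `U`, and its
    -- `σ`-part is a basic cover contained in `𝒱`.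
    refine (hKG.app' htK).elimIn fun w _ b' hb' htb => ?_
    refine (hH.1.app' hb').elimIn fun w _ R hR hRb => ?_
    have hgood : w ⊩ _ := hG.1.app hb'.at
    have hRσ : w ⊩ allIn R fun V => exIn b' fun t => isPair t σ V := fun V w _ hV =>
      isSet_prop (P := fun V => rel b' σ V) hRb hV
    have hR𝒱 : w ⊩ sub R 𝒱 := fun V w _ hV => (hRσ.app hV).elimIn fun w _ t ht htV =>
      ((hσK t V).mp htV).mp (htb.2.app ht)
    refine ⟨h₀.2.1.at, .ex_intro R ⟨(hb.2 U R).bwd ⟨h₀.1.at, hR, ?_, fun q w _ hq => ?_⟩, hR𝒱⟩⟩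
    · intro V w _ hV
      have hV' : w ⊩ _ := h₀.2.1.app (hR𝒱.app hV)
      refine ⟨hV'.1, hV'.2.1, fun V' w _ hV𝒢 w _ hle => isSet_mem hRb hV𝒢.at ?_⟩
      refine (hRσ.app' hV).elimIn fun w _ t ht htV => ?_
      refine (hYσ.app' hV𝒢).elimIn fun w _ t' ht' htV' => rel_of_isPair htV' ?_
      have h : w ⊩ rel o V' V := hle.at
      refine Forces.mp ((hgood.2.1.app (ht.at : w ⊩ _)).app ht') (.exIn_intro V hV'.1.at ?_)
      exact .exIn_intro V' hV𝒢.at ⟨htV.at, htV', ((ho.2 V' V).fwd h).2.2⟩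
    · have hqB : w ⊩ q ∈ᵢ B.pt := mem_of_loc hB (h₀.2.2.app hq)
      have hα : w ⊩ exIn 𝒢 fun U => isPair t τ U ⋏ q ∈ᵢ U := .exIn_intro U h₀.1.at ⟨htU, hq⟩
      have h' := ((hgood.2.2.app (htb.1.at : w ⊩ _)).app hqB).mp hα
      refine Forces.elimIn (h' : w ⊩ _) fun w _ j hj hqj => .exIn_intro j hj ⟨hqj.1, ?_⟩
      intro x w _ hx
      have hxj : w ⊩ x ∈ᵢ B.pt := ((sieve_of_bcov hB hqj.1).app hx).1
      have h' : w ⊩ _ := ((hqj.2.app hxj).mp hx).1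
      refine Forces.elimIn h' fun w _ t ht h => h.elimIn fun w _ V hV h => ?_
      exact .exIn_intro V (isSet_mem hRb hV (rel_of_isPair h.1 ht.at)) h.2

end

/-! ### The space of opens satisfies the axioms of a formal space -/

section

variable {W : Type} [Preorder W] {D : Type} [SetModel W D]
  {u v w : W} {a b c x y z x' y' p q r s t X Y S R J E F U V : D} {A B C : Space D}
  {opn Φ Ψ : D → Omega W}

theorem opn_sub (hT : u ⊩ isTopology B opn) [Ext w u] (h : w ⊩ opn U) (hx : w ⊩ x ∈ᵢ U) :
    w ⊩ x ∈ᵢ B.pt :=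
  ((hT.2.1 U).mp h).1.app hx

theorem opn_down (hT : u ⊩ isTopology B opn) [Ext w u] (h : w ⊩ opn U) (hx : w ⊩ x ∈ᵢ U)
    (hy : w ⊩ B.le y x) : w ⊩ y ∈ᵢ U :=
  (((hT.2.1 U).mp h).2.app hx y).mp hy

/-- The intersection of two opens is open but need not be a generator, so around a common point it
is replaced by a smaller generator. -/
theorem exists_basic_inter (hT : u ⊩ isTopology B opn) [Ext w u] (hC : w ⊩ generates X opn)
    (hU : w ⊩ opn U) (hV : w ⊩ opn V) (hxU : w ⊩ x ∈ᵢ U) (hxV : w ⊩ x ∈ᵢ V) :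
    w ⊩ exIn X fun I => x ∈ᵢ I ⋏ sub I U ⋏ sub I V := by
  refine (exists_isSet U fun x => x ∈ᵢ V).elim fun w _ I hI => ?_
  have h : w ⊩ opn I := Forces.mp (((hT.2.2 U V I).mp (v := w) hU.at).mpAt hV) hI
  have h' : w ⊩ _ := (hC.2 I).mp h
  refine Forces.elimIn (h'.app (isSet_mem hI hxU.at hxV.at)) fun w _ I' hI' h => ?_
  exact .exIn_intro I' hI' ⟨h.1, fun y w _ hy => (isSet_sub hI).app (h.2.app hy),
    fun y w _ hy => isSet_prop (P := fun x => x ∈ᵢ V) hI (h.2.app hy)⟩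

/-- `C` is a space whose points generate the open sets `opn` of `B`. -/
def isOpenSpace (B C : Space D) (opn : D → Omega W) : Omega W :=
  B.isFormalSpace ⋏ isTopology B opn ⋏ generates C.pt opn ⋏ isSpaceOfOpens B C

theorem isOpenSpace_le (h : u ⊩ isOpenSpace B C opn) [Ext w u] (hU : w ⊩ U ∈ᵢ C.pt)
    (hV : w ⊩ V ∈ᵢ C.pt) (hUV : w ⊩ sub U V) : w ⊩ C.le U V :=
  (h.2.2.2.2.1 U V).bwd ⟨hU, hV, hUV⟩

theorem isOpenSpace_of_le (h : u ⊩ isOpenSpace B C opn) [Ext w u] (hUV : w ⊩ C.le U V) :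
    w ⊩ U ∈ᵢ C.pt ⋏ V ∈ᵢ C.pt ⋏ sub U V :=
  (h.2.2.2.2.1 U V).fwd hUV

theorem isOpenSpace_opn (h : u ⊩ isOpenSpace B C opn) [Ext w u] (hU : w ⊩ U ∈ᵢ C.pt) :
    w ⊩ opn U :=
  h.2.2.1.1.app hU

theorem covering_of_cov (h : u ⊩ isOpenSpace B C opn) [Ext w u] (hc : w ⊩ C.cov S U) :
    w ⊩ U ∈ᵢ C.pt ⋏ C.sieve S U ⋏ covering B S U :=
  (h.2.2.2.2.2.2 S U).fwd hc

theorem cov_of_covering (h : u ⊩ isOpenSpace B C opn) [Ext w u] (hU : w ⊩ U ∈ᵢ C.pt)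
    (hS : w ⊩ C.sieve S U) (hc : w ⊩ covering B S U) : w ⊩ C.cov S U :=
  (h.2.2.2.2.2.2 S U).bwd ⟨hU, hS, hc⟩

/-- A sieve in `C` covers exactly when it covers pointwise in `B`. Maximality, stability and local
character then come from `loc_unit`, from `loc_mono` with intersections of generators, and from
`loc_bind`. -/
theorem isFormalSpace_of_isOpenSpace (h : w ⊩ isOpenSpace B C opn) : w ⊩ C.isFormalSpace := by
  have hB := h.1
  have hT := h.2.1
  refine ⟨⟨h.2.2.2.1, fun U w _ hU => ?_, fun U V X w _ h₁ w _ h₂ => ?_⟩, h.2.2.2.2.2.1, ?_, ?_, ?_⟩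
  · exact isOpenSpace_le h hU hU fun x w _ hx => hx
  · have h₁ : w ⊩ _ := isOpenSpace_of_le h h₁.at
    have h₂ := isOpenSpace_of_le h h₂
    exact isOpenSpace_le h h₁.1 h₂.2.1 fun x w _ hx => h₂.2.2.app (h₁.2.2.app hx)
  · intro U w _ hU S w _ hS
    refine cov_of_covering h hU.at (fun V w _ hV => ?_) fun x w _ hx => ?_
    · have hV := (hS V).fwd hV
      have hV' := isOpenSpace_of_le h hV
      refine ⟨hV'.1, hV, fun V₁ w _ _ w _ hle => (hS V₁).bwd ?_⟩
      have hle := isOpenSpace_of_le h hle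
      exact isOpenSpace_le h hle.1 hU.at fun x w _ hx => hV'.2.2.app (hle.2.2.app hx)
    · have hU' : w ⊩ opn U := isOpenSpace_opn h hU.at
      refine loc_unit hB (opn_sub hT hU' hx) fun w _ y hy hyx => .exIn_intro U ?_ ?_
      · exact (hS U).bwd (isOpenSpace_le h hU.at hU.at fun x w _ hx => hx)
      · exact opn_down hT hU'.at hx.at hyx
  · intro U w _ hU S w _ hS U₁ w _ hU₁ w _ hle S₁ w _ hS₁
    have hS' : w ⊩ _ := covering_of_cov h hS.at
    have hle : w ⊩ _ := isOpenSpace_of_le h hle.at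
    refine cov_of_covering h hU₁.at (fun V w _ hV => ?_) fun x w _ hx => ?_
    · have hV := (hS₁ V).fwd hV
      have hV' := hS'.2.1.app hV.1
      refine ⟨hV'.1, hV.2, fun V₁ w _ hV₁ w _ hle => (hS₁ V₁).bwd ⟨?_, ?_⟩⟩
      · exact (hV'.2.2.app hV₁).mp hle
      · have h₁ := isOpenSpace_of_le h hV.2
        have h₂ := isOpenSpace_of_le h hle
        exact isOpenSpace_le h h₂.1 h₁.2.1.at fun x w _ hx => h₁.2.2.app (h₂.2.2.app hx)
    · refine loc_mono (hS'.2.2.app (hle.2.2.app hx)) fun w _ y hy hyx hyS => ?_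
      have hyU : w ⊩ y ∈ᵢ U₁ := opn_down hT (isOpenSpace_opn h hU₁.at) hx.at hyx
      refine hyS.elimIn fun w _ V hV hyV => ?_
      have hV' := hS'.2.1.app hV
      -- A generator inside `V ∩ U₁` belongs to the sieve because it is below `V`, and to its
      -- restriction because it is below `U₁`.
      refine (exists_basic_inter (opn := opn) hT h.2.2.1.at (isOpenSpace_opn h hV'.1)
        (isOpenSpace_opn h hU₁.at) hyV hyU.at).elimIn fun w _ I hI hyI => .exIn_intro I ?_ hyI.1
      refine (hS₁ I).bwd ⟨(hV'.2.2.app hI).mp ?_, ?_⟩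
      · exact isOpenSpace_le h hI hV'.1.at hyI.2.1
      · exact isOpenSpace_le h hI hU₁.at hyI.2.2
  · intro U w _ hU S w _ hS R w _ hR w _ hSR
    have hS' : w ⊩ _ := covering_of_cov h hS.at
    refine cov_of_covering h hU.at hR.at fun x w _ hx => ?_
    refine loc_bind hB (hS'.2.2.app hx) (fun w _ y hy hyx hyS => ?_) fun w _ y z hzy _ hyR => ?_
    · refine hyS.elimIn fun w _ V hV hyV => ?_
      refine (exists_isSet R fun X => C.le X V).elim fun w _ R₁ hR₁ => ?_
      have hcov := ((hSR.app (hV.at : w ⊩ _)) R₁).mp (v := w) fun X => ⟨fun w _ hX =>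
        ⟨(isSet_sub hR₁).app hX, isSet_prop (P := fun X => C.le X V) hR₁ hX⟩,
        fun w _ hX => isSet_mem hR₁ hX.1 hX.2⟩
      refine loc_mono ((covering_of_cov h hcov).2.2.appAt hyV) fun w _ z _ _ hz => ?_
      exact hz.elimIn fun w _ X hX hz => .exIn_intro X ((isSet_sub hR₁).app hX) hz
    · refine hyR.elimIn fun w _ V hV hyV => .exIn_intro V hV ?_
      exact opn_down hT (isOpenSpace_opn h (hR.app hV).1) hyV hzy.at

end

/-! ### The quotient map, factorizations and their uniqueness -/

section

variable {W : Type} [Preorder W] {D : Type} [SetModel W D]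
  {u v w : W} {a b c x y z x' y' p q r s t X Y S R J E F G U V L K : D} {A B C T : Space D}
  {opn Φ Ψ : D → Omega W}

/-- `E` is the morphism from `B` to the space `C` of open sets of `B`. -/
def isQuotientMap (B C : Space D) (E : D) : Omega W :=
  subProd E B.pt C.pt ⋏
  all fun q : D => all fun U : D => rel E q U ⟷ᵢ (U ∈ᵢ C.pt ⋏ B.loc q fun q' => q' ∈ᵢ U)

theorem exists_isQuotientMap (hB : w ⊩ B.isFormalSpace) :
    w ⊩ ex fun E : D => isQuotientMap B C E := by
  refine (B.exists_boundedBy).elim fun w _ J hJ => ?_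
  refine (exists_rel B.pt C.pt fun q U => B.locIn J q fun q' => q' ∈ᵢ U).elim fun w _ E hE => ?_
  refine .ex_intro E ⟨hE.1, fun q U => ⟨fun w _ h => ?_, fun w _ h => ?_⟩⟩
  · have h : w ⊩ _ := (hE.2 q U).fwd h
    exact ⟨h.2.1, loc_of_locIn hB h.2.2⟩
  · exact (hE.2 q U).bwd ⟨mem_of_loc hB h.2, h.1, locIn_of_loc hJ h.2⟩

theorem quotientMap_of_mem (h : u ⊩ isOpenSpace B C opn) [Ext w u] (hE : w ⊩ isQuotientMap B C E)
    (hU : w ⊩ U ∈ᵢ C.pt) (hq : w ⊩ q ∈ᵢ U) : w ⊩ rel E q U :=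
  have hU' := isOpenSpace_opn h hU
  (hE.2 q U).bwd ⟨hU, loc_unit h.1 (opn_sub h.2.1 hU' hq) fun _ _ _ _ hx =>
    opn_down h.2.1 hU'.at hq.at hx⟩

/-- Opens are only required to be downsets, not closed under covers of `B`. Taking local membership
in `E` gives the second morphism condition; the last two then transfer from actual membership by
`loc_bind`. -/
theorem isMor_quotientMap (h : w ⊩ isOpenSpace B C opn) (hE : w ⊩ isQuotientMap B C E) :
    w ⊩ isMor B C E := by
  have hB := h.1
  have hT := h.2.1
  have hmono : ∀ v, Ext v w → ∀ q U q' U', (v ⊩ rel E q U) → (v ⊩ B.le q' q) → (v ⊩ C.le U U') →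
      v ⊩ rel E q' U' := by
    intro w _ q U q' U' hq hle hU
    have hq' : w ⊩ _ := (hE.2 q U).fwd hq
    have hU := isOpenSpace_of_le h hU
    refine (hE.2 q' U').bwd ⟨hU.2.1, ?_⟩
    exact loc_mono (loc_stable hB hq'.2 hle) fun w _ x _ _ hx => hU.2.2.app hx
  have hrefl : ∀ v, Ext v w → ∀ U, (v ⊩ U ∈ᵢ C.pt) → v ⊩ C.le U U := fun w _ U hU =>
    isOpenSpace_le h hU hU fun x w _ hx => hx
  refine ⟨hE.1, fun q U q' U' w _ hq w _ hle w _ hU => ?_, fun U w _ hU q w _ hq S w _ hS w _ hSE => ?_,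
    fun q w _ hq => ?_, fun U w _ hU V w _ hV q w _ hq w _ hqU w _ hqV => ?_,
    fun q w _ hq U w _ hU w _ hqU S w _ hS => ?_⟩
  · exact hmono w inferInstance q U q' U' hq.at hle.at hU
  · refine (hE.2 q U).bwd ⟨hU.at, ?_⟩
    have : w ⊩ B.loc q fun q' => rel E q' U := .ex_intro S ⟨hS.at, hSE⟩
    refine loc_bind hB this (fun w _ x _ _ hx => ((hE.2 x U).fwd hx).2) fun w _ x y hy _ hx => ?_
    exact opn_down hT (isOpenSpace_opn h hU.at) hx hy
  · refine loc_unit hB hq fun w _ x hx hxq => ?_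
    have hx' : w ⊩ _ := ((h.2.2.1.2 B.pt).mp (v := w) hT.1.at).app hx
    exact Forces.elimIn hx' fun w _ U hU hxU =>
      .exIn_intro U hU (quotientMap_of_mem h hE.at hU hxU.1)
  · have hqU : w ⊩ _ := (hE.2 q U).fwd hqU.at
    have hqV : w ⊩ _ := (hE.2 q V).fwd hqV
    refine loc_bind hB hqU.2 (fun w _ x hx hxq hxU => ?_) fun w _ x y hyx _ hx => ?_
    · refine loc_mono (loc_stable hB hqV.2.at hxq) fun w _ y hy hyx hyV => ?_
      have hU' : w ⊩ opn U := isOpenSpace_opn h hU.at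
      have hV' : w ⊩ opn V := isOpenSpace_opn h hV.at
      refine (exists_basic_inter (opn := opn) hT h.2.2.1.at hU' hV' (opn_down hT hU' hxU.at hyx)
        hyV).elimIn fun w _ I hI hyI => .exIn_intro I hI ⟨?_, ?_, ?_⟩
      · exact isOpenSpace_le h hI hU.at hyI.2.1
      · exact isOpenSpace_le h hI hV.at hyI.2.2
      · exact quotientMap_of_mem h hE.at hI hyI.1
    · refine hx.elimIn fun w _ I hI hxI => .exIn_intro I hI ⟨hxI.1, hxI.2.1, ?_⟩
      exact hmono w inferInstance x I y I hxI.2.2 hyx.at (hrefl w inferInstance I hI)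
  · have hqU : w ⊩ _ := (hE.2 q U).fwd hqU.at
    have hS := covering_of_cov h hS
    refine loc_bind hB hqU.2 (fun w _ x hx _ hxU => ?_) fun w _ x y hyx _ hx => ?_
    · refine loc_mono (hS.2.2.app hxU) fun w _ y _ _ hy => ?_
      exact hy.elimIn fun w _ V hV hyV =>
        .exIn_intro V hV (quotientMap_of_mem h hE.at (hS.2.1.app hV).1 hyV)
    · refine hx.elimIn fun w _ I hI hxI => .exIn_intro I hI ?_
      exact hmono w inferInstance x I y I hxI hyx.at (hrefl w inferInstance I (hS.2.1.app hI).1)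

/-! ## The universal property -/

/-- For `K : B → T`, the inverse images of the basic open sets are open. -/
def isCompatible (B T : Space D) (opn : D → Omega W) (K : D) : Omega W :=
  allIn T.pt fun r => all fun U : D => isSet U B.pt (fun q => rel K q r) ⟶ᵢ opn U

theorem exists_preimage (hc : w ⊩ isCompatible B T opn K) (hK : w ⊩ isMor B T K) (hq : w ⊩ rel K q r) :
    w ⊩ ex fun I : D => opn I ⋏ isSet I B.pt fun q => rel K q r := by
  have hr := snd_mem_of_mor hK hq
  exact (exists_isSet B.pt fun q => rel K q r).elim fun w _ I hI =>
    .ex_intro I ⟨((hc.app hr) I).mp hI, hI⟩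

/-- `L` is the factorization of `K` through the space `C` of open sets of `B`. -/
def isFactor (C T : Space D) (K L : D) : Omega W :=
  subProd L C.pt T.pt ⋏ all fun U : D => all fun r : D =>
    rel L U r ⟷ᵢ (U ∈ᵢ C.pt ⋏ r ∈ᵢ T.pt ⋏ allIn U fun q => rel K q r)

/-- One direction only uses that `K` is determined locally. In the other, compatibility makes the
inverse image of `r` open, hence a union of generators `U`, and each of these satisfies `L(U, r)`.
-/
theorem factors_of_isFactor (h : w ⊩ isOpenSpace B C opn) (hE : w ⊩ isQuotientMap B C E)
    (hc : w ⊩ isCompatible B T opn K) (hK : w ⊩ isMor B T K) (hL : w ⊩ isFactor C T K L) :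
    w ⊩ factors B C T E L K := by
  have hB := h.1
  refine fun q w _ hq r w _ hr => ⟨fun w _ hqr => ?_, fun w _ hqr => ?_⟩
  · refine mor_of_loc hK hB.at hr.at (loc_mono hqr fun w _ x _ _ hx => ?_)
    refine hx.elimIn fun w _ U hU hxU => ?_
    have h₁ : w ⊩ _ := (hE.2 x U).fwd hxU.1
    have h₂ : w ⊩ _ := (hL.2 U r).fwd hxU.2
    exact mor_of_loc hK hB.at hr.at (loc_mono h₁.2 fun w _ y _ _ hy => h₂.2.2.app hy)
  · refine (exists_preimage hc.at hK.at hqr).elim fun w _ I hI => ?_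
    refine loc_unit hB hq.at fun w _ x hx hxq => ?_
    have hxI : w ⊩ x ∈ᵢ I := opn_down h.2.1 hI.1.at (isSet_mem hI.2 hq.at hqr.at) hxq
    refine Forces.elimIn (((h.2.2.1.2 I).mp hI.1).app hxI) fun w _ U hU hxU => ?_
    refine .exIn_intro U hU ⟨quotientMap_of_mem h hE.at hU hxU.1, ?_⟩
    exact (hL.2 U r).bwd ⟨hU, hr.at, fun y w _ hy =>
      isSet_prop (P := fun q => rel K q r) hI.2 (hxU.2.app hy)⟩

/-- To show that `L` is locally defined, it suffices that `K` is. -/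
theorem loc_isFactor (h : u ⊩ isOpenSpace B C opn) [Ext w u]
    (hc : w ⊩ isCompatible B T opn K) (hK : w ⊩ isMor B T K) (hL : w ⊩ isFactor C T K L)
    (hU : w ⊩ U ∈ᵢ C.pt) (hk : w ⊩ allIn U fun q => B.loc q fun q' => exIn Y fun r => rel K q' r) :
    w ⊩ C.loc U fun V => exIn Y fun r => rel L V r := by
  refine (exists_isSet C.pt fun V => C.le V U ⋏ exIn Y fun r => rel L V r).elim
    fun w _ S hS => .ex_intro S ⟨cov_of_covering h hU.at (fun V w _ hV => ?_) fun x w _ hx => ?_,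
      fun V w _ hV => ?_⟩
  · have hV' := isSet_prop hS hV
    refine ⟨(isSet_sub hS).app hV, hV'.1, fun V₁ w _ hV₁ w _ hle => isSet_mem hS hV₁.at ?_⟩
    have h₁ : w ⊩ _ := isOpenSpace_of_le h hV'.1.at
    have h₂ := isOpenSpace_of_le h hle
    refine ⟨isOpenSpace_le h h₂.1 h₁.2.1 fun x w _ hx => h₁.2.2.app (h₂.2.2.app hx), ?_⟩
    refine Forces.elimIn hV'.2.at fun w _ r hr hVr => .exIn_intro r hr ?_
    have h₃ : w ⊩ _ := (hL.2 V r).fwd hVr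
    exact (hL.2 V₁ r).bwd ⟨hV₁.at, h₃.2.1, fun x w _ hx => h₃.2.2.app (h₂.2.2.app hx)⟩
  · have hU' : w ⊩ opn U := isOpenSpace_opn h hU.at
    refine loc_mono (hk.app hx) fun w _ y hy hyx h' => h'.elimIn fun w _ r hr hyr => ?_
    -- The required cover of `U` consists of generators inside the intersections of `U` with inverse
    -- images of elements `r` of `Y`.
    refine (exists_preimage hc.at hK.at hyr).elim fun w _ I hI => ?_
    have hyI : w ⊩ y ∈ᵢ I := isSet_mem hI.2 hy.at hyr.at
    have hyU : w ⊩ y ∈ᵢ U := opn_down h.2.1 hU'.at hx.at hyx.at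
    refine (exists_basic_inter (opn := opn) h.2.1 h.2.2.1.at hU'.at hI.1 hyU hyI).elimIn
      fun w _ V hV hyV => .exIn_intro V (isSet_mem hS hV ⟨?_, .exIn_intro r hr.at ?_⟩) hyV.1
    · exact isOpenSpace_le h hV hU.at hyV.2.1
    · exact (hL.2 V r).bwd ⟨hV, snd_mem_of_mor hK hyr.at, fun z w _ hz =>
        isSet_prop (P := fun q => rel K q r) hI.2 (hyV.2.2.app hz)⟩
  · exact (isSet_prop hS hV).2

/-- The three conditions that ask for a cover are instances of `loc_isFactor`, with `Y` all of `T`,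
the common lower bounds of `r` and `r'`, and a given cover of `r`; each is inherited from the same
condition on `K`. -/
theorem isMor_of_isFactor (h : w ⊩ isOpenSpace B C opn) (hT : w ⊩ T.isFormalSpace)
    (hc : w ⊩ isCompatible B T opn K) (hK : w ⊩ isMor B T K) (hL : w ⊩ isFactor C T K L) :
    w ⊩ isMor C T L := by
  have hB := h.1
  refine ⟨hL.1, fun U r U' r' w _ hUr w _ hle w _ hr => ?_, fun r w _ hr U w _ hU S w _ hS w _ hSL => ?_,
    fun U w _ hU => ?_, fun r w _ hr r' w _ hr' U w _ hU w _ hUr w _ hUr' => ?_,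
    fun U w _ hU r w _ hr w _ hUr S w _ hS => ?_⟩
  · have h₁ : w ⊩ _ := (hL.2 U r).fwd hUr.at
    have h₂ : w ⊩ _ := isOpenSpace_of_le h hle.at
    refine (hL.2 U' r').bwd ⟨h₂.1, mem_right hT hr, fun x w _ hx => ?_⟩
    have hxr := h₁.2.2.app (h₂.2.2.app hx)
    exact mor_mono hK hxr (le_refl hB (fst_mem_of_mor hK hxr)) hr.at
  · have hS : w ⊩ _ := covering_of_cov h hS.at
    refine (hL.2 U r).bwd ⟨hU.at, hr.at, fun x w _ hx => ?_⟩
    refine mor_of_loc hK hB.at hr.at (loc_mono (hS.2.2.app hx) fun w _ y _ _ hy => ?_)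
    refine hy.elimIn fun w _ V hV hyV => ?_
    have h₁ : w ⊩ _ := (hL.2 V r).fwd (hSL.app hV)
    exact h₁.2.2.app hyV
  · exact loc_isFactor h hc.at hK.at hL.at hU fun x w _ hx =>
      mor_total hK (opn_sub h.2.1 (isOpenSpace_opn h hU.at) hx)
  · have h₁ : w ⊩ _ := (hL.2 U r).fwd hUr.at
    have h₂ : w ⊩ _ := (hL.2 U r').fwd hUr'
    refine (exists_isSet T.pt fun s => T.le s r ⋏ T.le s r').elim fun w _ Y hY => ?_
    refine loc_mono (loc_isFactor (Y := Y) h hc.at hK.at hL.at hU.at fun x w _ hx => ?_)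
      fun w _ V _ _ hV => ?_
    · refine loc_mono (mor_inter hK (h₁.2.2.app hx) (h₂.2.2.app hx)) fun w _ y _ _ hy => ?_
      exact hy.elimIn fun w _ s hs hys =>
        .exIn_intro s (isSet_mem hY hs ⟨hys.1, hys.2.1⟩) hys.2.2
    · refine hV.elimIn fun w _ s hs hVs => .exIn_intro s ((isSet_sub hY).app hs) ?_
      have hs' := isSet_prop hY hs
      exact ⟨hs'.1, hs'.2, hVs⟩
  · have h₁ : w ⊩ _ := (hL.2 U r).fwd hUr.at
    exact loc_isFactor h hc.at hK.at hL.at hU.at fun x w _ hx => mor_cov hK (h₁.2.2.app hx) hS.at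

/-- If `F(U, r)`, every `q ∈ U` satisfies `E(q, U)`, so the factorization puts `q` in the inverse
image of `r`. Conversely, if `U` lies in that inverse image, the factorization covers `U` by
generators `V` with `F(V, r)`, which can be shrunk into `U`; then `F(U, r)` because morphisms are
local. -/
theorem eq_of_factors (h : w ⊩ isOpenSpace B C opn) (hE : w ⊩ isQuotientMap B C E)
    (hT : w ⊩ T.isFormalSpace) (hL : w ⊩ isFactor C T K L) (hF : w ⊩ isMor C T F)
    (hFK : w ⊩ factors B C T E F K) : w ⊩ F =ᵢ L := by
  have hB := h.1
  refine eq_of_rel_iff hF.1 hL.1 (fun w _ U r hUr => ?_) fun w _ U r hUr => ?_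
  · have hU := fst_mem_of_mor hF hUr
    refine (hL.2 U r).bwd ⟨hU, snd_mem_of_mor hF hUr, fun x w _ hx => ?_⟩
    have hU' : w ⊩ opn U := isOpenSpace_opn h hU.at
    have hxB := opn_sub h.2.1 hU' hx
    have h' : w ⊩ _ := (hFK.app hxB).app (snd_mem_of_mor hF hUr.at : w ⊩ _)
    refine h'.fwd (v := w) (loc_unit hB hxB fun w _ y hy hyx => .exIn_intro U hU.at ⟨?_, hUr.at⟩)
    exact quotientMap_of_mem h hE.at hU.at (opn_down h.2.1 hU'.at hx.at hyx)
  · have h₁ : w ⊩ _ := (hL.2 U r).fwd hUr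
    have hU' : w ⊩ opn U := isOpenSpace_opn h h₁.1
    have hC := isFormalSpace_of_isOpenSpace h
    refine mor_of_loc hF hC.at h₁.2.1 ?_
    refine (exists_isSet C.pt fun V => C.le V U ⋏ rel F V r).elim
      fun w _ S hS => .ex_intro S ⟨cov_of_covering h h₁.1.at (fun V w _ hV => ?_) fun x w _ hx => ?_,
        fun V w _ hV => ?_⟩
    · have hV' := isSet_prop hS hV
      refine ⟨(isSet_sub hS).app hV, hV'.1, fun V₁ w _ hV₁ w _ hle => isSet_mem hS hV₁.at ?_⟩
      exact ⟨le_trans hC hle hV'.1.at, mor_mono hF hV'.2.at hle (le_refl hT h₁.2.1.at)⟩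
    · have hxB := opn_sub h.2.1 hU'.at hx
      have h' : w ⊩ _ := ((hFK.app hxB).appAt h₁.2.1).bwd (h₁.2.2.app hx)
      refine loc_bind hB (h' : w ⊩ B.loc x _) (fun w _ y hy hyx hyV => ?_) fun w _ y z hzy _ hy => ?_
      · refine hyV.elimIn fun w _ V hV hyV => ?_
        have h₂ : w ⊩ _ := (hE.2 y V).fwd hyV.1
        refine loc_mono h₂.2 fun w _ z _ hzy hz => ?_
        have hzU : w ⊩ z ∈ᵢ U := opn_down h.2.1 hU'.at (opn_down h.2.1 hU'.at hx.at hyx.at) hzy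
        refine (exists_basic_inter (opn := opn) h.2.1 h.2.2.1.at hU'.at
          (isOpenSpace_opn h hV.at) hzU hz).elimIn fun w _ I hI hzI => .exIn_intro I ?_ hzI.1
        refine isSet_mem hS hI ⟨isOpenSpace_le h hI h₁.1.at hzI.2.1, ?_⟩
        exact mor_mono hF hyV.2.at (isOpenSpace_le h hI hV.at hzI.2.2) (le_refl hT h₁.2.1.at)
      · refine hy.elimIn fun w _ V hV hyV => .exIn_intro V hV ?_
        exact opn_down h.2.1 (isOpenSpace_opn h ((isSet_sub hS).app hV)) hyV hzy.at
    · exact (isSet_prop hS hV).2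

end

/-! ## Coequalizers -/

section

variable {W : Type} [Preorder W] {D : Type} [SetModel W D]
  {u v w : W} {a b c x y z x' y' p q r s t X Y S R I J E F G U V L K : D} {A B C T : Space D}

def isDownset (B : Space D) (U : D) : Omega W :=
  sub U B.pt ⋏ allIn U fun x => all fun y : D => B.le y x ⟶ᵢ y ∈ᵢ U

/-- On `U`, what `F` says of a point is locally matched by `G`. -/
def isMatched (A : Space D) (F G U : D) : Omega W :=
  allIn U fun q => all fun p : D => rel F p q ⟶ᵢ A.loc p fun p' => exIn U fun y => rel G p' y

/-- `U` is an open set of the coequalizer of `F` and `G`. -/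
def isCoequalizerOpen (A B : Space D) (F G U : D) : Omega W :=
  isDownset B U ⋏ isMatched A F G U ⋏ isMatched A G F U

/-- Both matching conditions are merged into one symmetric rule: if `p` is related to `q ∈ U` by `F`
or by `G`, some basic cover of `p` has all its members related to `U` by both. The unary rules
express that `U` is a downset. -/
theorem exists_generates_coequalizer (hNID : w ⊩ Sem.elementaryNID D) (hA : w ⊩ A.isFormalSpace)
    (hB : w ⊩ B.isFormalSpace) (hF : w ⊩ isMor A B F) (hG : w ⊩ isMor A B G) :
    w ⊩ ex fun 𝒢 : D => generates 𝒢 (isCoequalizerOpen A B F G) := by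
  refine (A.exists_boundedBy).elim fun w _ J hJ => ?_
  refine (exists_generates hNID.at B.pt J A.pt (fun p q => rel F p q ⋎ rel G p q)
    (fun p S => rel A.bcov p S) (fun p S => p ∈ᵢ S) (fun p y => rel F p y) (fun p y => rel G p y)
    (fun x y => B.le y x)).elim fun w _ 𝒢 h𝒢 => .ex_intro 𝒢 ⟨fun U w _ hU => ?_, fun U => ?_⟩
  · have hU : w ⊩ _ := h𝒢.1.app hU
    refine ⟨⟨hU.1, fun x w _ hx y w _ hy => ?_⟩, fun q w _ hq p w _ hpq => ?_,
      fun q w _ hq p w _ hpq => ?_⟩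
    · exact ((hU.2.1.app (hx.at : w ⊩ _)).app (mem_left hB hy)).mp hy
    · refine Forces.elimIn (((hU.2.2.app (hq.at : w ⊩ _)).app (fst_mem_of_mor hF hpq)).mp
        (.inl hpq)) fun w _ j hj hpj => ?_
      refine .ex_intro j ⟨⟨sieve_of_bcov hA hpj.1, .ex_intro j ⟨hpj.1, fun x w _ hx => hx⟩⟩, ?_⟩
      intro x w _ hx
      exact ((hpj.2.app ((sieve_of_bcov hA hpj.1).app hx).1).mp hx).2
    · refine Forces.elimIn (((hU.2.2.app (hq.at : w ⊩ _)).app (fst_mem_of_mor hG hpq)).mp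
        (.inr hpq)) fun w _ j hj hpj => ?_
      refine .ex_intro j ⟨⟨sieve_of_bcov hA hpj.1, .ex_intro j ⟨hpj.1, fun x w _ hx => hx⟩⟩, ?_⟩
      intro x w _ hx
      exact ((hpj.2.app ((sieve_of_bcov hA hpj.1).app hx).1).mp hx).1
  · intro w _ hU
    refine (h𝒢.2 U).mp (v := w) ⟨hU.1.1, fun x w _ hx y w _ _ w _ hyx => ?_,
      fun q w _ hq p w _ hp w _ hpq => ?_⟩
    · exact ((hU.1.2.app (hx.at : w ⊩ _)) y).mp hyx
    · have hqB : w ⊩ q ∈ᵢ B.pt := hU.1.1.app hq.at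
      have h : w ⊩ A.loc p fun p' => (exIn U fun y => rel F p' y) ⋏ exIn U fun y => rel G p' y := by
        refine hpq.cases (fun w _ h => ?_) fun w _ h => ?_
        -- Matching supplies the `G`-partner, while `q` itself remains an `F`-partner for every `x ≤
        -- p`.
        · refine loc_mono (((hU.2.1.app (hq.at : w ⊩ _)) p).mp h) fun w _ x hx hxp hxG => ⟨?_, hxG⟩
          exact .exIn_intro q hq.at (mor_mono hF h.at hxp (le_refl hB hqB.at))
        · refine loc_mono (((hU.2.2.app (hq.at : w ⊩ _)) p).mp h) fun w _ x hx hxp hxG => ⟨hxG, ?_⟩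
          exact .exIn_intro q hq.at (mor_mono hG h.at hxp (le_refl hB hqB.at))
      refine (locIn_of_loc hJ h).elimIn fun w _ j hj hpj => .exIn_intro j hj ⟨hpj.1, ?_⟩
      exact fun x w _ _ w _ hx => hpj.2.app hx

theorem isMatched_pt (hF : u ⊩ isMor A B F) (hG : u ⊩ isMor A B G) [Ext w u] :
    w ⊩ isMatched A F G B.pt :=
  fun _ _ _ _ _ _ _ hpq => mor_total hG (fst_mem_of_mor hF hpq)

/-- Matching in `U` and in `V` gives, on a common cover, two `G`-partners `r' ∈ U` and `r ∈ V`. As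
`G` is a morphism, locally it has a partner below both, which lies in `U ∩ V` since these are
downsets. -/
theorem isMatched_inter (hA : w ⊩ A.isFormalSpace) (hB : w ⊩ B.isFormalSpace)
    (hF : w ⊩ isMor A B F) (hG : w ⊩ isMor A B G) (hU : w ⊩ isDownset B U)
    (hV : w ⊩ isDownset B V) (hUm : w ⊩ isMatched A F G U)
    (hVm : w ⊩ isMatched A F G V) (hI : w ⊩ isSet I U fun x => x ∈ᵢ V) :
    w ⊩ isMatched A F G I := by
  have hdown : ∀ v, Ext v w → ∀ x y, (v ⊩ A.le y x) → (v ⊩ exIn I fun q => rel G x q) →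
      v ⊩ exIn I fun q => rel G y q := fun w _ x y hyx hx => hx.elimIn fun w _ q hq hxq =>
    .exIn_intro q hq (mor_mono hG hxq hyx.at (le_refl hB (snd_mem_of_mor hG hxq)))
  intro q w _ hq p w _ hpq
  have hqB : w ⊩ q ∈ᵢ B.pt := snd_mem_of_mor hF hpq
  have hqV : w ⊩ q ∈ᵢ V := isSet_prop (P := fun x => x ∈ᵢ V) hI hq.at
  refine loc_bind hA ((hUm.app ((isSet_sub hI).app (hq.at : w ⊩ _)) p).mp hpq)
    (fun w _ x hx hxp hxU => ?_) fun w _ x y hyx _ hx => hdown w inferInstance x y hyx hx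
  have hxq : w ⊩ rel F x q := mor_mono hF hpq.at hxp (le_refl hB hqB.at)
  refine loc_bind hA ((hVm.app (hqV.at : w ⊩ _) x).mp hxq) (fun w _ y hy hyx hyV => ?_)
    fun w _ x y hyx _ hx => hdown w inferInstance x y hyx hx
  refine hyV.elimIn fun w _ r hr hyr => Forces.elimIn hxU.at fun w _ r' hr' hxr' => ?_
  have hyr' : w ⊩ rel G y r' :=
    mor_mono hG hxr' hyx.at (le_refl hB (snd_mem_of_mor hG hxr'))
  refine loc_mono (mor_inter hG hyr.at hyr') fun w _ z _ _ hz => hz.elimIn fun w _ s _ hzs => ?_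
  exact .exIn_intro s (isSet_mem hI ((hU.2.app (hr'.at : w ⊩ _) s).mp hzs.2.1)
    ((hV.2.app (hr.at : w ⊩ _) s).mp hzs.1)) hzs.2.2

theorem isTopology_coequalizer (hA : w ⊩ A.isFormalSpace)
    (hB : w ⊩ B.isFormalSpace) (hF : w ⊩ isMor A B F) (hG : w ⊩ isMor A B G) :
    w ⊩ isTopology B (isCoequalizerOpen A B F G) := by
  refine ⟨⟨⟨fun x w _ hx => hx, fun x w _ _ y w _ h => mem_left hB h⟩, isMatched_pt hF hG,
    isMatched_pt hG hF⟩, fun U w _ hU => hU.1, fun U V I w _ hU w _ hV w _ hI => ⟨⟨?_, ?_⟩, ?_, ?_⟩⟩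
  · exact fun x w _ hx => hU.1.1.app ((isSet_sub hI).app hx)
  · intro x w _ hx y w _ hyx
    have hxV : w ⊩ x ∈ᵢ V := isSet_prop (P := fun x => x ∈ᵢ V) hI hx.at
    have hxU : w ⊩ x ∈ᵢ U := (isSet_sub hI).app hx.at
    exact isSet_mem hI ((hU.1.2.app hxU y).mp hyx) ((hV.1.2.app hxV y).mp hyx)
  · exact isMatched_inter hA.at hB.at hF.at hG.at hU.at.1 hV.at.1 hU.at.2.1 hV.at.2.1 hI
  · exact isMatched_inter hA.at hB.at hG.at hF.at hU.at.1 hV.at.1 hU.at.2.2 hV.at.2.2 hI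

/-- If `F(p, q)` and `q` is locally in `U`, continuity of `F` replaces `q` by actual members of `U`
on a cover of `p`; matching then turns these into `G`-partners in `U`. -/
theorem compRel_of_isMatched (hA : w ⊩ A.isFormalSpace) (hB : w ⊩ B.isFormalSpace)
    (hF : w ⊩ isMor A B F) (hG : w ⊩ isMor A B G) (hE : w ⊩ isQuotientMap B C E)
    (hU : w ⊩ isDownset B U) (hUm : w ⊩ isMatched A F G U)
    (hC : ∀ v, Ext v w → ∀ q, (v ⊩ q ∈ᵢ U) → v ⊩ rel E q U)
    (h : w ⊩ compRel A B F E p U) : w ⊩ compRel A B G E p U := by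
  have hdown : ∀ v, Ext v w → ∀ x y, (v ⊩ A.le y x) →
      (v ⊩ exIn B.pt fun q => rel G x q ⋏ rel E q U) →
      v ⊩ exIn B.pt fun q => rel G y q ⋏ rel E q U := fun w _ x y hyx hx =>
    hx.elimIn fun w _ q hq hxq =>
      .exIn_intro q hq ⟨mor_mono hG hxq.1 hyx.at (le_refl hB hq), hxq.2⟩
  refine loc_bind hA (h : w ⊩ A.loc p _) (fun w _ x _ _ hx => ?_)
    fun w _ x y hyx _ hx => hdown w inferInstance x y hyx hx
  refine hx.elimIn fun w _ q hq hxq => ?_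
  have hqU : w ⊩ _ := (hE.2 q U).fwd hxq.2
  refine hqU.2.elim fun w _ S hS => ?_
  refine loc_bind hA (mor_cov hF hxq.1.at hS.1) (fun w _ y _ _ hy => ?_)
    fun w _ x y hyx _ hx => hdown w inferInstance x y hyx hx
  refine hy.elimIn fun w _ q' hq' hyq' => ?_
  refine loc_mono ((hUm.app (hS.2.app hq') y).mp hyq') fun w _ z _ _ hz => ?_
  exact hz.elimIn fun w _ r hr hzr => .exIn_intro r (hU.1.app hr) ⟨hzr, hC w inferInstance r hr⟩

/-- For `q ∈ U`, `F(p, q)` makes `p` related to `r` by `K ∘ F`, hence by `K ∘ G`; unfolding the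
latter gives exactly the local `G`-partners in `U`. -/
theorem isMatched_preimage (hA : w ⊩ A.isFormalSpace) (hB : w ⊩ B.isFormalSpace)
    (hF : w ⊩ isMor A B F) (hU : w ⊩ isSet U B.pt fun q => rel K q r)
    (hK : w ⊩ all fun p : D => compRel A B F K p r ⟶ᵢ compRel A B G K p r) :
    w ⊩ isMatched A F G U := by
  intro q w _ hq p w _ hpq
  have hqB : w ⊩ q ∈ᵢ B.pt := (isSet_sub hU).app hq.at
  have h : w ⊩ compRel A B F K p r := loc_unit hA (fst_mem_of_mor hF hpq) fun w _ x _ hxp =>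
    .exIn_intro q hqB.at ⟨mor_mono hF hpq.at hxp (le_refl hB hqB.at),
      isSet_prop (P := fun q => rel K q r) hU hq.at⟩
  have h' : w ⊩ A.loc p _ := (hK p).mp h
  exact loc_mono h' fun w _ x _ _ hx => hx.elimIn fun w _ y hy hxy =>
    .exIn_intro y (isSet_mem hU hy hxy.2) hxy.1

theorem isCompatible_coequalizer (hA : w ⊩ A.isFormalSpace) (hB : w ⊩ B.isFormalSpace)
    (hT : w ⊩ T.isFormalSpace) (hF : w ⊩ isMor A B F) (hG : w ⊩ isMor A B G)
    (hK : w ⊩ isMor B T K) (hc : w ⊩ coequalizes A B T F G K) :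
    w ⊩ isCompatible B T (isCoequalizerOpen A B F G) K := by
  intro r w _ hr U w _ hU
  refine ⟨⟨isSet_sub hU, fun x w _ hx y w _ hyx => isSet_mem hU (mem_left hB hyx) ?_⟩, ?_, ?_⟩
  · have hxr : w ⊩ rel K x r := isSet_prop (P := fun q => rel K q r) hU hx.at
    exact mor_mono hK hxr hyx (le_refl hT hr.at)
  · refine isMatched_preimage hA.at hB.at hF.at hU fun p w _ h => ?_
    exact ((hc.app (mem_of_loc (Φ := _) hA (h : w ⊩ A.loc p _))).appAt hr).fwd h
  · refine isMatched_preimage hA.at hB.at hG.at hU fun p w _ h => ?_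
    exact ((hc.app (mem_of_loc (Φ := _) hA (h : w ⊩ A.loc p _))).appAt hr).bwd h

theorem hasCoequalizers_of_elementaryNID (hNID : w ⊩ Sem.elementaryNID D) :
    w ⊩ Sem.hasCoequalizers D := by
  intro P₁ L₁ B₁ w _ hA P₂ L₂ B₂ w _ hB F w _ hF G w _ hG
  set A : Space D := ⟨P₁, L₁, B₁⟩
  set B : Space D := ⟨P₂, L₂, B₂⟩
  refine (exists_generates_coequalizer hNID.at hA.at hB.at hF.at hG).elim fun w _ 𝒢 h𝒢 => ?_
  refine (exists_space hNID.at hB.at 𝒢).elim fun w _ o ho => ho.elim fun w _ b hC => ?_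
  have h : w ⊩ isOpenSpace B ⟨𝒢, o, b⟩ (isCoequalizerOpen A B F G) :=
    ⟨hB.at, isTopology_coequalizer hA.at hB.at hF.at hG.at, h𝒢.at, hC⟩
  refine .ex_intro 𝒢 (.ex_intro o (.ex_intro b ⟨isFormalSpace_of_isOpenSpace h, ?_⟩))
  refine (exists_isQuotientMap (C := ⟨𝒢, o, b⟩) hB.at).elim fun w _ E hE => .ex_intro E ?_
  have hEm := isMor_quotientMap h.at hE
  refine ⟨hEm, fun p w _ hp U w _ hU => ?_, fun P₃ L₃ B₃ w _ hT K w _ hK w _ hc => ?_⟩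
  · have hU' : w ⊩ _ := isOpenSpace_opn h hU
    have hEU : ∀ v, Ext v w → ∀ q, (v ⊩ q ∈ᵢ U) → v ⊩ rel E q U := fun w _ q hq =>
      quotientMap_of_mem h hE.at hU.at hq
    refine ⟨fun w _ h => ?_, fun w _ h => ?_⟩
    · exact compRel_of_isMatched hA.at hB.at hF.at hG.at hE.at hU'.at.1 hU'.at.2.1
        (fun v _ => hEU v inferInstance) h
    · exact compRel_of_isMatched hA.at hB.at hG.at hF.at hE.at hU'.at.1 hU'.at.2.2
        (fun v _ => hEU v inferInstance) h
  · set T : Space D := ⟨P₃, L₃, B₃⟩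
    have hcK : w ⊩ _ := isCompatible_coequalizer hA.at hB.at hT.at hF.at hG.at hK.at hc
    refine (exists_rel 𝒢 T.pt fun U r => allIn U fun q => rel K q r).elim fun w _ L hL =>
      .ex_intro L ⟨⟨?_, ?_⟩, fun L' w _ hL' w _ hf => ?_⟩
    · exact isMor_of_isFactor h.at hT.at hcK.at hK.at hL
    · exact factors_of_isFactor h.at hE.at hcK.at hK.at hL
    · exact eq_of_factors h.at hE.at hT.at hL.at hL'.at hf

end

end CZF

theorem mainTheorem9 :
    CZF.Provable CZF.Axioms (CZF.elementaryNID ⇒ᶠ CZF.hasCoequalizers).close :=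
  CZF.provable_of_model fun _ h => CZF.hasCoequalizers_of_elementaryNID h
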